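/- Let $k\ge 3$ be an integer and let $f^{(L)},f^{(R)}$ be real functions of $(x;\mu,\eta)$ that are $C^k$ in a neighbourhood of the origin of $\mathbb{R}^3$, with $$f^{(L)}(x;\mu,\eta)=\mu b(\mu,\eta)+a_L(\mu,\eta)x+p(\mu,\eta)x^2+q(\mu,\eta)x^3+o(x^3),\qquad f^{(R)}(x;\mu,\eta)=\mu b(\mu,\eta)+a_R(\mu,\eta)x+O(x^2).$$ Let $f(\cdot\,;\mu,\eta)$ be the map equal to $f^{(L)}$ for $x\le 0$ and to $f^{(R)}$ for $x\ge 0$. Suppose $a_L(0,0)=-1$, $b(0,0)=1$ and $\frac{\partial a_L}{\partial\eta}(0,0)=1$. Put $a_0=a_R(0,0)$ and $c_0=p(0,0)^2+q(0,0)$. Then there are a $C^k$ function $x^*(\mu,\eta)=\frac12\mu+O(\|(\mu,\eta)\|^2)$ and $C^{k-1}$ functions $h_1,h_2$, defined near the origin, with $$h_1(\mu)=-\Big(\tfrac{\partial a_L}{\partial\mu}+p\Big)\Big|_{(0,0)}\mu+O(\mu^2),\qquad h_2(\mu)=h_1(\mu)-\tfrac{c_0}{4}\mu^2+o(\mu^2),$$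 such that for every sufficiently small $\varepsilon>0$ there is $\delta\in(0,\varepsilon]$ for which the following hold whenever $|\mu|,|\eta|<\delta$ (along the curves $\eta=h_i(\mu)$: whenever $|\mu|<\delta$, where moreover $|h_i(\mu)|<\varepsilon$). 0. $x^*(\mu,\eta)$ is the only fixed point of $f^{(L)}$ in $|x|<\varepsilon$, and $|x^*(\mu,\eta)|<\delta$. 1. The multiplier $\frac{\partial f^{(L)}}{\partial x}(x^*(\mu,\eta);\mu,\eta)$ equals $-1$ exactly when $\eta=h_1(\mu)$. For $\mu<0$, $x^*(\mu,h_1(\mu))<0$ (so it is a fixed point of $f$), and if $c_0\ne0$ then as $\eta$ varies $f$ has a nondegenerate period-doubling bifurcation there: the usual transversality and cubic nondegeneracy conditions hold, and near the fixed point a two-cycle, unique and shrinking to it, exists on exactly one side of $\eta=h_1(\mu)$. 2. For $\mu\neq0$, the origin is a point of least period two of $f^{(L)}$ exactly when $\eta=h_2(\mu)$. For $\mu<0$ this orbit lies in $x\le0$, hence is a two-cycle of $f$. 3. Suppose $a_0\ne\pm1$ and $c_0\ne0$. The fixed points and two-cycles of $f$ in $|x|<\varepsilon$ are exactly the following, each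 of them unique when it exists. - A fixed point $x<0$ exists iff $\mu<0$; it is stable if $\eta>h_1(\mu)$ and unstable if $\eta<h_1(\mu)$. - The fixed point $x=0$ exists iff $\mu=0$. - A fixed point $x>0$ exists iff ($a_0<1$ and $\mu>0$) or ($a_0>1$ and $\mu<0$); it is stable if $|a_0|<1$ and unstable if $|a_0|>1$. - A two-cycle with both points negative exists iff $\mu<0$ and $\eta$ lies strictly between $h_1(\mu)$ and $h_2(\mu)$ (that is, $h_2(\mu)<\eta<h_1(\mu)$ if $c_0>0$, and $h_1(\mu)<\eta<h_2(\mu)$ if $c_0<0$); it is stable if $c_0>0$ and unstable if $c_0<0$. - A two-cycle with one negative and one positive point exists iff $\mu<0$ and either $a_0<-1$, $\eta>h_2(\mu)$ or $a_0>-1$, $\eta<h_2(\mu)$; it is stable if $|a_0|<1$ and unstable if $|a_0|>1$. - A two-cycle containing $0$ exists iff $\mu<0$ and $\eta=h_2(\mu)$; its other point is negative. Here stable (unstable) means that the multiplier of the orbit has modulus less than (greater than) $1$. 4. If $a_0<1$ or $\mu\ge0$ or $\eta\ge h_2(\mu)$, then $f$ has no $n$-cycle with $n\ge3$ contained in $|x|<\varepsilon$.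 5. If $a_0>1$, $\mu<0$ and $\eta<h_2(\mu)$, then $f$ is chaotic in $|x|<\varepsilon$: there is a compact set $S\subset(-\varepsilon,\varepsilon)$, mapped by $f$ into its own interior, on which $f$ has sensitive dependence on initial conditions, and $S$ contains a compact set $A$ with nonempty interior and $f(A)=A$ on which $f$ is chaotic in the sense of Devaney (topologically transitive, periodic points dense, sensitive dependence). The functions $h_1$ and $h_2$ are unique near $\mu=0$: a function $g$ with $g(0)=0$, continuous at $0$, which for all small $\mu$ (respectively all small $\mu\neq0$) gives $x^*(\mu,g(\mu))$ the multiplier $-1$ (respectively makes the origin a point of least period two of $f^{(L)}$ at $\eta=g(\mu)$) coincides near $0$ with $h_1$ (respectively $h_2$). -/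

import Mathlib

open Filter Topology Set Asymptotics

/-- The piecewise map `x ↦ f(x; μ, η)` with left half-map `fL` and right half-map `fR`;
arguments of the half-maps are ordered `x, μ, η`. -/
noncomputable def pwMap (fL fR : ℝ → ℝ → ℝ → ℝ) (μ η : ℝ) : ℝ → ℝ :=
  fun x => if x ≤ 0 then fL x μ η else fR x μ η

/-- The linear coefficient `a(μ, η) = ∂f/∂x (0; μ, η)` of a half-map. -/
noncomputable def aCoef (f : ℝ → ℝ → ℝ → ℝ) (μ η : ℝ) : ℝ :=
  deriv (fun x => f x μ η) 0

/-- The coefficient `p(μ, η)` of `x ^ 2` in a half-map. -/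
noncomputable def pCoef (f : ℝ → ℝ → ℝ → ℝ) (μ η : ℝ) : ℝ :=
  iteratedDeriv 2 (fun x => f x μ η) 0 / 2

/-- The coefficient `q(μ, η)` of `x ^ 3` in a half-map. -/
noncomputable def qCoef (f : ℝ → ℝ → ℝ → ℝ) (μ η : ℝ) : ℝ :=
  iteratedDeriv 3 (fun x => f x μ η) 0 / 6

/-- The coefficient `b(μ, η)`, with `f(0; μ, η) = μ * b(μ, η)`: it is `f(0; μ, η) / μ` for
`μ ≠ 0` (when `f(0; 0, η) = 0`) and `∂f/∂μ (0; 0, η)` for `μ = 0`. -/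
noncomputable def bCoef (f : ℝ → ℝ → ℝ → ℝ) (μ η : ℝ) : ℝ :=
  dslope (fun m => f 0 m η) 0 μ

/-- `c₀ = p(0,0)² + q(0,0)`. -/
noncomputable def c0Coef (f : ℝ → ℝ → ℝ → ℝ) : ℝ :=
  pCoef f 0 0 ^ 2 + qCoef f 0 0

/-- A one-dimensional piecewise-`C^k` continuous family near the origin whose two half-maps have
the common constant term `μ * b(μ, η)` (so the origin is a fixed point on the switching point
`x = 0` when `μ = 0`), with the singularity, non-degeneracy and transversality conditions of the
simultaneous border-collision and period-doubling. -/
structure IsBorderFlipFamily (k : ℕ) (fL fR : ℝ → ℝ → ℝ → ℝ) : Prop where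
  smooth_left : ContDiffAt ℝ k (fun z : ℝ × ℝ × ℝ => fL z.1 z.2.1 z.2.2) 0
  smooth_right : ContDiffAt ℝ k (fun z : ℝ × ℝ × ℝ => fR z.1 z.2.1 z.2.2) 0
  const_left : ∀ᶠ w : ℝ × ℝ in 𝓝 0, fL 0 w.1 w.2 = w.1 * bCoef fL w.1 w.2
  const_right : ∀ᶠ w : ℝ × ℝ in 𝓝 0, fR 0 w.1 w.2 = w.1 * bCoef fL w.1 w.2
  singularity : aCoef fL 0 0 = -1
  nondegeneracy : bCoef fL 0 0 = 1
  transversality : deriv (fun η => aCoef fL 0 η) 0 = 1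

/-- There is an object with property `P` exactly when `c` holds, and then it is unique. -/
def UniqueExactlyWhen {α : Type} (P : α → Prop) (c : Prop) : Prop :=
  (c → ∃! a, P a) ∧ ((∃ a, P a) → c)

/-- `{z.1, z.2}` is a two-cycle of `f`, listed in increasing order. -/
def IsTwoCycle (f : ℝ → ℝ) (z : ℝ × ℝ) : Prop :=
  z.1 < z.2 ∧ f z.1 = z.2 ∧ f z.2 = z.1

/-- The two-cycle lies in the interval `(c - ε, c + ε)`. -/
def CycleWithin (c ε : ℝ) (z : ℝ × ℝ) : Prop :=
  |z.1 - c| < ε ∧ |z.2 - c| < ε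

/-- `x`, a point of period `n`, has a multiplier of modulus less than one. -/
def StablePt (f : ℝ → ℝ) (n : ℕ) (x : ℝ) : Prop :=
  DifferentiableAt ℝ (f^[n]) x ∧ |deriv (f^[n]) x| < 1

/-- `x`, a point of period `n`, has a multiplier of modulus greater than one. -/
def UnstablePt (f : ℝ → ℝ) (n : ℕ) (x : ℝ) : Prop :=
  DifferentiableAt ℝ (f^[n]) x ∧ 1 < |deriv (f^[n]) x|

/-- The family `x ↦ g x η` has a (nondegenerate) period-doubling bifurcation at `x = x₀`,
`η = η₀`: there is a fixed point with multiplier `-1`, the usual transversality and cubic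
nondegeneracy conditions hold, and on exactly one side of `η₀` there is, locally, a two-cycle;
it is unique and shrinks to `x₀` as `η → η₀`. -/
structure IsPeriodDoubling (g : ℝ → ℝ → ℝ) (x₀ η₀ : ℝ) : Prop where
  fixed : g x₀ η₀ = x₀
  multiplier : deriv (fun x => g x η₀) x₀ = -1
  transversality :
    deriv (fun η => g x₀ η) η₀ * iteratedDeriv 2 (fun x => g x η₀) x₀
      + 2 * deriv (fun η => deriv (fun x => g x η) x₀) η₀ ≠ 0
  nondegeneracy :
    (1 / 2 : ℝ) * iteratedDeriv 2 (fun x => g x η₀) x₀ ^ 2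
      + (1 / 3 : ℝ) * iteratedDeriv 3 (fun x => g x η₀) x₀ ≠ 0
  branch : ∃ s : ℝ, (s = 1 ∨ s = -1) ∧ ∃ ε₀ > 0, ∀ ε, 0 < ε → ε ≤ ε₀ →
    ∃ ρ > 0, ∀ η, |η - η₀| < ρ →
      UniqueExactlyWhen (fun z => IsTwoCycle (fun x => g x η) z ∧ CycleWithin x₀ ε z)
        (0 < s * (η - η₀))

/-- The fixed points and two-cycles of `f` in `(-ε, ε)`, their position relative to the switching
point `0`, and their stability, at a parameter point `(μ, η)`. Here `η₁ = h₁(μ)`, `η₂ = h₂(μ)`,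
`a = a_R(0,0)` and `c = c₀`. -/
structure SectorPicture (f : ℝ → ℝ) (ε μ η η₁ η₂ a c : ℝ) : Prop where
  fixed_left : UniqueExactlyWhen (fun x => x ∈ Ioo (-ε) 0 ∧ f x = x) (μ < 0)
  fixed_zero : f 0 = 0 ↔ μ = 0
  fixed_right : UniqueExactlyWhen (fun x => x ∈ Ioo 0 ε ∧ f x = x)
    ((a < 1 ∧ 0 < μ) ∨ (1 < a ∧ μ < 0))
  /-- two-cycles with both points to the left of the switching point -/
  cycle_LL : UniqueExactlyWhen (fun z => IsTwoCycle f z ∧ CycleWithin 0 ε z ∧ z.2 < 0)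
    (μ < 0 ∧ ((0 < c ∧ η₂ < η ∧ η < η₁) ∨ (c < 0 ∧ η₁ < η ∧ η < η₂)))
  /-- two-cycles with a point on each side of the switching point -/
  cycle_LR : UniqueExactlyWhen (fun z => IsTwoCycle f z ∧ CycleWithin 0 ε z ∧ z.1 < 0 ∧ 0 < z.2)
    (μ < 0 ∧ ((a < -1 ∧ η₂ < η) ∨ (-1 < a ∧ η < η₂)))
  /-- two-cycles with a point on the switching point and a point to its left -/
  cycle_zero : UniqueExactlyWhen (fun z => IsTwoCycle f z ∧ CycleWithin 0 ε z ∧ z.2 = 0)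
    (μ < 0 ∧ η = η₂)
  /-- no other two-cycles -/
  cycle_none : ∀ z, IsTwoCycle f z → CycleWithin 0 ε z → z.1 < 0
  stab_left : ∀ x ∈ Ioo (-ε) 0, f x = x →
    (η₁ < η → StablePt f 1 x) ∧ (η < η₁ → UnstablePt f 1 x)
  stab_right : ∀ x ∈ Ioo 0 ε, f x = x →
    (|a| < 1 → StablePt f 1 x) ∧ (1 < |a| → UnstablePt f 1 x)
  stab_LL : ∀ z, IsTwoCycle f z → CycleWithin 0 ε z → z.2 < 0 →
    (0 < c → StablePt f 2 z.1 ∧ StablePt f 2 z.2) ∧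
    (c < 0 → UnstablePt f 2 z.1 ∧ UnstablePt f 2 z.2)
  stab_LR : ∀ z, IsTwoCycle f z → CycleWithin 0 ε z → z.1 < 0 → 0 < z.2 →
    (|a| < 1 → StablePt f 2 z.1 ∧ StablePt f 2 z.2) ∧
    (1 < |a| → UnstablePt f 2 z.1 ∧ UnstablePt f 2 z.2)

/-- `f` has an `n`-cycle contained in `(-ε, ε)`. -/
def HasCycleWithin (f : ℝ → ℝ) (n : ℕ) (ε : ℝ) : Prop :=
  ∃ x, 0 < n ∧ Function.minimalPeriod f x = n ∧ ∀ i : ℕ, |f^[i] x| < ε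

/-- Sensitive dependence on initial conditions of `f` on the set `A`. -/
def SensitiveOn (f : ℝ → ℝ) (A : Set ℝ) : Prop :=
  ∃ β > 0, ∀ x ∈ A, ∀ r > 0, ∃ y ∈ A, |y - x| < r ∧ ∃ n : ℕ, β ≤ |f^[n] y - f^[n] x|

/-- `f` is chaotic on the invariant set `A` in the sense of Devaney. -/
structure DevaneyChaotic (f : ℝ → ℝ) (A : Set ℝ) : Prop where
  nonempty : A.Nonempty
  invariant : f '' A = A
  transitive : ∀ U V : Set ℝ, IsOpen U → IsOpen V → (U ∩ A).Nonempty → (V ∩ A).Nonempty →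
    ∃ n : ℕ, ∃ x ∈ U ∩ A, f^[n] x ∈ V
  dense_periodic : A ⊆ closure {x ∈ A | ∃ n : ℕ, 0 < n ∧ Function.IsPeriodicPt f n x}
  sensitive : SensitiveOn f A

/-- `f` exhibits (attracting) chaos in `(-ε, ε)`: there is a compact trapping region in `(-ε, ε)`
on all of which `f` has sensitive dependence, and in it a compact invariant set with nonempty
interior on which `f` is chaotic. -/
def ExhibitsChaosWithin (f : ℝ → ℝ) (ε : ℝ) : Prop :=
  ∃ S A : Set ℝ, IsCompact S ∧ S ⊆ Ioo (-ε) ε ∧ MapsTo f S (interior S) ∧ SensitiveOn f S ∧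
    IsCompact A ∧ A ⊆ S ∧ (interior A).Nonempty ∧ DevaneyChaotic f A

/-! Near the origin `fL` is close to x ↦ μ - x and `fR` to x ↦ μ + a₀ x. At fixed parameters the
dynamics is decided by secant slopes, by the derivative of the second iterate of `fL`, and by two
signs: that of (multiplier + 1) at x*, and that of the second return w = L(L 0) of the switching
point.

Curves. The implicit function theorem gives x*, with μ-slope 1/2. The multiplier at x* has
η-derivative 1, and its level -1 is h₁. The second return of 0 vanishes at μ = 0; dividing it by μ
leaves V with η-derivative 1, whose zero set is h₂. On h₁ the second iterate agrees with the
identity to second order at x*, and its third derivative is near -12 c₀. Hence w ≈ 2 c₀ x*³ ≈ c₀ μ³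
/ 4 there, and V ≈ η - h₂ turns this into h₁ - h₂ ≈ c₀ μ² / 4 (`FlipGerm.isLittleO_curves`).

Short cycles. The sign of c₀ times the derivative of L ∘ L is strictly concave, so L ∘ L has at most
three fixed points: x* and one two-cycle. The same concavity gives the stability of that cycle
(`FlipMaps.cycle_left`). A cycle crossing 0 is a fixed point of y ↦ L(R y) ≈ w - a₀ y, so it exists
when w and a₀ + 1 have the same sign (`FlipMaps.cycle_right`).

Long cycles. If a₀ < 0 the map is decreasing. If a₀ ≥ 1 and f(0) ≥ 0 or w ≤ 0, the orbit lies on one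
monotone side. If 0 ≤ a₀ < 1, the second iterate contracts the positive points of the orbit.

Chaos. If a₀ > 1, μ < 0 and w > 0, f exchanges a small interval around 0 with one around f(0), and
its second iterate on the former is close to a skew tent with slopes 1 and -a₀. Slope 1 does not
expand, but that branch shifts points right by about w. The metric with density 1 + θ x / w grows
along the shift, so both branches expand uniformly (`exists_cover_of_near_skewTent`). An expanding
unimodal map has a window covered by an iterate of every interval (`exists_cover_of_expanding`), and
this covering property gives density of periodic points, transitivity and sensitivity
(`exhibitsChaosWithin_of_cover`). -/

/-! ### Chaos from a window covered by iterates of every interval. -/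

theorem exists_Icc_subset_near {c d y r : ℝ} (hcd : c < d) (hy : y ∈ Icc c d) (hr : 0 < r) :
    ∃ p q, p < q ∧ Icc p q ⊆ Icc c d ∧ Icc p q ⊆ Ioo (y - r) (y + r) := by
  rcases lt_or_eq_of_le hy.2 with h | h
  · refine ⟨y, min d (y + r / 2), lt_min h (by linarith), ?_, ?_⟩
    · exact Icc_subset_Icc hy.1 (min_le_left _ _)
    · rintro z ⟨h1, h2⟩
      have := h2.trans (min_le_right _ _)
      exact ⟨by linarith, by linarith⟩
  · refine ⟨max c (y - r / 2), y, max_lt (h ▸ hcd) (by linarith), ?_, ?_⟩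
    · exact Icc_subset_Icc (le_max_left _ _) hy.2
    · rintro z ⟨h1, h2⟩
      have := (le_max_right _ _).trans h1
      exact ⟨by linarith, by linarith⟩

theorem exists_fixedPt_of_Icc_subset_image {h : ℝ → ℝ} {p q : ℝ} (hpq : p ≤ q)
    (hc : ContinuousOn h (Icc p q)) (hs : Icc p q ⊆ h '' Icc p q) :
    ∃ x ∈ Icc p q, h x = x := by
  obtain ⟨a, ha, hap⟩ := hs (left_mem_Icc.2 hpq)
  obtain ⟨b, hb, hbq⟩ := hs (right_mem_Icc.2 hpq)
  exact isPreconnected_Icc.intermediate_value₂ ha hb hc continuousOn_id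
    (by rw [hap]; exact ha.1) (by rw [hbq]; exact hb.2)

/-- An endpoint of the window is at least half its length away from the n-th iterate of x, and a
point near x is mapped onto that endpoint. -/
theorem sensitiveOn_of_cover {f : ℝ → ℝ} {u v : ℝ} {T : Set ℝ} (huv : u < v)
    (h : ∀ x ∈ T, ∀ r > 0, ∃ p q, Icc p q ⊆ T ∧ Icc p q ⊆ Ioo (x - r) (x + r) ∧
      ∃ n : ℕ, Icc u v ⊆ f^[n] '' Icc p q) : SensitiveOn f T := by
  refine ⟨(v - u) / 2, by linarith, fun x hx r hr => ?_⟩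
  obtain ⟨p, q, hT, hr', n, hn⟩ := h x hx r hr
  have key : ∃ z ∈ Icc u v, (v - u) / 2 ≤ |z - f^[n] x| := by
    by_cases hz : (u + v) / 2 ≤ f^[n] x
    · exact ⟨u, left_mem_Icc.2 huv.le, by rw [abs_sub_comm]; exact le_trans (by linarith) (le_abs_self _)⟩
    · exact ⟨v, right_mem_Icc.2 huv.le, le_trans (by linarith) (le_abs_self _)⟩
  obtain ⟨z, hz, hd⟩ := key
  obtain ⟨y, hy, rfl⟩ := hn hz
  have := hr' hy
  exact ⟨y, hT hy, abs_sub_lt_iff.2 ⟨by linarith [this.2], by linarith [this.1]⟩, n, hd⟩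

/-- If every nondegenerate interval in a thick compact trapping region `S` has an iterate covering
a fixed nondegenerate interval, then `f` is chaotic. -/
theorem exhibitsChaosWithin_of_cover {f : ℝ → ℝ} {ε u v : ℝ} {S : Set ℝ} (hSc : IsCompact S)
    (hSε : S ⊆ Ioo (-ε) ε) (hf : ContinuousOn f S) (hmap : MapsTo f S (interior S))
    (huv : u < v) (huvS : Icc u v ⊆ S)
    (hthick : ∀ x ∈ S, ∀ r > 0, ∃ p q, p < q ∧ Icc p q ⊆ S ∧ Icc p q ⊆ Ioo (x - r) (x + r))
    (hcov : ∀ x y, x < y → Icc x y ⊆ S → ∃ n : ℕ, Icc u v ⊆ f^[n] '' Icc x y) :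
    ExhibitsChaosWithin f ε := by
  have hmapS : MapsTo f S S := hmap.mono_right interior_subset
  have hmapn : ∀ n, MapsTo f^[n] S S := fun n => hmapS.iterate n
  have hcontn : ∀ n, ContinuousOn f^[n] S := fun n => hf.iterate hmapS n
  set W := Icc u v with hW
  -- the window returns over itself
  obtain ⟨k, hk0, hk⟩ : ∃ k : ℕ, 0 < k ∧ W ⊆ f^[k] '' W := by
    -- Covering from half of the window excludes n = 0.
    obtain ⟨n, hn⟩ := hcov u ((u + v) / 2) (by linarith)
      ((Icc_subset_Icc le_rfl (by linarith)).trans huvS)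
    refine ⟨n, Nat.pos_of_ne_zero ?_, hn.trans (image_mono (Icc_subset_Icc le_rfl (by linarith)))⟩
    rintro rfl
    have := hn (right_mem_Icc.2 huv.le)
    simp only [Function.iterate_zero, image_id] at this
    linarith [this.2]
  have hkm : ∀ j, W ⊆ f^[k * j] '' W := by
    intro j
    induction j with
    | zero => simp
    | succ j ih =>
      rw [Nat.mul_succ, Function.iterate_add, image_comp]
      exact ih.trans (image_mono hk)
  have hWS : ∀ n, f^[n] '' W ⊆ S := fun n =>
    (image_mono huvS).trans (hmapn n).image_subset
  -- the images of the window are nondegenerate intervals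
  have hint : ∀ n, ∃ c d, c < d ∧ f^[n] '' W = Icc c d := by
    intro n
    have him := ((hcontn n).mono huvS).image_Icc huv.le
    refine ⟨_, _, ?_, him⟩
    by_contra hcon
    have hsub : (f^[n] '' W).Subsingleton := by
      rw [him]; exact subsingleton_Icc_of_ge (not_lt.1 hcon)
    -- A degenerate n-th image would make every later image degenerate, but the image at time k * n
    -- contains the window.
    obtain ⟨m, hm⟩ : ∃ m, k * n = m + n := ⟨k * n - n, by
      have : 1 * n ≤ k * n := Nat.mul_le_mul_right n hk0
      omega⟩
    have h2 : (f^[k * n] '' W).Subsingleton := by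
      rw [hm, Function.iterate_add, image_comp]; exact hsub.image _
    have := h2.anti (hkm n) (left_mem_Icc.2 huv.le) (right_mem_Icc.2 huv.le)
    linarith
  set O := ⋃ n, f^[n] '' W with hO
  set A := closure O with hA
  have hOS : O ⊆ S := iUnion_subset hWS
  have hAS : A ⊆ S := closure_minimal hOS hSc.isClosed
  have hAc : IsCompact A := hSc.of_isClosed_subset isClosed_closure hAS
  have hOA : O ⊆ A := subset_closure
  have hWO : ∀ n, f^[n] '' W ⊆ O := fun n => subset_iUnion (fun n => f^[n] '' W) n
  have hWA : W ⊆ A := by simpa using (hWO 0).trans hOA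
  have hthickA : ∀ x ∈ A, ∀ r > 0, ∃ m : ℕ, 0 < m ∧ ∃ p q, p < q ∧ Icc p q ⊆ f^[m] '' W ∧
      Icc p q ⊆ Ioo (x - r) (x + r) := by
    intro x hx r hr
    obtain ⟨y, hyO, hxy⟩ := Metric.mem_closure_iff.1 hx (r / 2) (by linarith)
    obtain ⟨m, hm⟩ := mem_iUnion.1 hyO
    -- Passing from m to m + k makes the exponent positive; it later enters a period.
    have hm' : y ∈ f^[m + k] '' W := by
      rw [Function.iterate_add, image_comp]; exact image_mono hk hm
    obtain ⟨c, d, hcd, hE⟩ := hint (m + k)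
    rw [hE] at hm'
    obtain ⟨p, q, hpq, h1, h2⟩ := exists_Icc_subset_near hcd hm' (half_pos hr)
    refine ⟨m + k, by omega, p, q, hpq, hE ▸ h1, h2.trans ?_⟩
    rw [Real.dist_eq, abs_lt] at hxy
    exact Ioo_subset_Ioo (by linarith) (by linarith)
  have hcovA : ∀ x ∈ A, ∀ r > 0, ∃ p q, Icc p q ⊆ A ∧ Icc p q ⊆ Ioo (x - r) (x + r) ∧
      ∃ n : ℕ, W ⊆ f^[n] '' Icc p q := by
    intro x hx r hr
    obtain ⟨m, -, p, q, hpq, h1, h2⟩ := hthickA x hx r hr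
    have h3 := h1.trans (hWO m)
    exact ⟨p, q, h3.trans hOA, h2, hcov p q hpq (h3.trans hOS)⟩
  have hball : ∀ {U : Set ℝ} {x : ℝ}, IsOpen U → x ∈ U → ∃ r > 0, Ioo (x - r) (x + r) ⊆ U := by
    intro U x hU hx
    obtain ⟨r, hr, h⟩ := Metric.isOpen_iff.1 hU x hx
    exact ⟨r, hr, by rwa [Real.ball_eq_Ioo] at h⟩
  refine ⟨S, A, hSc, hSε, hmap, sensitiveOn_of_cover huv ?_, hAc, hAS, ?_, ?_⟩
  · intro x hx r hr
    obtain ⟨p, q, hpq, h1, h2⟩ := hthick x hx r hr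
    exact ⟨p, q, h1, h2, hcov p q hpq h1⟩
  · have : Ioo u v ⊆ interior A :=
      interior_maximal (Ioo_subset_Icc_self.trans hWA) isOpen_Ioo
    exact (nonempty_Ioo.2 huv).mono this
  · refine ⟨⟨u, hWA (left_mem_Icc.2 huv.le)⟩, ?_, ?_, ?_, sensitiveOn_of_cover huv hcovA⟩
    · apply Subset.antisymm
      · have h1 : f '' A ⊆ closure (f '' O) := (hf.mono hAS).image_closure
        refine h1.trans (closure_mono ?_)
        rw [hO, image_iUnion]
        refine iUnion_subset fun n => ?_
        rw [← image_comp, ← Function.iterate_succ']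
        exact hWO (n + 1)
      · refine closure_minimal (iUnion_subset fun n => ?_)
          (hAc.image_of_continuousOn (hf.mono hAS)).isClosed
        have h1 : f^[n] '' W ⊆ f^[n + k] '' W := by
          rw [Function.iterate_add, image_comp]; exact image_mono hk
        obtain ⟨j, hj⟩ : ∃ j, n + k = j + 1 := ⟨n + k - 1, by omega⟩
        refine h1.trans ?_
        rw [hj, Function.iterate_succ', image_comp]
        exact image_mono ((hWO j).trans hOA)
    · rintro U V hU hV ⟨x, hxU, hxA⟩ ⟨z, hzV, hzA⟩
      obtain ⟨r, hr, hrU⟩ := hball hU hxU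
      obtain ⟨p, q, h1, h2, n, hn⟩ := hcovA x hxA r hr
      obtain ⟨y, hyV, hyO⟩ := mem_closure_iff.1 hzA V hV hzV
      obtain ⟨m, w, hw, rfl⟩ := mem_iUnion.1 hyO
      obtain ⟨t, ht, rfl⟩ := hn hw
      exact ⟨m + n, t, ⟨hrU (h2 ht), h1 ht⟩, by rwa [Function.iterate_add]⟩
    · intro x hxA
      rw [Metric.mem_closure_iff]
      intro r hr
      obtain ⟨m, hm, p, q, hpq, h1, h2⟩ := hthickA x hxA r hr
      have h3 := h1.trans (hWO m)
      obtain ⟨n, hn⟩ := hcov p q hpq (h3.trans hOS)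
      -- The small interval lies in an image of the window, and the window lies in an image of the
      -- small interval. So an iterate maps the small interval over itself and has a fixed point in
      -- it.
      have h4 : Icc p q ⊆ f^[m + n] '' Icc p q := by
        rw [Function.iterate_add, image_comp]
        exact h1.trans (image_mono hn)
      obtain ⟨t, ht, hfix⟩ := exists_fixedPt_of_Icc_subset_image hpq.le
        ((hcontn (m + n)).mono (h3.trans hOS)) h4
      refine ⟨t, ⟨hOA (h3 ht), m + n, by omega, hfix⟩, ?_⟩
      have := h2 ht
      rw [Real.dist_eq, abs_sub_lt_iff]
      exact ⟨by linarith [this.1], by linarith [this.2]⟩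

/-! ### Expanding unimodal interval maps. -/

section Expanding

variable {g ψ : ℝ → ℝ} {α β ρ : ℝ}

/-- As long as two orbits stay strictly on the same side of the turning point, their ψ-distance
grows by the factor ρ. That distance is at most ψ β - ψ α, so they must separate. -/
theorem exists_separation_of_expanding (hmap : MapsTo g (Icc α β) (Icc α β))
    (hψ : StrictMonoOn ψ (Icc α β)) (hρ : 1 < ρ)
    (hexp : ∀ x ∈ Icc α β, ∀ y ∈ Icc α β, 0 < x * y → ρ * |ψ x - ψ y| ≤ |ψ (g x) - ψ (g y)|)
    {x y : ℝ} (hx : x ∈ Icc α β) (hy : y ∈ Icc α β) (hxy : x ≠ y) :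
    ∃ n : ℕ, g^[n] x * g^[n] y ≤ 0 ∧ ρ ^ n * |ψ x - ψ y| ≤ |ψ (g^[n] x) - ψ (g^[n] y)| := by
  have hm : ∀ n, MapsTo g^[n] (Icc α β) (Icc α β) := fun n => hmap.iterate n
  have hgrow : ∀ n : ℕ, (∀ j < n, 0 < g^[j] x * g^[j] y) →
      ρ ^ n * |ψ x - ψ y| ≤ |ψ (g^[n] x) - ψ (g^[n] y)| := by
    intro n
    induction n with
    | zero => intro _; simp
    | succ n ih =>
      intro h
      have h1 := ih fun j hj => h j (by omega)
      have h2 := hexp _ (hm n hx) _ (hm n hy) (h n (by omega))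
      simp only [Function.iterate_succ', Function.comp_apply]
      calc ρ ^ (n + 1) * |ψ x - ψ y| = ρ * (ρ ^ n * |ψ x - ψ y|) := by ring
        _ ≤ ρ * |ψ (g^[n] x) - ψ (g^[n] y)| := by gcongr
        _ ≤ _ := h2
  have hpos : 0 < |ψ x - ψ y| := abs_pos.2 (sub_ne_zero.2 fun h => hxy (hψ.injOn hx hy h))
  have hex : ∃ n : ℕ, g^[n] x * g^[n] y ≤ 0 := by
    by_contra! hcon
    obtain ⟨n, hn⟩ := pow_unbounded_of_one_lt ((ψ β - ψ α) / |ψ x - ψ y|) hρ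
    have h1 := hgrow n fun j _ => hcon j
    rw [div_lt_iff₀ hpos] at hn
    have hb : ∀ z ∈ Icc α β, ψ α ≤ ψ z ∧ ψ z ≤ ψ β := fun z hz =>
      ⟨hψ.monotoneOn (left_mem_Icc.2 (hz.1.trans hz.2)) hz hz.1,
        hψ.monotoneOn hz (right_mem_Icc.2 (hz.1.trans hz.2)) hz.2⟩
    have h2 := hb _ (hm n hx)
    have h3 := hb _ (hm n hy)
    have : |ψ (g^[n] x) - ψ (g^[n] y)| ≤ ψ β - ψ α := abs_sub_le_iff.2 ⟨by linarith, by linarith⟩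
    linarith
  classical
  exact ⟨Nat.find hex, Nat.find_spec hex, hgrow _ fun j hj => not_le.1 (Nat.find_min hex hj)⟩

/-- A continuous unimodal interval map that expands a suitable metric uniformly on each side of its
turning point has a window, ending at the maximal value, which is covered by an iterate of every
nondegenerate interval. -/
theorem exists_cover_of_expanding (hα : α < 0) (hβ : 0 < β)
    (hg : ContinuousOn g (Icc α β)) (hmap : MapsTo g (Icc α β) (Icc α β))
    (hψ : StrictMonoOn ψ (Icc α β)) (hψc : ContinuousOn ψ (Icc α β)) (hρ : 1 < ρ)
    (hL : ∀ x y, α ≤ x → x < y → y ≤ 0 → ρ * (ψ y - ψ x) ≤ ψ (g y) - ψ (g x))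
    (hR : ∀ x y, 0 ≤ x → x < y → y ≤ β → ρ * (ψ y - ψ x) ≤ ψ (g x) - ψ (g y)) :
    ∃ u v, u < v ∧ Icc u v ⊆ Icc α β ∧
      ∀ x y, x < y → Icc x y ⊆ Icc α β → ∃ n : ℕ, Icc u v ⊆ g^[n] '' Icc x y := by
  have hm : ∀ n, MapsTo g^[n] (Icc α β) (Icc α β) := fun n => hmap.iterate n
  have hcn : ∀ n, ContinuousOn g^[n] (Icc α β) := fun n => hg.iterate hmap n
  have h0 : (0 : ℝ) ∈ Icc α β := ⟨hα.le, hβ.le⟩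
  set s := g 0 with hs
  have hsI : s ∈ Icc α β := hmap h0
  have hexp : ∀ x ∈ Icc α β, ∀ y ∈ Icc α β, 0 < x * y →
      ρ * |ψ x - ψ y| ≤ |ψ (g x) - ψ (g y)| := by
    intro x hx y hy hxy
    wlog h : x ≤ y generalizing x y
    · have := this y hy x hx (by linarith [mul_comm x y]) (by linarith)
      rwa [abs_sub_comm (ψ y), abs_sub_comm (ψ (g y))] at this
    rcases h.eq_or_lt with rfl | h
    · simp
    have h1 : |ψ x - ψ y| = ψ y - ψ x := by
      rw [abs_sub_comm]; exact abs_of_pos (sub_pos.2 (hψ hx hy h))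
    rw [h1]
    rcases pos_and_pos_or_neg_and_neg_of_mul_pos hxy with ⟨h2, h3⟩ | ⟨h2, h3⟩
    · exact (hR x y h2.le h hy.2).trans (le_abs_self _)
    · rw [abs_sub_comm]
      exact (hL x y hx.1 h h3.le).trans (le_abs_self _)
  -- images of one-sided intervals at the turning point end at the maximal value
  have hfold : ∀ z ∈ Icc α β, z ≠ 0 → g z < s ∧ ρ * |ψ 0 - ψ z| ≤ ψ s - ψ (g z) := by
    intro z hz hz0
    have key : ρ * |ψ 0 - ψ z| ≤ ψ s - ψ (g z) ∧ 0 < |ψ 0 - ψ z| := by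
      rcases lt_or_gt_of_ne hz0 with h | h
      · have h1 := hψ hz h0 h
        rw [abs_of_pos (sub_pos.2 h1)]
        exact ⟨hL z 0 hz.1 h le_rfl, sub_pos.2 h1⟩
      · have h1 := hψ h0 hz h
        rw [abs_sub_comm, abs_of_pos (sub_pos.2 h1)]
        exact ⟨hR 0 z le_rfl h hz.2, sub_pos.2 h1⟩
    refine ⟨?_, key.1⟩
    by_contra hcon
    have h1 := hψ.monotoneOn hsI (hmap hz) (not_lt.1 hcon)
    nlinarith [key.1, key.2]
  have himg : ∀ {K : Set ℝ} {n : ℕ} {a b : ℝ}, uIcc a b ⊆ K → K ⊆ Icc α β →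
      uIcc (g^[n] a) (g^[n] b) ⊆ g^[n] '' K := fun {K n a b} h1 h2 =>
    (intermediate_value_uIcc ((hcn n).mono (h1.trans h2))).trans (image_mono h1)
  have hnext : ∀ {K : Set ℝ} {n : ℕ} {z : ℝ}, z ∈ Icc α β → z ≠ 0 → uIcc 0 z ⊆ g^[n] '' K →
      Icc (g z) s ⊆ g^[n + 1] '' K := by
    intro K n z hz hz0 hK
    have h1 : uIcc 0 z ⊆ Icc α β := (convex_Icc α β).ordConnected.uIcc_subset h0 hz
    have h2 := intermediate_value_uIcc (hg.mono h1)
    rw [Function.iterate_succ', image_comp]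
    refine Subset.trans ?_ (h2.trans (image_mono hK))
    rw [uIcc_comm]
    exact Icc_subset_uIcc
  -- An interval cut at the turning point can lose half of its length. Separation times n ≥ n₀
  -- compensate for this; the finitely many earlier times are handled by e, a lower bound for the
  -- ψ-distance from 0 to the nonzero points g^[j] s with j < n₀.
  obtain ⟨n₀, hn₀⟩ := pow_unbounded_of_one_lt 2 hρ
  obtain ⟨e, he, hej⟩ : ∃ e > 0, ∀ j < n₀, g^[j] s ≠ 0 → e ≤ |ψ 0 - ψ (g^[j] s)| := by
    clear hn₀
    induction n₀ with
    | zero => exact ⟨1, one_pos, fun j hj => absurd hj (by omega)⟩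
    | succ n ih =>
      obtain ⟨e, he, h⟩ := ih
      by_cases hz : g^[n] s = 0
      · refine ⟨e, he, fun j hj hj0 => ?_⟩
        rcases Nat.lt_succ_iff_lt_or_eq.1 hj with h1 | rfl
        · exact h j h1 hj0
        · exact absurd hz hj0
      · refine ⟨min e |ψ 0 - ψ (g^[n] s)|, lt_min he (abs_pos.2 (sub_ne_zero.2 fun h' =>
          hz (hψ.injOn h0 (hm n hsI) h').symm)), fun j hj hj0 => ?_⟩
        rcases Nat.lt_succ_iff_lt_or_eq.1 hj with h1 | rfl
        · exact (min_le_left _ _).trans (h j h1 hj0)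
        · exact min_le_right _ _
  have hmono : ∀ x ∈ Icc α β, ∀ y ∈ Icc α β, ψ x ≤ ψ y → x ≤ y := fun x hx y hy h =>
    (hψ.le_iff_le hx hy).1 h
  -- growth of windows ending at the maximal value
  have hgrow : ∀ v ∈ Icc α β, v < s → ∃ n : ℕ, ∃ v' ∈ Icc α β, v' < s ∧
      Icc v' s ⊆ g^[n] '' Icc v s ∧ (e ≤ ψ s - ψ v' ∨ ρ * (ψ s - ψ v) ≤ ψ s - ψ v') := by
    intro v hv hvs
    have hsub : Icc v s ⊆ Icc α β := Icc_subset_Icc hv.1 hsI.2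
    have hd : |ψ v - ψ s| = ψ s - ψ v := by
      rw [abs_sub_comm]; exact abs_of_pos (sub_pos.2 (hψ hv hsI hvs))
    have hdpos : 0 < ψ s - ψ v := sub_pos.2 (hψ hv hsI hvs)
    obtain ⟨n, hn, hD⟩ := exists_separation_of_expanding hmap hψ hρ hexp hv hsI hvs.ne
    rw [hd] at hD
    have hρn : 1 ≤ ρ ^ n := one_le_pow₀ hρ.le
    have hKn : uIcc (g^[n] v) (g^[n] s) ⊆ g^[n] '' Icc v s :=
      himg (uIcc_of_le hvs.le).subset hsub
    have h0u : (0 : ℝ) ∈ uIcc (g^[n] v) (g^[n] s) := by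
      rw [mem_uIcc]
      rcases mul_nonpos_iff.1 hn with h | h
      · exact Or.inr ⟨h.2, h.1⟩
      · exact Or.inl ⟨h.1, h.2⟩
    have hK1 : uIcc 0 (g^[n] v) ⊆ g^[n] '' Icc v s :=
      (uIcc_subset_uIcc h0u left_mem_uIcc).trans hKn
    have hK2 : uIcc 0 (g^[n] s) ⊆ g^[n] '' Icc v s :=
      (uIcc_subset_uIcc h0u right_mem_uIcc).trans hKn
    have hvn := hm n hv
    have hsn := hm n hsI
    -- If the orbit of s hits the turning point, the image interval is not cut and one more step
    -- gains ρ. Otherwise an early time gives a piece of size e, and at a late time the larger of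
    -- the two pieces is at least as long as the original window.
    by_cases hs0 : g^[n] s = 0
    · have hv0 : g^[n] v ≠ 0 := by
        intro h
        rw [h, hs0, sub_self, abs_zero] at hD
        nlinarith
      refine ⟨n + 1, _, hmap hvn, (hfold _ hvn hv0).1, hnext hvn hv0 hK1, Or.inr ?_⟩
      refine le_trans ?_ (hfold _ hvn hv0).2
      rw [hs0, abs_sub_comm] at hD
      have : ψ s - ψ v ≤ |ψ 0 - ψ (g^[n] v)| := by nlinarith
      gcongr
    · by_cases hnn : n < n₀
      · refine ⟨n + 1, _, hmap hsn, (hfold _ hsn hs0).1, hnext hsn hs0 hK2, Or.inl ?_⟩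
        have h1 := hej n hnn hs0
        have h2 := (hfold _ hsn hs0).2
        nlinarith
      · have h2n : 2 ≤ ρ ^ n := hn₀.le.trans (pow_le_pow_right₀ hρ.le (not_lt.1 hnn))
        have htri : |ψ (g^[n] v) - ψ (g^[n] s)| ≤ |ψ 0 - ψ (g^[n] v)| + |ψ 0 - ψ (g^[n] s)| := by
          rw [abs_sub_comm (ψ 0) (ψ (g^[n] v))]; exact abs_sub_le _ _ _
        rcases le_total |ψ 0 - ψ (g^[n] v)| |ψ 0 - ψ (g^[n] s)| with hle | hle
        · refine ⟨n + 1, _, hmap hsn, (hfold _ hsn hs0).1, hnext hsn hs0 hK2, Or.inr ?_⟩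
          refine le_trans ?_ (hfold _ hsn hs0).2
          have : ψ s - ψ v ≤ |ψ 0 - ψ (g^[n] s)| := by nlinarith
          gcongr
        · have h3 : ψ s - ψ v ≤ |ψ 0 - ψ (g^[n] v)| := by nlinarith
          have hv0 : g^[n] v ≠ 0 := by
            intro h
            rw [h, sub_self, abs_zero] at h3
            linarith
          refine ⟨n + 1, _, hmap hvn, (hfold _ hvn hv0).1, hnext hvn hv0 hK1, Or.inr ?_⟩
          refine le_trans ?_ (hfold _ hvn hv0).2
          gcongr
  have hiter : ∀ v ∈ Icc α β, v < s → ∀ k : ℕ, ∃ n : ℕ, ∃ v' ∈ Icc α β, v' < s ∧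
      Icc v' s ⊆ g^[n] '' Icc v s ∧ (e ≤ ψ s - ψ v' ∨ ρ ^ k * (ψ s - ψ v) ≤ ψ s - ψ v') := by
    intro v hv hvs k
    induction k with
    | zero => exact ⟨0, v, hv, hvs, by simp, Or.inr (by simp)⟩
    | succ k ih =>
      obtain ⟨n, v', hv', hv's, hK, h | h⟩ := ih
      · exact ⟨n, v', hv', hv's, hK, Or.inl h⟩
      · obtain ⟨m, w, hw, hws, hK', h'⟩ := hgrow v' hv' hv's
        refine ⟨m + n, w, hw, hws, ?_, h'.imp id fun h' => ?_⟩
        · rw [Function.iterate_add, image_comp]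
          exact hK'.trans (image_mono hK)
        · rw [pow_succ']
          nlinarith
  have hbig : ∀ v ∈ Icc α β, v < s → ∃ n : ℕ, ∃ v' ∈ Icc α β, v' < s ∧
      Icc v' s ⊆ g^[n] '' Icc v s ∧ e ≤ ψ s - ψ v' := by
    intro v hv hvs
    have hdpos : 0 < ψ s - ψ v := sub_pos.2 (hψ hv hsI hvs)
    obtain ⟨k, hk⟩ := pow_unbounded_of_one_lt ((ψ s - ψ α) / (ψ s - ψ v)) hρ
    rw [div_lt_iff₀ hdpos] at hk
    obtain ⟨n, v', hv', hv's, hK, h | h⟩ := hiter v hv hvs k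
    · exact ⟨n, v', hv', hv's, hK, h⟩
    · have := hψ.monotoneOn (left_mem_Icc.2 (hα.trans hβ).le) hv' hv'.1
      linarith
  -- a window of size at most `e`
  have hαs : α < s := hα.trans_le (by
    by_contra hcon
    have h1 := (hfold _ hsI (not_le.1 hcon).ne)
    have h2 := hL s 0 hsI.1 (not_le.1 hcon) le_rfl
    have h3 := hψ hsI h0 (not_le.1 hcon)
    -- iterating below the turning point would increase the orbit
    obtain ⟨n, hn, hD⟩ := exists_separation_of_expanding hmap hψ hρ hexp (hmap hsI) hsI h1.1.ne
    have hneg : ∀ x ∈ Icc α β, g x < 0 := fun x hx => by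
      by_cases hx0 : x = 0
      · rw [hx0]; exact not_le.1 hcon
      · exact (hfold x hx hx0).1.trans (not_le.1 hcon)
    have hneg' : ∀ n, ∀ x ∈ Icc α β, x < 0 → g^[n] x < 0 := by
      intro n x hx hx0
      cases n with
      | zero => exact hx0
      | succ n => rw [Function.iterate_succ', Function.comp_apply]; exact hneg _ (hm n hx)
    have := mul_pos_of_neg_of_neg (hneg' n _ (hmap hsI) (hneg s hsI))
      (hneg' n s hsI (not_le.1 hcon))
    linarith)
  obtain ⟨u, huI, hus, hue⟩ : ∃ u ∈ Icc α β, u < s ∧ ψ s - ψ u ≤ e := by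
    have h1 : ContinuousOn ψ (Icc α s) := hψc.mono (Icc_subset_Icc le_rfl hsI.2)
    by_cases hse : ψ s - ψ α ≤ e
    · exact ⟨α, left_mem_Icc.2 (hα.trans hβ).le, hαs, hse⟩
    · obtain ⟨u, hu, hue⟩ := intermediate_value_Icc hαs.le h1
        (show ψ s - e ∈ Icc (ψ α) (ψ s) from ⟨by linarith, by linarith⟩)
      refine ⟨u, ⟨hu.1, hu.2.trans hsI.2⟩, lt_of_le_of_ne hu.2 ?_, by linarith⟩
      rintro rfl
      linarith
  refine ⟨u, s, hus, Icc_subset_Icc huI.1 hsI.2, fun x y hxy hK => ?_⟩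
  have hx : x ∈ Icc α β := hK (left_mem_Icc.2 hxy.le)
  have hy : y ∈ Icc α β := hK (right_mem_Icc.2 hxy.le)
  obtain ⟨n, hn, hD⟩ := exists_separation_of_expanding hmap hψ hρ hexp hx hy hxy.ne
  have hpos : 0 < |ψ x - ψ y| := abs_pos.2 (sub_ne_zero.2 fun h => hxy.ne (hψ.injOn hx hy h))
  have hKn : uIcc (g^[n] x) (g^[n] y) ⊆ g^[n] '' Icc x y :=
    himg (uIcc_of_le hxy.le).subset hK
  have h0u : (0 : ℝ) ∈ uIcc (g^[n] x) (g^[n] y) := by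
    rw [mem_uIcc]
    rcases mul_nonpos_iff.1 hn with h | h
    · exact Or.inr ⟨h.2, h.1⟩
    · exact Or.inl ⟨h.1, h.2⟩
  -- Once an image of the interval contains the turning point, the next image contains an interval
  -- ending at s, to which the window growth applies.
  obtain ⟨z, hz, hz0, hzK⟩ : ∃ z ∈ Icc α β, z ≠ 0 ∧ uIcc 0 z ⊆ g^[n] '' Icc x y := by
    by_cases hxn : g^[n] x = 0
    · refine ⟨g^[n] y, hm n hy, fun h => ?_, (uIcc_subset_uIcc h0u right_mem_uIcc).trans hKn⟩
      rw [hxn, h, sub_self, abs_zero] at hD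
      have : 0 < ρ ^ n := by positivity
      nlinarith
    · exact ⟨g^[n] x, hm n hx, hxn, (uIcc_subset_uIcc h0u left_mem_uIcc).trans hKn⟩
  obtain ⟨m, v', hv', hv's, hK', hbig'⟩ := hbig _ (hmap hz) (hfold z hz hz0).1
  refine ⟨m + (n + 1), ?_⟩
  rw [Function.iterate_add, image_comp]
  refine Subset.trans (Icc_subset_Icc ?_ le_rfl) (hK'.trans (image_mono (hnext hz hz0 hzK)))
  exact hmono v' hv' u huI (by linarith)

end Expanding

/-! ### The second iterate as a perturbed skew tent map. -/

/-- The map equal to `L` on `x ≤ 0` and to `R` on `x > 0`. -/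
noncomputable def pw (L R : ℝ → ℝ) : ℝ → ℝ := fun x => if x ≤ 0 then L x else R x

theorem pw_of_nonpos {L R : ℝ → ℝ} {x : ℝ} (h : x ≤ 0) : pw L R x = L x := if_pos h

theorem pw_of_pos {L R : ℝ → ℝ} {x : ℝ} (h : 0 < x) : pw L R x = R x := if_neg h.not_ge

theorem pw_of_nonneg {L R : ℝ → ℝ} (h0 : L 0 = R 0) {x : ℝ} (h : 0 ≤ x) : pw L R x = R x := by
  rcases h.eq_or_lt with rfl | h
  · rw [pw_of_nonpos le_rfl, h0]
  · exact pw_of_pos h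

/-- The secant slopes of `L` on `(-ε, ε)` lie within `κ` of `m`. -/
def SecantBound (L : ℝ → ℝ) (m κ ε : ℝ) : Prop :=
  ∀ x y, |x| < ε → |y| < ε → x ≤ y → (m - κ) * (y - x) ≤ L y - L x ∧ L y - L x ≤ (m + κ) * (y - x)

theorem SecantBound.abs_image_sub_le {L : ℝ → ℝ} {m κ ε B : ℝ} (h : SecantBound L m κ ε)
    (h1 : -B ≤ m - κ) (h2 : m + κ ≤ B) {x y : ℝ} (hx : |x| < ε) (hy : |y| < ε) :
    |L x - L y| ≤ B * |x - y| := by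
  wlog hxy : x ≤ y generalizing x y
  · rw [abs_sub_comm, abs_sub_comm x]
    exact this hy hx (le_of_not_ge hxy)
  obtain ⟨h3, h4⟩ := h x y hx hy hxy
  have hd := sub_nonneg.2 hxy
  rw [abs_sub_comm x, abs_of_nonneg hd, abs_sub_comm, abs_le]
  constructor <;> nlinarith

theorem SecantBound.continuousOn {L : ℝ → ℝ} {m κ ε : ℝ} (h : SecantBound L m κ ε) :
    ContinuousOn L (Ioo (-ε) ε) := by
  have : LipschitzOnWith (|m| + |κ|).toNNReal L (Ioo (-ε) ε) := by
    refine LipschitzOnWith.of_dist_le_mul fun x hx y hy => ?_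
    rw [Real.dist_eq, Real.dist_eq, Real.coe_toNNReal _ (by positivity)]
    exact h.abs_image_sub_le (by linarith [neg_abs_le m, le_abs_self κ])
      (by linarith [le_abs_self m, le_abs_self κ]) (abs_lt.2 hx) (abs_lt.2 hy)
  exact this.continuousOn

theorem continuousOn_pw {L R : ℝ → ℝ} {s : Set ℝ} (hL : ContinuousOn L s) (hR : ContinuousOn R s)
    (h0 : L 0 = R 0) : ContinuousOn (pw L R) s := by
  refine ContinuousOn.if (fun a ha => ?_) (hL.mono inter_subset_left) (hR.mono inter_subset_left)
  have : a = 0 := by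
    have h := ha.2
    rw [show {a : ℝ | a ≤ 0} = Iic 0 from rfl, frontier_Iic] at h
    exact h
  rw [this, h0]

/-- Here 1 + e is a secant slope of the modified metric before a step of the left branch, and 1 + (e
+ θ / 2) bounds the one after it from below. The gain of order θ outweighs the loss 2 κ from the
slope, because κ ≤ θ / 16. -/
theorem expansion_factor_le {κ θ e : ℝ} (hκ : 0 < κ) (hκθ : 16 * κ ≤ θ) (hθ : θ ≤ 1 / 8)
    (he : -(1 / 2) ≤ e) (he0 : e ≤ 0) :
    (1 + θ / 4) * (1 + e) ≤ (1 - κ) ^ 2 * (1 + (e + θ / 2)) := by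
  have h2 : (1 - 2 * κ) * (1 + (e + θ / 2)) ≤ (1 - κ) ^ 2 * (1 + (e + θ / 2)) :=
    mul_le_mul_of_nonneg_right (by nlinarith) (by linarith)
  refine le_trans ?_ h2
  nlinarith [mul_nonneg hκ.le (sub_nonneg.2 he0), mul_nonneg (by linarith : 0 ≤ θ) (sub_nonneg.2 he0),
    mul_nonneg hκ.le (sub_nonneg.2 hθ)]

theorem secant_comp {a b d p q : ℝ} (hb : 0 ≤ b) (hp : a * d ≤ p)
    (hq : b * p ≤ q) : b * a * d ≤ q := by
  have := mul_le_mul_of_nonneg_left hp hb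
  linarith

theorem secant_comp' {a b d p q : ℝ} (hb : 0 ≤ b) (hp : p ≤ a * d)
    (hq : q ≤ b * p) : q ≤ b * a * d := by
  have := mul_le_mul_of_nonneg_left hp hb
  linarith

-- The left branch has slope near 1, so expansion comes only from the metric ψ, whose density 1 + θ
-- x / s increases in the direction in which this branch moves points. On the right branch the
-- density may drop to 1 - θ C, which the slope near a > 1 absorbs.
set_option maxHeartbeats 1000000 in
theorem exists_cover_of_near_skewTent {g : ℝ → ℝ} {s κ θ a C : ℝ} (hs : 0 < s) (ha : 1 < a)
    (hκ : 0 < κ) (hθ : 0 < θ) (hθC : θ * C ≤ 1 / 2) (hκθ : 16 * κ ≤ θ)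
    (hκC : 6 * κ * (C + 1) ≤ 1) (hC4 : 4 < C)
    (hexp : (1 + θ / 4) * (1 + 2 * θ) ≤ (1 - κ) * (a - κ) * (1 - θ * C))
    (hgc : ContinuousOn g (Icc (-(C * s)) (2 * s)))
    (hgI : MapsTo g (Icc (-(C * s)) (2 * s)) (Icc (-(C * s)) (2 * s))) (hg0 : g 0 = s)
    (hgL : ∀ x y, -(C * s) ≤ x → x ≤ y → y ≤ 0 →
      (1 - κ) ^ 2 * (y - x) ≤ g y - g x ∧ g y - g x ≤ (1 + κ) ^ 2 * (y - x))
    (hgR : ∀ x y, 0 ≤ x → x ≤ y → y ≤ 2 * s → (1 - κ) * (a - κ) * (y - x) ≤ g x - g y) :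
    ∃ u v, u < v ∧ Icc u v ⊆ Icc (-(C * s)) (2 * s) ∧
      ∀ x y, x < y → Icc x y ⊆ Icc (-(C * s)) (2 * s) → ∃ n : ℕ, Icc u v ⊆ g^[n] '' Icc x y := by
  have hκ1 : κ < 1 / 50 := by nlinarith
  have hCs : 0 < C * s := by positivity
  have h4s : 4 * s < C * s := by nlinarith
  have hκs : κ * s < s / 50 := by nlinarith
  have hκCs : 6 * (κ * (C * s)) + 6 * (κ * s) ≤ s := by nlinarith
  set I := Icc (-(C * s)) (2 * s) with hI
  set ψ : ℝ → ℝ := fun x => x + θ * x ^ 2 / (2 * s) with hψ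
  have hψsub : ∀ x y, ψ y - ψ x = (y - x) * (1 + θ * ((x + y) / (2 * s))) := fun x y => by
    simp only [hψ]; field_simp; ring
  have hmid : ∀ x ∈ I, ∀ y ∈ I, -C ≤ (x + y) / (2 * s) ∧ (x + y) / (2 * s) ≤ 2 := by
    intro x hx y hy
    rw [le_div_iff₀ (by linarith), div_le_iff₀ (by linarith)]
    exact ⟨by nlinarith [hx.1, hy.1], by nlinarith [hx.2, hy.2]⟩
  have hψm : StrictMonoOn ψ I := by
    intro x hx y hy hxy
    have h1 := (hmid x hx y hy).1
    have h2 : 0 < 1 + θ * ((x + y) / (2 * s)) := by nlinarith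
    have := hψsub x y
    nlinarith [mul_pos (sub_pos.2 hxy) h2]
  have hψc : ContinuousOn ψ I := by
    apply Continuous.continuousOn; fun_prop
  exact exists_cover_of_expanding (ρ := 1 + θ / 4)
    (show -(C * s) < 0 by linarith) (show 0 < 2 * s by linarith) hgc hgI hψm hψc (by linarith)
    (by
      intro x y hx hxy hy
      have hxI : x ∈ I := ⟨hx, by linarith⟩
      have hyI : y ∈ I := ⟨by linarith, by linarith⟩
      obtain ⟨h1, -⟩ := hgL x y hx hxy.le hy
      have hx2 := (hgL x 0 hx (hxy.le.trans hy) le_rfl).2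
      have hy2 := (hgL y 0 hyI.1 hy le_rfl).2
      rw [hg0] at hx2 hy2
      have hkk : (1 + κ) ^ 2 ≤ 1 + 3 * κ := by nlinarith
      -- The shift is s up to an error of order κ C s. Half of s survives, which raises the
      -- normalised midpoint m by at least 1 / 2.
      have hx3 : x + s / 2 ≤ g x := by
        have : κ * (-x) ≤ κ * (C * s) := by gcongr; linarith
        nlinarith
      have hy3 : y + s / 2 ≤ g y := by
        have : κ * (-y) ≤ κ * (C * s) := by gcongr; linarith [hyI.1]
        nlinarith
      set m := (x + y) / (2 * s) with hm
      have hm1 : -C ≤ m := (hmid x hxI y hyI).1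
      have hm0 : m ≤ 0 := div_nonpos_of_nonpos_of_nonneg (by linarith) (by linarith)
      set m' := (g x + g y) / (2 * s) with hm'
      have hmm : m + 1 / 2 ≤ m' := by
        rw [hm, hm', div_add' _ _ _ (by positivity), div_le_div_iff_of_pos_right (by positivity)]
        linarith
      rw [hψsub, hψsub, ← hm, ← hm']
      have hθm : -(1 / 2) ≤ θ * m := by nlinarith
      have hθm0 : θ * m ≤ 0 := by nlinarith
      have hk2 : 1 - 2 * κ ≤ (1 - κ) ^ 2 := by nlinarith
      have hd : 0 < y - x := sub_pos.2 hxy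
      have hθ1 : θ ≤ 1 / 8 := by nlinarith
      have hm'm : θ * m + θ / 2 ≤ θ * m' := by
        rw [show θ * m + θ / 2 = θ * (m + 1 / 2) by ring]; gcongr
      have h2 := expansion_factor_le hκ hκθ hθ1 hθm hθm0
      calc (1 + θ / 4) * ((y - x) * (1 + θ * m))
          = (y - x) * ((1 + θ / 4) * (1 + θ * m)) := by ring
        _ ≤ (y - x) * ((1 - κ) ^ 2 * (1 + θ * m')) := by
          refine mul_le_mul_of_nonneg_left (h2.trans ?_) hd.le
          exact mul_le_mul_of_nonneg_left (by linarith) (by positivity)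
        _ = (1 - κ) ^ 2 * (y - x) * (1 + θ * m') := by ring
        _ ≤ _ := mul_le_mul_of_nonneg_right h1 (by linarith))
    (by
      intro x y hx hxy hy
      have hxI : x ∈ I := ⟨by linarith, by linarith⟩
      have hyI : y ∈ I := ⟨by linarith, by linarith⟩
      have h1 := hgR x y hx hxy.le hy
      have hm1 := (hmid x hxI y hyI).2
      have hm2 := (hmid _ (hgI hyI) _ (hgI hxI)).1
      rw [hψsub, hψsub]
      set m := (x + y) / (2 * s)
      set m' := (g y + g x) / (2 * s)
      have hd : 0 < y - x := sub_pos.2 hxy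
      calc (1 + θ / 4) * ((y - x) * (1 + θ * m))
          = (y - x) * ((1 + θ / 4) * (1 + θ * m)) := by ring
        _ ≤ (y - x) * ((1 + θ / 4) * (1 + 2 * θ)) := by
          refine mul_le_mul_of_nonneg_left (mul_le_mul_of_nonneg_left ?_ (by positivity)) hd.le
          linarith [mul_le_mul_of_nonneg_left hm1 hθ.le]
        _ ≤ (y - x) * ((1 - κ) * (a - κ) * (1 - θ * C)) :=
          mul_le_mul_of_nonneg_left hexp hd.le
        _ = ((1 - κ) * (a - κ) * (y - x)) * (1 - θ * C) := by ring
        _ ≤ (g x - g y) * (1 - θ * C) := mul_le_mul_of_nonneg_right h1 (by linarith)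
        _ ≤ _ := by
          have h2 : 0 < (1 - κ) * (a - κ) := mul_pos (by linarith) (by linarith)
          refine mul_le_mul_of_nonneg_left ?_ ((mul_pos h2 hd).le.trans h1)
          linarith [mul_le_mul_of_nonneg_left hm2 hθ.le])

-- The switching point goes to c = L 0 and returns to s = L c. The interval I = [-C s, 2 s] has
-- image of length about C s to the right of c, since both C s and a · 2 s are at most C s; J is
-- this image with margin s / 2. Slope -1 on J sends it back into the interior of I. The lower bound
-- on -c keeps J to the left of I.
set_option maxHeartbeats 1000000 in
theorem exhibitsChaosWithin_pw {L R : ℝ → ℝ} {ε κ θ a : ℝ} (hL : SecantBound L (-1) κ ε)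
    (hR : SecantBound R a κ ε) (h0 : L 0 = R 0) (ha : 1 < a) (hκ : 0 < κ) (hθ : 0 < θ)
    (hθC : θ * (2 * (a + 1)) ≤ 1 / 2) (hκθ : 16 * κ ≤ θ) (hκC : 6 * κ * (2 * (a + 1) + 1) ≤ 1)
    (hexp : (1 + θ / 4) * (1 + 2 * θ) ≤ (1 - κ) * (a - κ) * (1 - θ * (2 * (a + 1))))
    (hs : 0 < L (L 0)) (hsc : (2 * (2 * (a + 1)) + 1) * L (L 0) ≤ -L 0)
    (hcε : -2 * L 0 < ε) : ExhibitsChaosWithin (pw L R) ε := by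
  set c := L 0 with hcdef
  set s := L c with hsdef
  have hspos : 0 < s := hs
  set C := 2 * (a + 1) with hC
  set f := pw L R with hf
  have hC4 : 4 < C := by linarith
  have hκ1 : κ < 1 / 50 := by nlinarith
  have hCs : 0 < C * s := by positivity
  have h4s : 4 * s < C * s := by nlinarith
  have hκs : κ * s < s / 50 := by nlinarith
  have hκCs : 6 * (κ * (C * s)) + 6 * (κ * s) ≤ s := by nlinarith
  have hIε : ∀ x ∈ Icc (-(C * s)) (2 * s), |x| < ε := fun x hx =>
    abs_lt.2 ⟨by linarith [hx.1], by linarith [hx.2]⟩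
  have hJε : ∀ x ∈ Icc (c - s / 2) (c + (C * s + s / 2)), |x| < ε := fun x hx =>
    abs_lt.2 ⟨by linarith [hx.1], by linarith [hx.2]⟩
  have hJneg : ∀ x ∈ Icc (c - s / 2) (c + (C * s + s / 2)), x < -(C * s) := fun x hx => by
    linarith [hx.2]
  have hzε : |(0 : ℝ)| < ε := by rw [abs_zero]; linarith
  have hcJ : c ∈ Icc (c - s / 2) (c + (C * s + s / 2)) := ⟨by linarith, by linarith⟩
  have hf0 : f 0 = c := pw_of_nonpos le_rfl
  have hfL : ∀ x ≤ 0, f x = L x := fun x hx => pw_of_nonpos hx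
  have hfR : ∀ x, 0 ≤ x → f x = R x := fun x hx => pw_of_nonneg h0 hx
  have hfJ : ∀ x ∈ Icc (c - s / 2) (c + (C * s + s / 2)), f x = L x := fun x hx =>
    hfL x (by linarith [hJneg x hx])
  have hIJ : MapsTo f (Icc (-(C * s)) (2 * s)) (Ioo (c - s / 2) (c + (C * s + s / 2))) := by
    intro x hx
    rcases le_total x 0 with h | h
    · obtain ⟨h1, h2⟩ := hL x 0 (hIε x hx) hzε h
      rw [hfL x h]
      constructor
      · nlinarith
      · nlinarith [mul_nonneg hκ.le (sub_nonneg.2 hx.1), hx.1]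
    · obtain ⟨h1, h2⟩ := hR 0 x hzε (hIε x hx) h
      rw [hfR x h, ← sub_add_cancel (R x) (R 0), ← h0]
      constructor
      · nlinarith
      · nlinarith [mul_nonneg hκ.le (sub_nonneg.2 hx.2), hx.2]
  have hJI : MapsTo f (Icc (c - s / 2) (c + (C * s + s / 2))) (Ioo (-(C * s)) (2 * s)) := by
    intro x hx
    rw [hfJ x hx]
    rcases le_total x c with h | h
    · obtain ⟨h1, h2⟩ := hL x c (hJε x hx) (hJε c hcJ) h
      have := hx.1
      constructor
      · nlinarith
      · nlinarith [mul_nonneg hκ.le (sub_nonneg.2 hx.1)]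
    · obtain ⟨h1, h2⟩ := hL c x (hJε c hcJ) (hJε x hx) h
      have := hx.2
      constructor
      · nlinarith [mul_nonneg hκ.le (sub_nonneg.2 hx.2)]
      · nlinarith
  set I := Icc (-(C * s)) (2 * s) with hI
  set J := Icc (c - s / 2) (c + (C * s + s / 2)) with hJ
  have hIJ' : MapsTo f I J := hIJ.mono_right Ioo_subset_Icc_self
  have hJI' : MapsTo f J I := hJI.mono_right Ioo_subset_Icc_self
  have hgI : MapsTo f^[2] I I := fun x hx => hJI' (hIJ' hx)
  have hfc : ContinuousOn f (Ioo (-ε) ε) := continuousOn_pw hL.continuousOn hR.continuousOn h0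
  have hSε : I ∪ J ⊆ Ioo (-ε) ε := by
    rintro x (hx | hx)
    · exact abs_lt.1 (hIε x hx)
    · exact abs_lt.1 (hJε x hx)
  have hfS : ContinuousOn f (I ∪ J) := hfc.mono hSε
  have hgc : ContinuousOn f^[2] I :=
    (hfS.mono subset_union_right).comp (hfS.mono subset_union_left) hIJ'
  have hg : ∀ x ∈ I, f^[2] x = L (f x) := fun x hx => hfJ _ (hIJ' hx)
  have hg0 : f^[2] 0 = s := by
    rw [hg 0 ⟨by linarith, by linarith⟩, hf0]
  -- secant slopes of the second iterate
  have hgL : ∀ x y, -(C * s) ≤ x → x ≤ y → y ≤ 0 →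
      (1 - κ) ^ 2 * (y - x) ≤ f^[2] y - f^[2] x ∧ f^[2] y - f^[2] x ≤ (1 + κ) ^ 2 * (y - x) := by
    intro x y hx hxy hy
    have hxI : x ∈ I := ⟨hx, by linarith⟩
    have hyI : y ∈ I := ⟨by linarith, by linarith⟩
    obtain ⟨h1, h2⟩ := hL x y (hIε x hxI) (hIε y hyI) hxy
    have hx' := hfL x (hxy.trans hy)
    have hy' := hfL y hy
    obtain ⟨h3, h4⟩ := hL (f y) (f x) (hJε _ (hIJ' hyI)) (hJε _ (hIJ' hxI)) (by
      rw [hx', hy']; nlinarith)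
    rw [hg x hxI, hg y hyI]
    rw [hx', hy'] at h3 h4 ⊢
    rw [sq, sq]
    exact ⟨secant_comp (by linarith) (by linarith : (1 - κ) * (y - x) ≤ L x - L y) (by linarith),
      secant_comp' (by linarith) (by linarith : L x - L y ≤ (1 + κ) * (y - x)) (by linarith)⟩
  have hgR : ∀ x y, 0 ≤ x → x ≤ y → y ≤ 2 * s →
      (1 - κ) * (a - κ) * (y - x) ≤ f^[2] x - f^[2] y := by
    intro x y hx hxy hy
    have hxI : x ∈ I := ⟨by linarith, by linarith⟩
    have hyI : y ∈ I := ⟨by linarith, by linarith⟩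
    obtain ⟨h1, h2⟩ := hR x y (hIε x hxI) (hIε y hyI) hxy
    have hx' := hfR x hx
    have hy' := hfR y (hx.trans hxy)
    obtain ⟨h3, h4⟩ := hL (f x) (f y) (hJε _ (hIJ' hxI)) (hJε _ (hIJ' hyI)) (by
      rw [hx', hy']; nlinarith)
    rw [hg x hxI, hg y hyI]
    rw [hx', hy'] at h3 h4 ⊢
    exact secant_comp (by linarith) h1 (by linarith)
  obtain ⟨u, v, huv, hWI, hcov⟩ := exists_cover_of_near_skewTent hspos ha hκ hθ hθC hκθ hκC hC4 hexp
    hgc hgI hg0 hgL hgR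
  have hcovI : ∀ x y, x < y → Icc x y ⊆ I → ∃ n : ℕ, Icc u v ⊆ f^[n] '' Icc x y := by
    intro x y hxy hK
    obtain ⟨n, hn⟩ := hcov x y hxy hK
    exact ⟨2 * n, by rwa [Function.iterate_mul]⟩
  have hintU : Ioo (-(C * s)) (2 * s) ⊆ interior (I ∪ J) :=
    interior_maximal (Ioo_subset_Icc_self.trans subset_union_left) isOpen_Ioo
  have hintV : Ioo (c - s / 2) (c + (C * s + s / 2)) ⊆ interior (I ∪ J) :=
    interior_maximal (Ioo_subset_Icc_self.trans subset_union_right) isOpen_Ioo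
  refine exhibitsChaosWithin_of_cover (isCompact_Icc.union isCompact_Icc) hSε hfS
    ?_ huv (hWI.trans subset_union_left) ?_ ?_
  · rintro x (hx | hx)
    · exact hintV (hIJ hx)
    · exact hintU (hJI hx)
  · rintro x (hx | hx) r hr
    · obtain ⟨p, q, h1, h2, h3⟩ := exists_Icc_subset_near (by linarith) hx hr
      exact ⟨p, q, h1, h2.trans subset_union_left, h3⟩
    · obtain ⟨p, q, h1, h2, h3⟩ := exists_Icc_subset_near (by linarith) hx hr
      exact ⟨p, q, h1, h2.trans subset_union_right, h3⟩
  · intro x y hxy hK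
    by_cases hyJ : y ∈ J
    · -- an interval in `J` is mapped monotonically into `I`
      have hKJ : Icc x y ⊆ J := by
        intro z hz
        have hzy : z < -(C * s) := hz.2.trans_lt (hJneg y hyJ)
        rcases hK hz with h | h
        · exact absurd h.1 (not_le.2 hzy)
        · exact h
      have hxJ := hKJ (left_mem_Icc.2 hxy.le)
      have hlt : f y < f x := by
        rw [hfJ x hxJ, hfJ y hyJ]
        nlinarith [(hL x y (hJε x hxJ) (hJε y hyJ) hxy.le).2]
      have hsub : Icc (f y) (f x) ⊆ f '' Icc x y :=
        intermediate_value_Icc' hxy.le (hfS.mono hK)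
      obtain ⟨n, hn⟩ := hcovI _ _ hlt (Icc_subset_Icc (hJI' hyJ).1 (hJI' hxJ).2)
      refine ⟨n + 1, hn.trans ?_⟩
      rw [Function.iterate_succ, image_comp]
      exact image_mono hsub
    · have hyI : y ∈ I := (hK (right_mem_Icc.2 hxy.le)).resolve_right hyJ
      refine hcovI x y hxy fun z hz => ?_
      refine ⟨?_, hz.2.trans hyI.2⟩
      by_contra hcon
      -- the gap between the two intervals
      have hgap : c + (C * s + s / 2) < -(C * s) := by linarith
      set t := max z ((c + (C * s + s / 2) + -(C * s)) / 2) with ht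
      have ht1 : t < -(C * s) := max_lt (not_le.1 hcon) (by linarith)
      have ht2 : c + (C * s + s / 2) < t := lt_of_lt_of_le (by linarith) (le_max_right _ _)
      rcases hK (show t ∈ Icc x y from
        ⟨hz.1.trans (le_max_left _ _), ht1.le.trans hyI.1⟩) with h | h
      · linarith [h.1]
      · linarith [h.2]

/-- With b = a - 1, half of b is reserved for κ, so that (1 - κ)(a - κ) ≥ 1 + b / 2. To first order
the remaining inequality reads θ D ≤ b / 2, and θ D = b / 4 leaves room. -/
theorem exists_chaos_constants {a : ℝ} (ha : 1 < a) : ∃ θ > 0, ∃ κ₀ > 0, ∀ κ, 0 < κ → κ ≤ κ₀ →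
    θ * (2 * (a + 1)) ≤ 1 / 2 ∧ 16 * κ ≤ θ ∧ 6 * κ * (2 * (a + 1) + 1) ≤ 1 ∧
      (1 + θ / 4) * (1 + 2 * θ) ≤ (1 - κ) * (a - κ) * (1 - θ * (2 * (a + 1))) := by
  set b := a - 1 with hb
  have hb0 : 0 < b := by linarith
  set C := 2 * (a + 1) with hC
  have hC4 : 4 < C := by linarith
  set D := (1 + b / 2) * C + 3 with hD
  have hD7 : 7 < D := by nlinarith
  have hθD : b / (4 * D) * D = b / 4 := by field_simp
  set θ := b / (4 * D) with hθ
  have hθ0 : 0 < θ := by positivity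
  have hθC : θ * C ≤ 1 / 2 := by
    rw [hθ, div_mul_eq_mul_div, div_le_iff₀ (by positivity)]
    nlinarith
  refine ⟨θ, hθ0, min (θ / 16) (min (1 / (6 * (C + 1))) (b / (2 * (1 + a)))), by positivity,
    fun κ hκ hκ' => ?_⟩
  simp only [le_min_iff] at hκ'
  obtain ⟨h1, h2, h3⟩ := hκ'
  rw [le_div_iff₀ (by positivity)] at h2 h3
  refine ⟨hθC, by linarith, by linarith, ?_⟩
  have h4 : 1 + b / 2 ≤ (1 - κ) * (a - κ) := by nlinarith
  calc (1 + θ / 4) * (1 + 2 * θ) ≤ (1 + b / 2) * (1 - θ * C) := by nlinarith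
    _ ≤ _ := by
      gcongr
      linarith

/-! ### Absence of cycles of length at least three. -/

section Cycles

variable {f : ℝ → ℝ} {n : ℕ} {ε : ℝ}

/-- The orbit of a cycle of length at least three. -/
structure IsLongOrbit (f : ℝ → ℝ) (ε : ℝ) (O : Set ℝ) : Prop where
  finite : O.Finite
  nonempty : O.Nonempty
  abs_lt : ∀ y ∈ O, |y| < ε
  mapsTo : MapsTo f O O
  surjOn : ∀ y ∈ O, ∃ z ∈ O, f z = y
  minimal : ∀ T ⊆ O, T.Nonempty → MapsTo f T T → T = O
  ne : ∀ y ∈ O, f (f y) ≠ y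

theorem HasCycleWithin.exists_isLongOrbit (h : HasCycleWithin f n ε) (hn : 3 ≤ n) :
    ∃ O, IsLongOrbit f ε O := by
  obtain ⟨x, hn0, hx, hε⟩ := h
  have hper : Function.IsPeriodicPt f n x := hx ▸ Function.isPeriodicPt_minimalPeriod f x
  have hmod : ∀ i, f^[i] x = f^[i % n] x := fun i => (hper.iterate_mod_apply i).symm
  have hmem : x ∈ Function.periodicPts f := ⟨n, hn0, hper⟩
  refine ⟨range fun i : ℕ => f^[i] x, ?_, ⟨x, 0, rfl⟩, ?_, ?_, ?_, ?_, ?_⟩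
  · refine ((finite_lt_nat n).image fun i => f^[i] x).subset ?_
    rintro _ ⟨i, rfl⟩
    exact ⟨i % n, Nat.mod_lt _ hn0, (hmod i).symm⟩
  · rintro _ ⟨i, rfl⟩
    exact hε i
  · rintro _ ⟨i, rfl⟩
    exact ⟨i + 1, Function.iterate_succ_apply' f i x⟩
  · rintro _ ⟨i, rfl⟩
    refine ⟨f^[i + (n - 1)] x, ⟨_, rfl⟩, ?_⟩
    rw [← Function.iterate_succ_apply' f, show (i + (n - 1)).succ = i + n by omega,
      Function.iterate_add_apply, hper.eq]
  · intro T hT ⟨y, hy⟩ hm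
    refine hT.antisymm ?_
    obtain ⟨i, rfl⟩ := hT hy
    rintro _ ⟨j, rfl⟩
    have h1 : f^[j] x = f^[j + i * n - i] (f^[i] x) := by
      have : i ≤ i * n := Nat.le_mul_of_pos_right i hn0
      rw [← Function.iterate_add_apply, show j + i * n - i + i = j + i * n by omega, hmod j,
        hmod (j + i * n), Nat.add_mul_mod_self_right]
    simp only [h1]
    exact hm.iterate _ hy
  · rintro _ ⟨i, rfl⟩ hc
    have h1 : Function.IsPeriodicPt f 2 (f^[i] x) := hc
    have h2 := h1.minimalPeriod_le two_pos
    rw [Function.minimalPeriod_apply_iterate hmem, hx] at h2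
    omega

namespace IsLongOrbit

variable {O : Set ℝ}

theorem exists_max (h : IsLongOrbit f ε O) : ∃ M ∈ O, ∀ y ∈ O, y ≤ M :=
  exists_max_image O id h.finite h.nonempty

theorem exists_min (h : IsLongOrbit f ε O) : ∃ m ∈ O, ∀ y ∈ O, m ≤ y :=
  exists_min_image O id h.finite h.nonempty

/-- A decreasing map would exchange the maximum and the minimum of the orbit. -/
theorem not_antitoneOn (h : IsLongOrbit f ε O) : ¬ AntitoneOn f O := by
  intro ha
  obtain ⟨M, hM, hMy⟩ := h.exists_max
  obtain ⟨m, hm, hmy⟩ := h.exists_min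
  obtain ⟨z, hz, hzm⟩ := h.surjOn m hm
  obtain ⟨z', hz', hzM⟩ := h.surjOn M hM
  have h1 : f M = m := le_antisymm (hzm ▸ ha hz hM (hMy z hz)) (hmy _ (h.mapsTo hM))
  have h2 : f m = M := le_antisymm (hMy _ (h.mapsTo hm)) (hzM ▸ ha hm hz' (hmy z' hz'))
  exact h.ne M hM (by rw [h1, h2])

/-- An increasing map would fix the maximum of the orbit. -/
theorem not_monotoneOn (h : IsLongOrbit f ε O) : ¬ MonotoneOn f O := by
  intro ha
  obtain ⟨M, hM, hMy⟩ := h.exists_max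
  obtain ⟨z', hz', hzM⟩ := h.surjOn M hM
  have h2 : f M = M := le_antisymm (hMy _ (h.mapsTo hM)) (hzM.symm.le.trans (ha hz' hM (hMy z' hz')))
  exact h.ne M hM (by rw [h2, h2])

/-- The point of the finite set T that the second iterate moves least would have an image moved
still less. -/
theorem not_contraction (h : IsLongOrbit f ε O) {T : Set ℝ} (hT : T ⊆ O) (hne : T.Nonempty)
    {ρ : ℝ} (hρ : ρ < 1) (hm : ∀ y ∈ T, f (f y) ∈ T)
    (hc : ∀ y ∈ T, ∀ z ∈ T, |f (f y) - f (f z)| ≤ ρ * |y - z|) : False := by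
  obtain ⟨y, hy, hmin⟩ := exists_min_image T (fun y => |f (f y) - y|) (h.finite.subset hT) hne
  have h1 := hc _ (hm y hy) _ hy
  have h2 := hmin _ (hm y hy)
  have h3 : 0 < |f (f y) - y| := abs_pos.2 (sub_ne_zero.2 (h.ne y (hT hy)))
  nlinarith

end IsLongOrbit

variable {L R : ℝ → ℝ} {κ a : ℝ}

theorem SecantBound.antitoneOn {m : ℝ} (h : SecantBound L m κ ε) (hm : m + κ ≤ 0) :
    AntitoneOn L (Ioo (-ε) ε) := fun x hx y hy hxy => by
  have := (h x y (_root_.abs_lt.2 hx) (_root_.abs_lt.2 hy) hxy).2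
  nlinarith

theorem SecantBound.monotoneOn {m : ℝ} (h : SecantBound L m κ ε) (hm : 0 ≤ m - κ) :
    MonotoneOn L (Ioo (-ε) ε) := fun x hx y hy hxy => by
  have := (h x y (_root_.abs_lt.2 hx) (_root_.abs_lt.2 hy) hxy).1
  nlinarith

theorem antitoneOn_pw (hL : AntitoneOn L (Ioo (-ε) ε)) (hR : AntitoneOn R (Ioo (-ε) ε))
    (h0 : L 0 = R 0) (hε : 0 < ε) : AntitoneOn (pw L R) (Ioo (-ε) ε) := by
  have hz : (0 : ℝ) ∈ Ioo (-ε) ε := ⟨by linarith, hε⟩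
  intro x hx y hy hxy
  rcases le_total y 0 with h | h
  · rw [pw_of_nonpos h, pw_of_nonpos (hxy.trans h)]
    exact hL hx hy hxy
  · rcases le_total x 0 with h' | h'
    · rw [pw_of_nonpos h', pw_of_nonneg h0 h]
      exact (hR hz hy h).trans (h0 ▸ hL hx hz h')
    · rw [pw_of_nonneg h0 h', pw_of_nonneg h0 h]
      exact hR hx hy hxy

theorem not_hasCycleWithin_of_neg (hL : SecantBound L (-1) κ ε) (hR : SecantBound R a κ ε)
    (h0 : L 0 = R 0) (hκ : κ ≤ 1) (ha : a + κ ≤ 0) (hn : 3 ≤ n) :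
    ¬ HasCycleWithin (pw L R) n ε := by
  intro h
  obtain ⟨O, hO⟩ := h.exists_isLongOrbit hn
  have hε : 0 < ε := by
    obtain ⟨y, hy⟩ := hO.nonempty
    exact (abs_nonneg y).trans_lt (hO.abs_lt y hy)
  exact hO.not_antitoneOn ((antitoneOn_pw (hL.antitoneOn (by linarith)) (hR.antitoneOn ha) h0 hε).mono
    fun y hy => _root_.abs_lt.1 (hO.abs_lt y hy))

/-- The map has its minimum L 0 at the switching point. If L 0 ≥ 0 the orbit lies on the increasing
side. If L 0 < 0 and L (L 0) ≤ 0, the nonpositive part of the orbit is invariant, so it is empty or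
everything. -/
theorem not_hasCycleWithin_of_pos (hL : SecantBound L (-1) κ ε) (hR : SecantBound R a κ ε)
    (h0 : L 0 = R 0) (hκ : κ ≤ 1) (ha : 0 ≤ a - κ) (hcε : |L 0| < ε)
    (hc : 0 ≤ L 0 ∨ L (L 0) ≤ 0)
    (hn : 3 ≤ n) : ¬ HasCycleWithin (pw L R) n ε := by
  intro h
  obtain ⟨O, hO⟩ := h.exists_isLongOrbit hn
  have hOI : O ⊆ Ioo (-ε) ε := fun y hy => _root_.abs_lt.1 (hO.abs_lt y hy)
  have hε : 0 < ε := by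
    obtain ⟨y, hy⟩ := hO.nonempty
    exact (abs_nonneg y).trans_lt (hO.abs_lt y hy)
  have hz : (0 : ℝ) ∈ Ioo (-ε) ε := ⟨by linarith, hε⟩
  have hLa := hL.antitoneOn (by linarith)
  have hRm := hR.monotoneOn ha
  have hge : ∀ y ∈ O, L 0 ≤ y := by
    intro y hy
    obtain ⟨z, hzO, rfl⟩ := hO.surjOn y hy
    rcases le_total z 0 with h | h
    · rw [pw_of_nonpos h]; exact hLa (hOI hzO) hz h
    · rw [pw_of_nonneg h0 h, h0]; exact hRm hz (hOI hzO) h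
  have hright : ¬ ∀ y ∈ O, 0 ≤ y := fun hp => by
    refine hO.not_monotoneOn fun x hx y hy hxy => ?_
    rw [pw_of_nonneg h0 (hp x hx), pw_of_nonneg h0 (hp y hy)]
    exact hRm (hOI hx) (hOI hy) hxy
  by_cases hc0 : 0 ≤ L 0
  · exact hright fun y hy => hc0.trans (hge y hy)
  · have hw := hc.resolve_left hc0
    have hc1 := not_le.1 hc0
    push Not at hright
    obtain ⟨y, hy, hy0⟩ := hright
    have hcI : L 0 ∈ Ioo (-ε) ε := _root_.abs_lt.1 hcε
    have hT : O ∩ Iic 0 = O := by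
      refine hO.minimal _ inter_subset_left ⟨y, hy, hy0.le⟩ fun z hz' => ⟨hO.mapsTo hz'.1, ?_⟩
      have h1 : z ≤ 0 := hz'.2
      rw [mem_Iic, pw_of_nonpos h1]
      exact (hLa hcI (hOI hz'.1) (hge z hz'.1)).trans hw
    refine hO.not_antitoneOn fun x hx y hy hxy => ?_
    have hn : ∀ x ∈ O, x ≤ 0 := fun x hx => (hT.symm ▸ hx : x ∈ O ∩ Iic 0).2
    rw [pw_of_nonpos (hn x hx), pw_of_nonpos (hn y hy)]
    exact hLa (hOI hx) (hOI hy) hxy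

/-- The slope a may vanish, so R need not be monotone and contraction replaces monotonicity. For L 0
≥ 0 the map itself preserves and contracts the positive points of the orbit; for L 0 < 0 its second
iterate does, with factor (1 + κ) ρ. -/
theorem not_hasCycleWithin_of_lt_one {ρ : ℝ} (hL : SecantBound L (-1) κ ε)
    (hR : SecantBound R a κ ε) (h0 : L 0 = R 0) (hκ0 : 0 < κ) (hκ : κ ≤ 1 / 4) (ha : 0 ≤ a)
    (haρ : a + κ ≤ ρ) (hρ : (1 + κ) * ρ < 1 - κ - κ ^ 2) (hcε : |L 0| < ε)
    (hw : L 0 < 0 → L (L 0) ≤ κ * -L 0) (hn : 3 ≤ n) : ¬ HasCycleWithin (pw L R) n ε := by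
  intro h
  obtain ⟨O, hO⟩ := h.exists_isLongOrbit hn
  have hOI : O ⊆ Ioo (-ε) ε := fun y hy => _root_.abs_lt.1 (hO.abs_lt y hy)
  have hzε : |(0 : ℝ)| < ε := by rw [abs_zero]; exact (abs_nonneg _).trans_lt hcε
  have hz : (0 : ℝ) ∈ Ioo (-ε) ε := _root_.abs_lt.1 hzε
  have hLa := hL.antitoneOn (by linarith)
  obtain ⟨M, hM, hMy⟩ := hO.exists_max
  have hfL : ∀ y ≤ 0, pw L R y = L y := fun y hy => pw_of_nonpos hy
  have hfR : ∀ y, 0 ≤ y → pw L R y = R y := fun y hy => pw_of_nonneg h0 hy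
  have hρ1 : ρ < 1 - κ := by nlinarith
  have hρ0 : 0 < ρ := by linarith
  have hM0 : 0 < M := by
    by_contra hcon
    refine hO.not_antitoneOn fun x hx y hy hxy => ?_
    rw [hfL x ((hMy x hx).trans (not_lt.1 hcon)), hfL y ((hMy y hy).trans (not_lt.1 hcon))]
    exact hLa (hOI hx) (hOI hy) hxy
  set c := L 0 with hc
  have hRy : ∀ y ∈ O, 0 ≤ y → c - κ * M ≤ R y ∧ R y ≤ c + ρ * M := by
    intro y hy hy0
    obtain ⟨h1, h2⟩ := hR 0 y hzε (hO.abs_lt y hy) hy0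
    have := hMy y hy
    rw [← h0] at h1 h2
    constructor <;> nlinarith
  have hge : ∀ y ∈ O, c - κ * M ≤ y := by
    intro y hy
    obtain ⟨z, hzO, rfl⟩ := hO.surjOn y hy
    rcases le_total z 0 with h | h
    · rw [hfL z h]
      have := hLa (hOI hzO) hz h
      nlinarith
    · rw [hfR z h]; exact (hRy z hzO h).1
  obtain ⟨z, hzO, hzM⟩ := hO.surjOn M hM
  have hTO : O ∩ Ioi 0 ⊆ O := inter_subset_left
  have hTne : (O ∩ Ioi 0).Nonempty := ⟨M, hM, hM0⟩
  rcases le_or_gt 0 c with hc0 | hc0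
  -- This makes R at least c - κ M > 0 on the positive points of the orbit.
  · have hcM : κ * M < c := by
      rcases le_total z 0 with h | h
      · rw [hfL z h] at hzM
        have h1 := (hL z 0 (hO.abs_lt z hzO) hzε h).1
        have h2 := hge z hzO
        nlinarith
      · rw [hfR z h] at hzM
        have := (hRy z hzO h).2
        nlinarith
    have hm : ∀ y ∈ O ∩ Ioi 0, pw L R y ∈ O ∩ Ioi 0 := fun y hy => by
      refine ⟨hO.mapsTo hy.1, ?_⟩
      have h1 : (0 : ℝ) ≤ y := le_of_lt hy.2
      rw [mem_Ioi, hfR y h1]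
      linarith [(hRy y hy.1 h1).1]
    have hcon : ∀ y ∈ O ∩ Ioi 0, ∀ z ∈ O ∩ Ioi 0, |pw L R y - pw L R z| ≤ ρ * |y - z| := by
      intro y hy z hz
      rw [hfR y (le_of_lt hy.2), hfR z (le_of_lt hz.2)]
      exact hR.abs_image_sub_le (by linarith) haρ (hO.abs_lt y hy.1) (hO.abs_lt z hz.1)
    refine hO.not_contraction hTO hTne (show ρ * ρ < 1 by nlinarith) (fun y hy => hm _ (hm y hy))
      fun y hy z hz => (hcon _ (hm y hy) _ (hm z hz)).trans ?_
    rw [mul_assoc]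
    exact mul_le_mul_of_nonneg_left (hcon y hy z hz) hρ0.le
  · specialize hw hc0
    set w := L c with hwdef
    have hz0 : z ≤ 0 := by
      by_contra hcon
      have h1 := (hRy z hzO (not_le.1 hcon).le).2
      rw [hfR z (not_le.1 hcon).le] at hzM
      nlinarith
    -- The maximum M is L z for some z ≥ c - κ M, so it exceeds w = L c by at most (1 + κ) κ M. By
    -- `hρ` this leaves w > (1 + κ) ρ M, and L (R y) cannot fall to 0.
    have hMw : M * (1 - κ - κ ^ 2) ≤ w := by
      rw [hfL z hz0] at hzM
      rcases le_total c z with h | h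
      · have := hLa (_root_.abs_lt.1 hcε) (hOI hzO) h
        nlinarith
      · have h1 := (hL z c (hO.abs_lt z hzO) hcε h).1
        have h2 := hge z hzO
        nlinarith
    have hMc : M < -c := by
      have h1 : M * (11 / 16) ≤ M * (1 - κ - κ ^ 2) :=
        mul_le_mul_of_nonneg_left (by nlinarith) hM0.le
      have h2 : κ * -c ≤ 1 / 4 * -c := mul_le_mul_of_nonneg_right hκ (by linarith)
      linarith
    have hwM : (1 + κ) * ρ * M < w := by nlinarith
    have hRneg : ∀ y ∈ O ∩ Ioi 0, R y < 0 := fun y hy => by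
      have := (hRy y hy.1 (le_of_lt hy.2)).2
      nlinarith
    have hff : ∀ y ∈ O ∩ Ioi 0, pw L R (pw L R y) = L (R y) := fun y hy => by
      rw [hfR y (le_of_lt hy.2), hfL _ (hRneg y hy).le]
    have hRε : ∀ y ∈ O ∩ Ioi 0, |R y| < ε := fun y hy => by
      have := hO.abs_lt _ (hO.mapsTo hy.1)
      rwa [hfR y (le_of_lt hy.2)] at this
    refine hO.not_contraction hTO hTne (show (1 + κ) * ρ < 1 by nlinarith) (fun y hy => ?_)
      fun y hy z hz => ?_
    · refine ⟨hO.mapsTo (hO.mapsTo hy.1), ?_⟩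
      rw [mem_Ioi, hff y hy]
      rcases le_total (R y) c with h | h
      · have := hLa (_root_.abs_lt.1 (hRε y hy)) (_root_.abs_lt.1 hcε) h
        have : 0 < (1 + κ) * ρ * M := by positivity
        linarith
      · have h1 := (hL c (R y) hcε (hRε y hy) h).1
        have h2 : (1 + κ) * (R y - c) ≤ (1 + κ) * (ρ * M) := by
          have := (hRy y hy.1 (le_of_lt hy.2)).2
          exact mul_le_mul_of_nonneg_left (by linarith) (by linarith)
        linarith
    · rw [hff y hy, hff z hz, mul_assoc]
      refine (hL.abs_image_sub_le (B := 1 + κ) (by linarith) (by linarith) (hRε y hy)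
        (hRε z hz)).trans (mul_le_mul_of_nonneg_left ?_ (by linarith))
      exact hR.abs_image_sub_le (by linarith) haρ (hO.abs_lt y hy.1) (hO.abs_lt z hz.1)

end Cycles

/-! ### Counting fixed points of a map whose derivative is strictly concave up to sign. -/

section StrictConcave

theorem StrictConcaveOn.pos_of_zeros {Q : ℝ → ℝ} {s : Set ℝ} (hQ : StrictConcaveOn ℝ s Q)
    {x y z : ℝ} (hx : x ∈ s) (hz : z ∈ s) (hxy : x < y) (hyz : y < z) (h1 : 0 ≤ Q x)
    (h2 : 0 ≤ Q z) : 0 < Q y := by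
  have h3 := hQ.slope_anti_adjacent hx hz hxy hyz
  rw [div_lt_div_iff₀ (sub_pos.2 hyz) (sub_pos.2 hxy)] at h3
  by_contra hcon
  have h4 := not_lt.1 hcon
  nlinarith [mul_nonneg (by linarith : 0 ≤ Q z - Q y) (sub_pos.2 hxy).le,
    mul_nonneg (by linarith : 0 ≤ Q x - Q y) (sub_pos.2 hyz).le]

variable {F P : ℝ → ℝ} {r σ : ℝ}

/-- The second iterate near a fixed point, in the form needed to count its fixed points: `σ` times
the derivative is strictly concave. -/
structure ConcaveDeriv (F P : ℝ → ℝ) (r σ : ℝ) : Prop where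
  hasDerivAt : ∀ x, |x| < r → HasDerivAt F (P x) x
  concave : StrictConcaveOn ℝ (Ioo (-r) r) fun x => σ * P x

namespace ConcaveDeriv

theorem concave' (h : ConcaveDeriv F P r σ) :
    StrictConcaveOn ℝ (Ioo (-r) r) fun x => σ * (P x - 1) := by
  have := h.concave.add_const (-σ)
  refine this.congr fun x _ => ?_
  simp only [Pi.add_apply]
  ring

theorem continuousOn (h : ConcaveDeriv F P r σ) : ContinuousOn F (Ioo (-r) r) := fun x hx =>
  (h.hasDerivAt x (abs_lt.2 hx)).continuousAt.continuousWithinAt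

theorem exists_slope (h : ConcaveDeriv F P r σ) {x y : ℝ} (hx : |x| < r) (hy : |y| < r)
    (hxy : x < y) : ∃ ξ, x < ξ ∧ ξ < y ∧ F y - F x = P ξ * (y - x) := by
  have hsub : Icc x y ⊆ Ioo (-r) r := Icc_subset_Ioo (abs_lt.1 hx).1 (abs_lt.1 hy).2
  obtain ⟨ξ, hξ, he⟩ := exists_hasDerivAt_eq_slope F P hxy (h.continuousOn.mono hsub)
    fun z hz => h.hasDerivAt z (abs_lt.2 (hsub (Ioo_subset_Icc_self hz)))
  refine ⟨ξ, hξ.1, hξ.2, ?_⟩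
  have : y - x ≠ 0 := (sub_pos.2 hxy).ne'
  rw [he]; field_simp

theorem exists_critical (h : ConcaveDeriv F P r σ) {x y : ℝ} (hx : |x| < r) (hy : |y| < r)
    (hxy : x < y) (hFx : F x = x) (hFy : F y = y) :
    ∃ ξ, x < ξ ∧ ξ < y ∧ |ξ| < r ∧ σ * (P ξ - 1) = 0 := by
  obtain ⟨ξ, h1, h2, h3⟩ := h.exists_slope hx hy hxy
  refine ⟨ξ, h1, h2, abs_lt.2 ⟨(abs_lt.1 hx).1.trans h1, h2.trans (abs_lt.1 hy).2⟩, ?_⟩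
  rw [hFx, hFy] at h3
  have : y - x ≠ 0 := (sub_pos.2 hxy).ne'
  have : P ξ = 1 := by
    have h4 : (P ξ - 1) * (y - x) = 0 := by linarith
    linarith [(mul_eq_zero.1 h4).resolve_right this]
  rw [this]; ring

/-- By the mean value theorem four fixed points give three zeros of P - 1, whereas a strictly
concave function has at most two. -/
theorem not_four_fixed (h : ConcaveDeriv F P r σ) {x y z t : ℝ} (hx : |x| < r) (ht : |t| < r)
    (hxy : x < y) (hyz : y < z) (hzt : z < t) (h1 : F x = x) (h2 : F y = y) (h3 : F z = z)
    (h4 : F t = t) : False := by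
  have hy : |y| < r := abs_lt.2 ⟨by linarith [(abs_lt.1 hx).1], by linarith [(abs_lt.1 ht).2]⟩
  have hz : |z| < r := abs_lt.2 ⟨by linarith [(abs_lt.1 hx).1], by linarith [(abs_lt.1 ht).2]⟩
  obtain ⟨a, -, a2, a3, a4⟩ := h.exists_critical hx hy hxy h1 h2
  obtain ⟨b, b1, b2, b3, b4⟩ := h.exists_critical hy hz hyz h2 h3
  obtain ⟨c, c1, -, c3, c4⟩ := h.exists_critical hz ht hzt h3 h4
  have := h.concave'.pos_of_zeros (abs_lt.1 a3) (abs_lt.1 c3) (a2.trans b1) (b2.trans c1)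
    a4.ge c4.ge
  linarith

/-- Three fixed points enclose the two zeros of P - 1. Concavity then fixes its sign between and
outside them: these are the stability of the outer pair and the direction of motion beyond it. -/
theorem signs_of_three_fixed (h : ConcaveDeriv F P r σ) {x y z : ℝ} (hx : |x| < r) (hz : |z| < r)
    (hxy : x < y) (hyz : y < z) (h1 : F x = x) (h2 : F y = y) (h3 : F z = z) :
    0 < σ * (P y - 1) ∧ σ * (P x - 1) < 0 ∧ σ * (P z - 1) < 0 ∧
      ∀ t, z < t → |t| < r → σ * (F t - t) < 0 := by
  have hy : |y| < r := abs_lt.2 ⟨by linarith [(abs_lt.1 hx).1], by linarith [(abs_lt.1 hz).2]⟩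
  obtain ⟨a, a1, a2, a3, a4⟩ := h.exists_critical hx hy hxy h1 h2
  obtain ⟨b, b1, b2, b3, b4⟩ := h.exists_critical hy hz hyz h2 h3
  have hab := a2.trans b1
  have hright : ∀ t, b < t → |t| < r → σ * (P t - 1) < 0 := fun t hbt ht => by
    by_contra hcon
    have := h.concave'.pos_of_zeros (abs_lt.1 a3) (abs_lt.1 ht) hab hbt a4.ge (not_lt.1 hcon)
    linarith
  have hleft : ∀ t, t < a → |t| < r → σ * (P t - 1) < 0 := fun t hta ht => by
    by_contra hcon
    have := h.concave'.pos_of_zeros (abs_lt.1 ht) (abs_lt.1 b3) hta hab (not_lt.1 hcon) b4.ge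
    linarith
  refine ⟨h.concave'.pos_of_zeros (abs_lt.1 a3) (abs_lt.1 b3) a2 b1 a4.ge b4.ge,
    hleft x a1 hx, hright z b2 hz, fun t hzt ht => ?_⟩
  obtain ⟨ξ, e1, e2, e3⟩ := h.exists_slope hz ht hzt
  have h4 := hright ξ (b2.trans e1)
    (abs_lt.2 ⟨by linarith [(abs_lt.1 hz).1], e2.trans (abs_lt.1 ht).2⟩)
  rw [h3] at e3
  have : σ * (F t - t) = σ * (P ξ - 1) * (t - z) := by
    rw [show F t = z + P ξ * (t - z) by linarith]; ring
  rw [this]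
  exact mul_neg_of_neg_of_pos h4 (sub_pos.2 hzt)

/-- The displacement σ (F t - t) is positive just to the right of x, by its derivative there, and
negative at b. -/
theorem exists_fixed_right (h : ConcaveDeriv F P r σ) {x b : ℝ} (hx : |x| < r) (hb : |b| < r)
    (hxb : x < b) (hF : F x = x) (h1 : 0 < σ * (P x - 1)) (h2 : σ * (F b - b) < 0) :
    ∃ y, x < y ∧ y < b ∧ F y = y := by
  have hd : HasDerivAt (fun t => σ * (F t - t)) (σ * (P x - 1)) x :=
    ((h.hasDerivAt x hx).sub (hasDerivAt_id x)).const_mul σ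
  have hσ : σ ≠ 0 := by rintro rfl; simp at h1
  obtain ⟨t, htx, htb, ht⟩ : ∃ t, x < t ∧ t < b ∧ 0 < σ * (F t - t) := by
    have hs := (hasDerivAt_iff_tendsto_slope.1 hd).mono_left
      (nhdsWithin_mono x fun t (ht : x < t) => ht.ne')
    have hev : ∀ᶠ t in 𝓝[>] x, 0 < slope (fun t => σ * (F t - t)) x t :=
      hs.eventually (lt_mem_nhds h1)
    obtain ⟨t, ht, ht'⟩ := (hev.and (Ioo_mem_nhdsGT hxb)).exists
    refine ⟨t, ht'.1, ht'.2, ?_⟩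
    rw [slope_def_field, hF] at ht
    have := (div_pos_iff_of_pos_right (sub_pos.2 ht'.1)).1 ht
    simpa using this
  have hsub : Icc t b ⊆ Ioo (-r) r :=
    Icc_subset_Ioo (by linarith [(abs_lt.1 hx).1]) (abs_lt.1 hb).2
  have hc : ContinuousOn (fun t => σ * (F t - t)) (Icc t b) :=
    continuousOn_const.mul ((h.continuousOn.mono hsub).sub continuousOn_id)
  obtain ⟨y, hy, hy0⟩ := intermediate_value_Icc' htb.le hc (show (0 : ℝ) ∈ Icc _ _ from ⟨h2.le, ht.le⟩)
  simp only [mul_eq_zero, hσ, false_or] at hy0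
  refine ⟨y, htx.trans_le hy.1, lt_of_le_of_ne hy.2 ?_, by linarith⟩
  rintro rfl
  rw [hy0, mul_zero] at h2
  exact h2.false

end ConcaveDeriv

end StrictConcave

/-! ### Fixed points and two-cycles at fixed parameter values. -/

section FlipMaps

theorem SecantBound.mono {L : ℝ → ℝ} {m κ ε r : ℝ} (h : SecantBound L m κ r) (hr : ε ≤ r) :
    SecantBound L m κ ε := fun x y hx hy => h x y (hx.trans_le hr) (hy.trans_le hr)

theorem SecantBound.strictAntiOn {L : ℝ → ℝ} {m κ ε : ℝ} (h : SecantBound L m κ ε)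
    (hm : m + κ < 0) : StrictAntiOn L (Ioo (-ε) ε) := fun x hx y hy hxy => by
  have := (h x y (abs_lt.2 hx) (abs_lt.2 hy) hxy.le).2
  nlinarith

/-- A two-cycle of a strictly decreasing map surrounds its fixed point. -/
theorem IsTwoCycle.surrounds {L : ℝ → ℝ} {s : Set ℝ} (hL : StrictAntiOn L s) {z : ℝ × ℝ}
    (h : IsTwoCycle L z) (h1 : z.1 ∈ s) (h2 : z.2 ∈ s) {x : ℝ} (hx : x ∈ s) (hfix : L x = x) :
    z.1 < x ∧ x < z.2 := by
  obtain ⟨hlt, e1, e2⟩ := h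
  constructor
  · by_contra hcon
    have := hL.antitoneOn hx h1 (not_lt.1 hcon)
    rw [hfix, e1] at this
    linarith [not_lt.1 hcon]
  · by_contra hcon
    have := hL.antitoneOn h2 hx (not_lt.1 hcon)
    rw [hfix, e2] at this
    linarith [not_lt.1 hcon]

/-- Data of the two half-maps near the origin, at fixed parameter values. -/
structure FlipMaps (L R L₁ R₁ P : ℝ → ℝ) (a κ r x₀ : ℝ) : Prop where
  secL : SecantBound L (-1) κ r
  secR : SecantBound R a κ r
  zero_eq : L 0 = R 0
  derivL : ∀ x, |x| < r → HasDerivAt L (L₁ x) x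
  derivR : ∀ x, |x| < r → HasDerivAt R (R₁ x) x
  derivL_le : ∀ x, |x| < r → |L₁ x + 1| ≤ κ
  derivR_le : ∀ x, |x| < r → |R₁ x - a| ≤ κ
  derivLL : ∀ x, |x| < r → HasDerivAt (fun x => L (L x)) (P x) x
  derivLL_le : ∀ x, |x| < r → |P x - 1| ≤ 1 / 2
  fixed : L x₀ = x₀
  derivLL_fixed : P x₀ = L₁ x₀ ^ 2
  return_le : |L (L 0)| ≤ κ * |L 0|

variable {L R L₁ R₁ P : ℝ → ℝ} {a κ r x₀ ε σ : ℝ}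

namespace FlipMaps

theorem eventuallyEq_left (L R : ℝ → ℝ) {x : ℝ} (hx : x < 0) : pw L R =ᶠ[𝓝 x] L := by
  filter_upwards [Iio_mem_nhds hx] with y hy using pw_of_nonpos (le_of_lt hy)

theorem eventuallyEq_right (L R : ℝ → ℝ) {x : ℝ} (hx : 0 < x) : pw L R =ᶠ[𝓝 x] R := by
  filter_upwards [Ioi_mem_nhds hx] with y hy using pw_of_pos hy

theorem hasDerivAt_pw_left (h : FlipMaps L R L₁ R₁ P a κ r x₀) {x : ℝ} (hx : |x| < r)
    (hx0 : x < 0) : HasDerivAt (pw L R) (L₁ x) x :=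
  (h.derivL x hx).congr_of_eventuallyEq (eventuallyEq_left L R hx0)

theorem hasDerivAt_pw_right (h : FlipMaps L R L₁ R₁ P a κ r x₀) {x : ℝ} (hx : |x| < r)
    (hx0 : 0 < x) : HasDerivAt (pw L R) (R₁ x) x :=
  (h.derivR x hx).congr_of_eventuallyEq (eventuallyEq_right L R hx0)

theorem hasDerivAt_iterate_two {f : ℝ → ℝ} {d e x : ℝ} (h1 : HasDerivAt f d x)
    (h2 : HasDerivAt f e (f x)) : HasDerivAt f^[2] (e * d) x :=
  h2.comp x h1

theorem fixed_neg_iff (h : FlipMaps L R L₁ R₁ P a κ r x₀) (hκ : κ < 1) (hx₀ : |x₀| < r) :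
    x₀ < 0 ↔ L 0 < 0 := by
  have hz : |(0 : ℝ)| < r := by rw [abs_zero]; exact (abs_nonneg _).trans_lt hx₀
  have hA := h.secL.strictAntiOn (by linarith)
  constructor
  · intro hx
    have := hA (abs_lt.1 hx₀) (abs_lt.1 hz) hx
    rw [h.fixed] at this
    linarith
  · intro hc
    by_contra hcon
    have := hA.antitoneOn (abs_lt.1 hz) (abs_lt.1 hx₀) (not_lt.1 hcon)
    rw [h.fixed] at this
    linarith

theorem eq_fixed (h : FlipMaps L R L₁ R₁ P a κ r x₀) (hκ : κ < 1) (hx₀ : |x₀| < r) {x : ℝ}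
    (hx : |x| < r) (hfix : L x = x) : x = x₀ := by
  have hA := h.secL.strictAntiOn (by linarith)
  rcases lt_trichotomy x x₀ with hlt | heq | hlt
  · have := hA (abs_lt.1 hx) (abs_lt.1 hx₀) hlt
    rw [h.fixed, hfix] at this
    linarith
  · exact heq
  · have := hA (abs_lt.1 hx₀) (abs_lt.1 hx) hlt
    rw [h.fixed, hfix] at this
    linarith

theorem isTwoCycle_of_pw {z : ℝ × ℝ} (h : IsTwoCycle (pw L R) z) (hz : z.2 ≤ 0) :
    IsTwoCycle L z :=
  ⟨h.1, by rw [← h.2.1, pw_of_nonpos (h.1.le.trans hz)], by rw [← h.2.2, pw_of_nonpos hz]⟩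

theorem isTwoCycle_pw {z : ℝ × ℝ} (h : IsTwoCycle L z) (hz : z.2 ≤ 0) :
    IsTwoCycle (pw L R) z :=
  ⟨h.1, by rw [pw_of_nonpos (h.1.le.trans hz), h.2.1], by rw [pw_of_nonpos hz, h.2.2]⟩

theorem signs_of_isTwoCycle (h : FlipMaps L R L₁ R₁ P a κ r x₀) (hκ : κ < 1) (hx₀ : |x₀| < r)
    (hP : StrictConcaveOn ℝ (Ioo (-r) r) fun x => σ * P x) {z : ℝ × ℝ} (hz : IsTwoCycle L z)
    (h1 : |z.1| < r) (h2 : |z.2| < r) :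
    0 < σ * (P x₀ - 1) ∧ σ * (P z.1 - 1) < 0 ∧ σ * (P z.2 - 1) < 0 ∧
      ∀ t, z.2 < t → |t| < r → σ * (L (L t) - t) < 0 := by
  have hA := h.secL.strictAntiOn (by linarith)
  obtain ⟨e1, e2⟩ := hz.surrounds hA (abs_lt.1 h1) (abs_lt.1 h2) (abs_lt.1 hx₀) h.fixed
  exact (ConcaveDeriv.mk h.derivLL hP).signs_of_three_fixed h1 h2 e1 e2
    (by rw [hz.2.1, hz.2.2]) (by rw [h.fixed, h.fixed]) (by rw [hz.2.2, hz.2.1])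

/-- Both cycles surround x₀, so distinct right endpoints would give four fixed points of L ∘ L. -/
theorem isTwoCycle_unique (h : FlipMaps L R L₁ R₁ P a κ r x₀) (hκ : κ < 1) (hx₀ : |x₀| < r)
    (hP : StrictConcaveOn ℝ (Ioo (-r) r) fun x => σ * P x) {z z' : ℝ × ℝ} (hz : IsTwoCycle L z)
    (h1 : |z.1| < r) (h2 : |z.2| < r) (hz' : IsTwoCycle L z') (h1' : |z'.1| < r)
    (h2' : |z'.2| < r) : z' = z := by
  have hA := h.secL.strictAntiOn (by linarith)
  have hC := ConcaveDeriv.mk h.derivLL hP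
  obtain ⟨e1, e2⟩ := hz.surrounds hA (abs_lt.1 h1) (abs_lt.1 h2) (abs_lt.1 hx₀) h.fixed
  obtain ⟨e1', e2'⟩ := hz'.surrounds hA (abs_lt.1 h1') (abs_lt.1 h2') (abs_lt.1 hx₀) h.fixed
  have f0 : L (L x₀) = x₀ := by rw [h.fixed, h.fixed]
  have f1 : L (L z.1) = z.1 := by rw [hz.2.1, hz.2.2]
  have f2 : L (L z.2) = z.2 := by rw [hz.2.2, hz.2.1]
  have f2' : L (L z'.2) = z'.2 := by rw [hz'.2.2, hz'.2.1]
  have h22 : z'.2 = z.2 := by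
    rcases lt_trichotomy z'.2 z.2 with hlt | heq | hlt
    · exact (hC.not_four_fixed h1 h2 e1 e2' hlt f1 f0 f2' f2).elim
    · exact heq
    · exact (hC.not_four_fixed h1 h2' e1 e2 hlt f1 f0 f2 f2').elim
  refine Prod.ext ?_ h22
  rw [← hz'.2.2, h22, hz.2.2]

theorem isTwoCycle_of_fixed_right (h : FlipMaps L R L₁ R₁ P a κ r x₀) (hκ : κ < 1)
    (hx₀ : |x₀| < r) {y b : ℝ} (hb : |b| < r) (hxy : x₀ < y) (hyb : y < b) (hy : L (L y) = y) :
    IsTwoCycle L (L y, y) ∧ L b < L y ∧ L y < x₀ := by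
  have hA := h.secL.strictAntiOn (by linarith)
  have hyI : y ∈ Ioo (-r) r := ⟨(abs_lt.1 hx₀).1.trans hxy, hyb.trans (abs_lt.1 hb).2⟩
  have h1 := hA (abs_lt.1 hx₀) hyI hxy
  rw [h.fixed] at h1
  exact ⟨⟨h1.trans hxy, hy, rfl⟩, hA hyI (abs_lt.1 hb) hyb, h1⟩

/-- The right point of the cycle is a fixed point of L ∘ L between x₀ and 0. The last two conditions
are the signs of its displacement just beyond x₀ and at 0; concavity makes them necessary as well.
-/
theorem cycle_left (h : FlipMaps L R L₁ R₁ P a κ r x₀) (hκ : κ < 1) (hε : ε ≤ r)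
    (hx₀ : |x₀| < ε) (hc : |L 0| < ε)
    (hP : StrictConcaveOn ℝ (Ioo (-r) r) fun x => σ * P x) :
    UniqueExactlyWhen (fun z => IsTwoCycle (pw L R) z ∧ CycleWithin 0 ε z ∧ z.2 < 0)
      (L 0 < 0 ∧ 0 < σ * (P x₀ - 1) ∧ σ * L (L 0) < 0) := by
  have hx₀r := hx₀.trans_le hε
  have hz : |(0 : ℝ)| < r := by rw [abs_zero]; exact (abs_nonneg _).trans_lt hx₀r
  simp only [CycleWithin, sub_zero]
  constructor
  · rintro ⟨hc0, h1, h2⟩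
    have hx0 := (h.fixed_neg_iff hκ hx₀r).2 hc0
    obtain ⟨y, hxy, hy0, hy⟩ := (ConcaveDeriv.mk h.derivLL hP).exists_fixed_right hx₀r hz hx0
      (by rw [h.fixed, h.fixed]) h1 (by rwa [sub_zero])
    obtain ⟨e1, e2, e3⟩ := h.isTwoCycle_of_fixed_right hκ hx₀r hz hxy hy0 hy
    have hLy : |L y| < ε := abs_lt.2 ⟨by linarith [(abs_lt.1 hc).1], by linarith [(abs_lt.1 hx₀).2]⟩
    have hyε : |y| < ε := abs_lt.2 ⟨by linarith [(abs_lt.1 hx₀).1], by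
      linarith [(abs_nonneg _).trans_lt hx₀]⟩
    refine ⟨(L y, y), ⟨isTwoCycle_pw e1 hy0.le, ⟨hLy, hyε⟩, hy0⟩, ?_⟩
    rintro z ⟨hz1, hz2, hz3⟩
    exact h.isTwoCycle_unique hκ hx₀r hP e1 (hLy.trans_le hε) (hyε.trans_le hε)
      (isTwoCycle_of_pw hz1 hz3.le) (hz2.1.trans_le hε) (hz2.2.trans_le hε)
  · rintro ⟨z, hz1, hz2, hz3⟩
    have hzL := isTwoCycle_of_pw hz1 hz3.le
    have hA := h.secL.strictAntiOn (by linarith)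
    obtain ⟨e1, -, -, e2⟩ := h.signs_of_isTwoCycle hκ hx₀r hP hzL (hz2.1.trans_le hε)
      (hz2.2.trans_le hε)
    have hs := (hzL.surrounds hA (abs_lt.1 (hz2.1.trans_le hε)) (abs_lt.1 (hz2.2.trans_le hε))
      (abs_lt.1 hx₀r) h.fixed).2
    have := e2 0 hz3 hz
    rw [sub_zero] at this
    exact ⟨(h.fixed_neg_iff hκ hx₀r).1 (hs.trans hz3), e1, this⟩

theorem hasDerivAt_cycle_left (h : FlipMaps L R L₁ R₁ P a κ r x₀) {z : ℝ × ℝ}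
    (hz : IsTwoCycle (pw L R) z) (h1 : |z.1| < r) (h2 : |z.2| < r) (h3 : z.2 < 0) :
    HasDerivAt (pw L R)^[2] (P z.1) z.1 ∧ HasDerivAt (pw L R)^[2] (P z.2) z.2 := by
  have key : ∀ x y : ℝ, |x| < r → |y| < r → x < 0 → y < 0 → L x = y →
      HasDerivAt (pw L R)^[2] (P x) x := by
    intro x y hx hy hx0 hy0 hxy
    refine (h.derivLL x hx).congr_of_eventuallyEq ?_
    have hcont : ContinuousAt L x := (h.derivL x hx).continuousAt
    filter_upwards [Iio_mem_nhds hx0, hcont (Iio_mem_nhds (show L x < 0 by rw [hxy]; exact hy0))]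
      with t ht1 ht2
    change pw L R (pw L R t) = L (L t)
    rw [pw_of_nonpos (le_of_lt ht1), pw_of_nonpos (le_of_lt ht2)]
  have hzL := isTwoCycle_of_pw hz h3.le
  exact ⟨key _ _ h1 h2 (hz.1.trans h3) h3 hzL.2.1, key _ _ h2 h1 h3 (hz.1.trans h3) hzL.2.2⟩

end FlipMaps

end FlipMaps

section FlipMaps

variable {L R L₁ R₁ P : ℝ → ℝ} {a κ r x₀ ε σ : ℝ}

namespace FlipMaps

/-- Secant slopes of `y ↦ L (R y)`. -/
theorem secant_right_left (h : FlipMaps L R L₁ R₁ P a κ r x₀) (hκ0 : 0 < κ) (hκ : κ ≤ 1)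
    {y y' : ℝ} (hy : |y| < r) (hy' : |y'| < r) (hyy : y ≤ y') (hR : |R y| < r) (hR' : |R y'| < r) :
    |L (R y') - L (R y) + a * (y' - y)| ≤ κ * (|a| + 2) * (y' - y) := by
  obtain ⟨h1, h2⟩ := h.secR y y' hy hy' hyy
  have hd := sub_nonneg.2 hyy
  have hκd := mul_nonneg hκ0.le hd
  have key : |L (R y') - L (R y) + (R y' - R y)| ≤ κ * |R y' - R y| := by
    rcases le_total (R y) (R y') with hle | hle
    · obtain ⟨h3, h4⟩ := h.secL _ _ hR hR' hle
      rw [abs_of_nonneg (sub_nonneg.2 hle), abs_le]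
      constructor <;> linarith
    · obtain ⟨h3, h4⟩ := h.secL _ _ hR' hR hle
      rw [abs_sub_comm (R y'), abs_of_nonneg (sub_nonneg.2 hle), abs_le]
      constructor <;> linarith
  have h5 : |R y' - R y| ≤ (|a| + 1) * (y' - y) := by
    rw [abs_le]
    constructor
    · nlinarith [neg_abs_le a]
    · nlinarith [le_abs_self a]
  have h6 : |a * (y' - y) - (R y' - R y)| ≤ κ * (y' - y) := by
    rw [abs_le]; constructor <;> linarith
  calc |L (R y') - L (R y) + a * (y' - y)|
      = |(L (R y') - L (R y) + (R y' - R y)) + (a * (y' - y) - (R y' - R y))| := by ring_nf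
    _ ≤ |L (R y') - L (R y) + (R y' - R y)| + |a * (y' - y) - (R y' - R y)| := abs_add_le _ _
    _ ≤ κ * ((|a| + 1) * (y' - y)) + κ * (y' - y) :=
      add_le_add (key.trans (mul_le_mul_of_nonneg_left h5 hκ0.le)) h6
    _ = _ := by ring

theorem abs_right_sub_le (h : FlipMaps L R L₁ R₁ P a κ r x₀) (hκ : κ ≤ 1) {y : ℝ}
    (hy : |y| < r) (hy0 : 0 ≤ y) : |R y - L 0| ≤ (|a| + 1) * y := by
  have := h.secR.abs_image_sub_le (B := |a| + 1) (by linarith [neg_abs_le a])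
    (by linarith [le_abs_self a]) hy (show |(0 : ℝ)| < r by
      rw [abs_zero]; exact (abs_nonneg _).trans_lt hy)
  rwa [← h.zero_eq, sub_zero, abs_of_nonneg hy0] at this

/-- A crossing cycle is (R y, y) with L (R y) = y. As L (R y) ≈ w - a y with w = L (L 0), the
solution is y ≈ w / (a + 1), which is positive iff w and a + 1 have the same sign. It is small
compared with |L 0|, so R y ≈ L 0, and R y < 0 forces L 0 < 0. -/
theorem cycle_right (h : FlipMaps L R L₁ R₁ P a κ r x₀) (hκ0 : 0 < κ) (hκ : κ ≤ 1) (hε : ε ≤ r)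
    (hc : 2 * |L 0| < ε) (ha : a ≠ -1) (hκ1 : 2 * (κ * (|a| + 2)) ≤ |a + 1|)
    (hκ2 : 4 * (κ * (|a| + 1)) ≤ |a + 1|) :
    UniqueExactlyWhen (fun z => IsTwoCycle (pw L R) z ∧ CycleWithin 0 ε z ∧ z.1 < 0 ∧ 0 < z.2)
      (L 0 < 0 ∧ 0 < (a + 1) * L (L 0)) := by
  simp only [CycleWithin, sub_zero]
  have hε0 : 0 < ε := by linarith [abs_nonneg (L 0)]
  have hz : |(0 : ℝ)| < r := by rw [abs_zero]; linarith
  have ha' : a + 1 ≠ 0 := fun h => ha (by linarith)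
  have hα : 0 < |a + 1| := abs_pos.2 ha'
  have hcr : |L 0| < r := by linarith [abs_nonneg (L 0)]
  set α := |a + 1| with hαdef
  set t := L 0 with ht
  set w := L t with hw
  have hwt : |w| ≤ κ * |t| := h.return_le
  have hG0 : ∀ y, 0 ≤ y → |y| < r → |R y| < r →
      |L (R y) - w + a * y| ≤ κ * (|a| + 2) * y := fun y hy hyr hR => by
    have := h.secant_right_left hκ0 hκ hz hyr hy (by rwa [← h.zero_eq]) hR
    rwa [← h.zero_eq, sub_zero] at this
  have hbound : ∀ y, 0 ≤ y → α * y ≤ 2 * |w| → |y| < r → |R y - t| ≤ |t| / 2 := by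
    intro y hy hyw hyr
    refine (h.abs_right_sub_le hκ hyr hy).trans ?_
    have h1 : α * ((|a| + 1) * y) ≤ α * (|t| / 2) :=
      calc α * ((|a| + 1) * y) = (|a| + 1) * (α * y) := by ring
        _ ≤ (|a| + 1) * (2 * (κ * |t|)) := by
          have : α * y ≤ 2 * (κ * |t|) := hyw.trans (by linarith)
          gcongr
        _ = (4 * (κ * (|a| + 1))) * (|t| / 2) := by ring
        _ ≤ _ := by gcongr
    exact le_of_mul_le_mul_left h1 hα
  have hRlt : ∀ y, |R y - t| ≤ |t| / 2 → |R y| < ε := fun y hy => by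
    have := abs_sub_abs_le_abs_sub (R y) t
    linarith [abs_nonneg t]
  constructor
  · rintro ⟨ht0, hpos⟩
    have hw0 : w ≠ 0 := fun h0 => by rw [h0, mul_zero] at hpos; exact hpos.false
    -- Twice the size of the approximate solution, which leaves room for the nonlinear error in the
    -- sign at Y.
    set Y := 2 * |w| / α with hY
    have hYα : α * Y = 2 * |w| := by rw [hY]; field_simp
    have hY0 : 0 < Y := by positivity
    have hYt : Y ≤ |t| := by
      have h4κ : 2 * κ ≤ α := by nlinarith [abs_nonneg a]
      rw [hY, div_le_iff₀ hα]
      nlinarith [abs_nonneg t]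
    have hyr : ∀ y, 0 ≤ y → y ≤ Y → |y| < ε := fun y hy hyY => by
      rw [abs_of_nonneg hy]; linarith [abs_nonneg t]
    have hRb : ∀ y, 0 ≤ y → y ≤ Y → |R y - t| ≤ |t| / 2 := fun y hy hyY =>
      hbound y hy (by rw [← hYα]; gcongr) ((hyr y hy hyY).trans_le hε)
    have hcont : ContinuousOn (fun y => (a + 1) * (L (R y) - y)) (Icc 0 Y) := by
      refine continuousOn_const.mul (ContinuousOn.sub ?_ continuousOn_id)
      refine h.secL.continuousOn.comp (h.secR.continuousOn.mono fun y hy => ?_) fun y hy => ?_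
      · exact abs_lt.1 ((hyr y hy.1 hy.2).trans_le hε)
      · exact abs_lt.1 ((hRlt y (hRb y hy.1 hy.2)).trans_le hε)
    have hend : (a + 1) * (L (R Y) - Y) ≤ 0 := by
      have h1 := hG0 Y hY0.le ((hyr Y hY0.le le_rfl).trans_le hε)
        ((hRlt Y (hRb Y hY0.le le_rfl)).trans_le hε)
      have h2 : κ * (|a| + 2) * Y ≤ |w| := by nlinarith
      have h3 := abs_le.1 (h1.trans h2)
      rcases lt_or_gt_of_ne ha' with hneg | hp
      · have hw1 : w < 0 := by nlinarith
        rw [hαdef, abs_of_neg hneg, abs_of_neg hw1] at hYα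
        rw [abs_of_neg hw1] at h3
        nlinarith
      · have hw1 : 0 < w := by nlinarith
        rw [hαdef, abs_of_pos hp, abs_of_pos hw1] at hYα
        rw [abs_of_pos hw1] at h3
        nlinarith
    obtain ⟨y, hy, hy0⟩ := intermediate_value_Icc' hY0.le hcont
      (show (0 : ℝ) ∈ Icc _ _ from ⟨hend, by rw [← h.zero_eq, sub_zero]; exact hpos.le⟩)
    have hfix : L (R y) = y := by
      rcases mul_eq_zero.1 hy0 with h' | h'
      · exact absurd h' ha'
      · linarith
    have hypos : 0 < y := lt_of_le_of_ne hy.1 (by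
      rintro rfl
      rw [← h.zero_eq] at hfix
      exact hw0 hfix)
    have hRy := hRb y hy.1 hy.2
    have hRneg : R y < 0 := by
      rw [abs_of_neg ht0] at hRy
      linarith [(abs_le.1 hRy).2]
    refine ⟨(R y, y), ⟨⟨hRneg.trans hypos, ?_, ?_⟩, ⟨hRlt y hRy, hyr y hy.1 hy.2⟩, hRneg, hypos⟩, ?_⟩
    · simp only [pw_of_nonpos hRneg.le, hfix]
    · simp only [pw_of_pos hypos]
    · rintro ⟨u, v⟩ ⟨⟨-, hz1, hz2⟩, ⟨hz3, hz4⟩, hz5, hz6⟩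
      simp only at hz1 hz2 hz3 hz4 hz5 hz6
      rw [pw_of_nonpos hz5.le] at hz1
      rw [pw_of_pos hz6] at hz2
      have hvy : v = y := by
        have hkey : ∀ p q : ℝ, |p| < r → |q| < r → p ≤ q → |R p| < r → |R q| < r →
            L (R p) = p → L (R q) = q → q ≤ p := by
          intro p q hp hq hpq hRp hRq h1 h2
          have := h.secant_right_left hκ0 hκ hp hq hpq hRp hRq
          rw [h1, h2, show q - p + a * (q - p) = (a + 1) * (q - p) by ring, abs_mul,
            abs_of_nonneg (sub_nonneg.2 hpq)] at this
          nlinarith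
        have hvr := hz4.trans_le hε
        have hRv : |R v| < r := by rw [hz2]; exact hz3.trans_le hε
        have hyr' := (hyr y hy.1 hy.2).trans_le hε
        have hRyr := (hRlt y hRy).trans_le hε
        have hLv : L (R v) = v := by rw [hz2, hz1]
        rcases le_total v y with hle | hle
        · exact le_antisymm hle (hkey v y hvr hyr' hle hRv hRyr hLv hfix)
        · exact le_antisymm (hkey y v hyr' hvr hle hRyr hRv hfix hLv) hle
      rw [← hz2, hvy]
  · rintro ⟨⟨u, v⟩, ⟨-, hz1, hz2⟩, ⟨hz3, hz4⟩, hz5, hz6⟩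
    simp only at hz1 hz2 hz3 hz4 hz5 hz6
    rw [pw_of_nonpos hz5.le] at hz1
    rw [pw_of_pos hz6] at hz2
    have hvr := hz4.trans_le hε
    have hRv : |R v| < r := by rw [hz2]; exact hz3.trans_le hε
    have h1 := hG0 v hz6.le hvr hRv
    rw [hz2, hz1, show v - w + a * v = (a + 1) * v - w by ring] at h1
    have h2 : |(a + 1) * v - w| ≤ α * v / 2 := h1.trans (by nlinarith)
    have h3 : α * v ≤ 2 * |w| := by
      have := abs_sub_abs_le_abs_sub ((a + 1) * v) w
      rw [abs_mul, abs_of_pos hz6] at this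
      linarith
    have h4 := hbound v hz6.le h3 hvr
    rw [hz2] at h4
    constructor
    · by_contra hcon
      rw [abs_of_nonneg (not_lt.1 hcon)] at h4
      linarith [(abs_le.1 h4).1, not_lt.1 hcon]
    · have hαv : 0 < α * v := mul_pos hα hz6
      have h5 := abs_le.1 h2
      rcases lt_or_gt_of_ne ha' with hneg | hp
      · rw [hαdef, abs_of_neg hneg] at h5 hαv
        have : w < 0 := by linarith [h5.1, h5.2]
        exact mul_pos_of_neg_of_neg hneg this
      · rw [hαdef, abs_of_pos hp] at h5 hαv
        have : 0 < w := by linarith [h5.1, h5.2]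
        exact mul_pos hp this

theorem cycle_zero (L R : ℝ → ℝ) (hc : |L 0| < ε) :
    UniqueExactlyWhen (fun z => IsTwoCycle (pw L R) z ∧ CycleWithin 0 ε z ∧ z.2 = 0)
      (L 0 < 0 ∧ L (L 0) = 0) := by
  simp only [CycleWithin, sub_zero]
  constructor
  · rintro ⟨h1, h2⟩
    refine ⟨(L 0, 0), ⟨⟨h1, ?_, ?_⟩, ⟨hc, by rw [abs_zero]; exact (abs_nonneg _).trans_lt hc⟩, rfl⟩, ?_⟩
    · simp only [pw_of_nonpos h1.le, h2]
    · simp only [pw_of_nonpos le_rfl]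
    · rintro ⟨u, v⟩ ⟨⟨-, -, hz2⟩, -, hz5⟩
      simp only at hz2 hz5
      subst hz5
      rw [pw_of_nonpos le_rfl] at hz2
      rw [hz2]
  · rintro ⟨⟨u, v⟩, ⟨hz0, hz1, hz2⟩, -, hz5⟩
    simp only at hz0 hz1 hz2 hz5
    subst hz5
    rw [pw_of_nonpos le_rfl] at hz2
    rw [pw_of_nonpos hz0.le] at hz1
    rw [hz2]
    exact ⟨hz0, hz1⟩

/-- A two-cycle within x ≥ 0 would be a secant of R of slope -1. -/
theorem cycle_none (h : FlipMaps L R L₁ R₁ P a κ r x₀) (hε : ε ≤ r)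
    (hκ : κ < |a + 1|) {z : ℝ × ℝ} (hz : IsTwoCycle (pw L R) z)
    (hw : CycleWithin 0 ε z) : z.1 < 0 := by
  by_contra hcon
  have h0 := not_lt.1 hcon
  obtain ⟨h1, h2, h3⟩ := hz
  rw [pw_of_nonneg h.zero_eq h0] at h2
  rw [pw_of_nonneg h.zero_eq (h0.trans h1.le)] at h3
  simp only [CycleWithin, sub_zero] at hw
  obtain ⟨h4, h5⟩ := h.secR z.1 z.2 (hw.1.trans_le hε) (hw.2.trans_le hε) h1.le
  have : |a + 1| ≤ κ := by
    rw [abs_le]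
    constructor <;> nlinarith
  linarith

/-- The map R x ≈ L 0 + a x has its fixed point near L 0 / (1 - a), which is positive under the
stated sign condition. The search interval is twice as long. -/
theorem fixed_right (h : FlipMaps L R L₁ R₁ P a κ r x₀) (hε : ε ≤ r) (hκ0 : 0 < κ)
    (ha : a ≠ 1) (hκ : 2 * κ ≤ |a - 1|) (hc : 2 * |L 0| < |a - 1| * ε) :
    UniqueExactlyWhen (fun x => x ∈ Ioo 0 ε ∧ pw L R x = x) (0 < (1 - a) * L 0) := by
  have ha' : a - 1 ≠ 0 := sub_ne_zero.2 ha
  have hα : 0 < |a - 1| := abs_pos.2 ha'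
  have hε0 : 0 < ε := by
    by_contra hcon
    nlinarith [abs_nonneg (L 0), mul_nonneg hα.le (by linarith : 0 ≤ -ε)]
  have hz : |(0 : ℝ)| < r := by rw [abs_zero]; linarith
  set α := |a - 1| with hαdef
  set t := L 0 with ht
  have hsec : ∀ x y, |x| < r → |y| < r → x ≤ y →
      |(R y - y) - (R x - x) - (a - 1) * (y - x)| ≤ κ * (y - x) := fun x y hx hy hxy => by
    obtain ⟨h1, h2⟩ := h.secR x y hx hy hxy
    rw [abs_le]; constructor <;> linarith
  constructor
  · intro hpos
    have ht0 : t ≠ 0 := fun h0 => by rw [h0, mul_zero] at hpos; exact hpos.false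
    set X := 2 * |t| / α with hX
    have hXα : α * X = 2 * |t| := by rw [hX]; field_simp
    have hX0 : 0 < X := by positivity
    have hXε : X < ε := by rw [hX, div_lt_iff₀ hα]; linarith
    have habs : ∀ y, 0 ≤ y → y < ε → |y| < r := fun y hy hyX => by
      rw [abs_of_nonneg hy]; linarith
    have hcont : ContinuousOn (fun y => (1 - a) * (R y - y)) (Icc 0 X) :=
      continuousOn_const.mul ((h.secR.continuousOn.mono fun y hy =>
        abs_lt.1 (habs y hy.1 (hy.2.trans_lt hXε))).sub continuousOn_id)
    have h1 := hsec 0 X hz (habs X hX0.le hXε) hX0.le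
    rw [← h.zero_eq, sub_zero, sub_zero] at h1
    have h2 : κ * X ≤ |t| := by nlinarith
    have h3 := abs_le.1 (h1.trans h2)
    have hend : (1 - a) * (R X - X) ≤ 0 := by
      rcases lt_or_gt_of_ne ha' with hneg | hp
      · have ht1 : 0 < t := by nlinarith
        rw [hαdef, abs_of_neg hneg, abs_of_pos ht1] at hXα
        rw [abs_of_pos ht1] at h3
        nlinarith
      · have ht1 : t < 0 := by nlinarith
        rw [hαdef, abs_of_pos hp, abs_of_neg ht1] at hXα
        rw [abs_of_neg ht1] at h3
        nlinarith
    obtain ⟨y, hy, hy0⟩ := intermediate_value_Icc' hX0.le hcont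
      (show (0 : ℝ) ∈ Icc _ _ from ⟨hend, by rw [← h.zero_eq, sub_zero]; exact hpos.le⟩)
    have hfix : R y = y := by
      rcases mul_eq_zero.1 hy0 with h' | h'
      · exact absurd (by linarith) ha'
      · linarith
    have hypos : 0 < y := lt_of_le_of_ne hy.1 (by
      rintro rfl
      rw [← h.zero_eq] at hfix
      exact ht0 hfix)
    have hyε := hy.2.trans_lt hXε
    refine ⟨y, ⟨⟨hypos, hyε⟩, by rw [pw_of_pos hypos, hfix]⟩, ?_⟩
    rintro x ⟨⟨hx0, hxε⟩, hx⟩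
    rw [pw_of_pos hx0] at hx
    have hkey : ∀ p q : ℝ, |p| < r → |q| < r → p ≤ q → R p = p → R q = q → q ≤ p := by
      intro p q hp hq hpq e1 e2
      have h4 := hsec p q hp hq hpq
      rw [e1, e2, sub_self, sub_self, sub_zero, zero_sub, abs_neg, abs_mul,
        abs_of_nonneg (sub_nonneg.2 hpq)] at h4
      nlinarith
    rcases le_total x y with hle | hle
    · exact le_antisymm hle (hkey x y (habs x hx0.le hxε) (habs y hy.1 hyε) hle hx hfix)
    · exact le_antisymm (hkey y x (habs y hy.1 hyε) (habs x hx0.le hxε) hle hfix hx) hle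
  · rintro ⟨x, ⟨hx0, hxε⟩, hx⟩
    rw [pw_of_pos hx0] at hx
    have h1 := hsec 0 x hz (by rw [abs_of_pos hx0]; linarith) hx0.le
    rw [← h.zero_eq, hx, sub_self, sub_zero, sub_zero] at h1
    have h3 := abs_le.1 h1
    have hαx : κ * x < α * x := by
      have : κ < α := by linarith
      gcongr
    rcases lt_or_gt_of_ne ha' with hneg | hp
    · rw [hαdef, abs_of_neg hneg] at hαx
      exact mul_pos (by linarith) (by linarith)
    · rw [hαdef, abs_of_pos hp] at hαx
      exact mul_pos_of_neg_of_neg (by linarith) (by linarith)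

theorem stable_cycle_right (h : FlipMaps L R L₁ R₁ P a κ r x₀) (hκ0 : 0 < κ) (hκ1 : κ < 1)
    (hs : |a| < 1 → (1 + κ) * (|a| + κ) < 1) (hu : 1 < |a| → 1 < (1 - κ) * (|a| - κ)) {z : ℝ × ℝ}
    (hz : IsTwoCycle (pw L R) z) (h1 : |z.1| < r) (h2 : |z.2| < r) (hz1 : z.1 < 0)
    (hz2 : 0 < z.2) :
    (|a| < 1 → StablePt (pw L R) 2 z.1 ∧ StablePt (pw L R) 2 z.2) ∧
      (1 < |a| → UnstablePt (pw L R) 2 z.1 ∧ UnstablePt (pw L R) 2 z.2) := by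
  have d1 := h.hasDerivAt_pw_left h1 hz1
  have d2 := h.hasDerivAt_pw_right h2 hz2
  have D1 := hasDerivAt_iterate_two d1 (by rw [hz.2.1]; exact d2)
  have D2 := hasDerivAt_iterate_two d2 (by rw [hz.2.2]; exact d1)
  have b1 := h.derivL_le _ h1
  have b2 := h.derivR_le _ h2
  have e1 : |L₁ z.1| ≤ 1 + κ := by
    have := abs_sub_abs_le_abs_sub (L₁ z.1) (-1)
    rw [sub_neg_eq_add, abs_neg, abs_one] at this
    linarith
  have e2 : 1 - κ ≤ |L₁ z.1| := by
    have := abs_sub_abs_le_abs_sub (-1) (L₁ z.1)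
    rw [abs_sub_comm, sub_neg_eq_add, abs_neg, abs_one] at this
    linarith
  have e3 : |R₁ z.2| ≤ |a| + κ := by linarith [abs_sub_abs_le_abs_sub (R₁ z.2) a]
  have e4 : |a| - κ ≤ |R₁ z.2| := by
    have := abs_sub_abs_le_abs_sub a (R₁ z.2)
    rw [abs_sub_comm] at this
    linarith
  constructor
  · intro ha
    have : |L₁ z.1| * |R₁ z.2| < 1 := (mul_le_mul e1 e3 (abs_nonneg _) (by linarith)).trans_lt (hs ha)
    refine ⟨⟨D1.differentiableAt, ?_⟩, ⟨D2.differentiableAt, ?_⟩⟩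
    · rw [D1.deriv, abs_mul]; linarith
    · rw [D2.deriv, abs_mul]; linarith
  · intro ha
    have : 1 < |L₁ z.1| * |R₁ z.2| := (hu ha).trans_le
      (mul_le_mul e2 e4 (by nlinarith [hu ha]) (abs_nonneg _))
    refine ⟨⟨D1.differentiableAt, ?_⟩, ⟨D2.differentiableAt, ?_⟩⟩
    · rw [D1.deriv, abs_mul]; linarith
    · rw [D2.deriv, abs_mul]; linarith

theorem sectorPicture (h : FlipMaps L R L₁ R₁ P a κ r x₀) {μ η η₁ η₂ c : ℝ} (hκ0 : 0 < κ)
    (hκ1 : κ ≤ 1 / 4) (ha : a ≠ 1) (ha' : a ≠ -1) (hκ2 : 2 * (κ * (|a| + 2)) ≤ |a + 1|)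
    (hκ3 : 4 * (κ * (|a| + 1)) ≤ |a + 1|) (hκ4 : 2 * κ ≤ |a - 1|)
    (hs : |a| < 1 → (1 + κ) * (|a| + κ) < 1) (hu : 1 < |a| → 1 < (1 - κ) * (|a| - κ))
    (hε : ε ≤ r) (hx₀ : |x₀| < ε) (hc1 : 2 * |L 0| < ε) (hc2 : 2 * |L 0| < |a - 1| * ε)
    (hc : c ≠ 0) (hP : 0 < c → StrictConcaveOn ℝ (Ioo (-r) r) fun x => 1 * P x)
    (hP' : c < 0 → StrictConcaveOn ℝ (Ioo (-r) r) fun x => (-1) * P x)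
    (hμneg : L 0 < 0 ↔ μ < 0) (hμpos : 0 < L 0 ↔ 0 < μ)
    (hη₁ : η₁ < η ↔ -1 < L₁ x₀) (hη₁' : η < η₁ ↔ L₁ x₀ < -1)
    (hη₂ : μ < 0 → (η₂ < η ↔ L (L 0) < 0)) (hη₂' : μ < 0 → (η < η₂ ↔ 0 < L (L 0))) :
    SectorPicture (pw L R) ε μ η η₁ η₂ a c := by
  have hx₀r := hx₀.trans_le hε
  have hκlt : κ < 1 := by linarith
  have hε0 : 0 < ε := (abs_nonneg _).trans_lt hx₀
  have hcε : |L 0| < ε := by linarith [abs_nonneg (L 0)]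
  have hα : 0 < |a + 1| := abs_pos.2 fun h => ha' (by linarith)
  have hM := abs_le.1 (h.derivL_le x₀ hx₀r)
  have hη₂z : μ < 0 → (η = η₂ ↔ L (L 0) = 0) := fun hμ => by
    have e1 := hη₂ hμ
    have e2 := hη₂' hμ
    constructor
    · rintro rfl
      exact le_antisymm (not_lt.1 fun hcon => (e2.2 hcon).false)
        (not_lt.1 fun hcon => (e1.2 hcon).false)
    · intro h0
      rw [h0] at e1 e2
      exact le_antisymm (not_lt.1 fun hcon => (e1.1 hcon).false)
        (not_lt.1 fun hcon => (e2.1 hcon).false)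
  -- With M the multiplier of x₀, M² - 1 = (1 - M)(-1 - M) and 1 - M > 0. The side of η₁ on which η
  -- lies therefore decides the sign required by `cycle_left`.
  have hMsq : ∀ s : ℝ, s * (P x₀ - 1) = s * ((1 - L₁ x₀) * (-1 - L₁ x₀)) := fun s => by
    rw [h.derivLL_fixed]; ring
  have hM1 : 0 < 1 - L₁ x₀ := by linarith [hM.2]
  have hgt : 0 < 1 * (P x₀ - 1) ↔ η < η₁ := by
    rw [hMsq, one_mul, mul_pos_iff_of_pos_left hM1, hη₁', sub_pos]
  have hlt : 0 < -1 * (P x₀ - 1) ↔ η₁ < η := by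
    rw [hMsq, hη₁]
    constructor <;> intro h1 <;> nlinarith
  have within : ∀ {z : ℝ × ℝ}, CycleWithin 0 ε z → |z.1| < r ∧ |z.2| < r := fun {z} hz => by
    simp only [CycleWithin, sub_zero] at hz
    exact ⟨hz.1.trans_le hε, hz.2.trans_le hε⟩
  have hiff : ∀ {α : Type} {Q : α → Prop} {p q : Prop}, (p ↔ q) → UniqueExactlyWhen Q p →
      UniqueExactlyWhen Q q := fun hpq hu => by rwa [propext hpq] at hu
  constructor
  · constructor
    · intro hμ
      have hx0 := (h.fixed_neg_iff hκlt hx₀r).2 (hμneg.2 hμ)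
      refine ⟨x₀, ⟨⟨(abs_lt.1 hx₀).1, hx0⟩, by rw [pw_of_nonpos hx0.le, h.fixed]⟩, ?_⟩
      rintro x ⟨⟨hx1, hx2⟩, hx3⟩
      rw [pw_of_nonpos hx2.le] at hx3
      exact h.eq_fixed hκlt hx₀r (abs_lt.2 ⟨by linarith, by linarith⟩) hx3
    · rintro ⟨x, ⟨hx1, hx2⟩, hx3⟩
      rw [pw_of_nonpos hx2.le] at hx3
      have := h.eq_fixed hκlt hx₀r (abs_lt.2 ⟨by linarith, by linarith⟩) hx3
      exact hμneg.1 ((h.fixed_neg_iff hκlt hx₀r).1 (this ▸ hx2))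
  · rw [pw_of_nonpos le_rfl]
    constructor
    · intro h0
      rw [h0] at hμneg hμpos
      exact le_antisymm (not_lt.1 fun hcon => (hμpos.2 hcon).false)
        (not_lt.1 fun hcon => (hμneg.2 hcon).false)
    · intro h0
      rw [h0] at hμneg hμpos
      exact le_antisymm (not_lt.1 fun hcon => (hμpos.1 hcon).false)
        (not_lt.1 fun hcon => (hμneg.1 hcon).false)
  · refine hiff ?_ (h.fixed_right hε hκ0 ha hκ4 hc2)
    rw [mul_pos_iff, hμpos, hμneg, sub_pos, sub_neg]
  · rcases lt_or_gt_of_ne hc with hcn | hcp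
    · refine hiff ?_ (h.cycle_left hκlt hε hx₀ hcε (hP' hcn))
      rw [hμneg, hlt]
      refine and_congr_right fun hμ => ?_
      rw [hη₂' hμ]
      simp only [hcn, hcn.not_gt, true_and, false_and, false_or]
      rw [neg_one_mul, neg_neg_iff_pos]
    · refine hiff ?_ (h.cycle_left hκlt hε hx₀ hcε (hP hcp))
      rw [hμneg, hgt]
      refine and_congr_right fun hμ => ?_
      rw [hη₂ hμ]
      simp only [hcp, hcp.not_gt, true_and, false_and, or_false]
      rw [one_mul, and_comm]
  · refine hiff ?_ (h.cycle_right hκ0 hκlt.le hε hc1 ha' hκ2 hκ3)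
    rw [hμneg]
    refine and_congr_right fun hμ => ?_
    rw [mul_pos_iff, hη₂ hμ, hη₂' hμ]
    constructor
    · rintro (⟨h1, h2⟩ | ⟨h1, h2⟩)
      · exact Or.inr ⟨by linarith, h2⟩
      · exact Or.inl ⟨by linarith, h2⟩
    · rintro (⟨h1, h2⟩ | ⟨h1, h2⟩)
      · exact Or.inr ⟨by linarith, h2⟩
      · exact Or.inl ⟨by linarith, h2⟩
  · refine hiff ?_ (cycle_zero L R hcε)
    rw [hμneg]
    exact and_congr_right fun hμ => (hη₂z hμ).symm
  · intro z hz hw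
    exact h.cycle_none hε (by nlinarith [abs_nonneg a]) hz hw
  · intro x hx hfix
    rw [pw_of_nonpos hx.2.le] at hfix
    have hxr : |x| < r := abs_lt.2 ⟨by linarith [hx.1], by linarith [hx.2]⟩
    have hxx := h.eq_fixed hκlt hx₀r hxr hfix
    have D := h.hasDerivAt_pw_left hxr hx.2
    rw [hxx] at D ⊢
    constructor
    · intro h1
      refine ⟨D.differentiableAt, ?_⟩
      rw [Function.iterate_one, D.deriv, abs_lt]
      exact ⟨hη₁.1 h1, by linarith [hM.2]⟩
    · intro h1
      refine ⟨D.differentiableAt, ?_⟩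
      rw [Function.iterate_one, D.deriv, lt_abs]
      exact Or.inr (by linarith [hη₁'.1 h1])
  · intro x hx hfix
    have hxr : |x| < r := abs_lt.2 ⟨by linarith [hx.1], by linarith [hx.2]⟩
    have D := h.hasDerivAt_pw_right hxr hx.1
    have b2 := h.derivR_le _ hxr
    constructor
    · intro h1
      refine ⟨D.differentiableAt, ?_⟩
      rw [Function.iterate_one, D.deriv]
      have := hs h1
      nlinarith [abs_sub_abs_le_abs_sub (R₁ x) a, abs_nonneg a]
    · intro h1
      refine ⟨D.differentiableAt, ?_⟩
      rw [Function.iterate_one, D.deriv]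
      have h2 := hu h1
      have h3 := abs_sub_abs_le_abs_sub a (R₁ x)
      rw [abs_sub_comm] at h3
      nlinarith
  · intro z hz hw hz2
    obtain ⟨w1, w2⟩ := within hw
    obtain ⟨D1, D2⟩ := h.hasDerivAt_cycle_left hz w1 w2 hz2
    have p1 := abs_le.1 (h.derivLL_le _ w1)
    have p2 := abs_le.1 (h.derivLL_le _ w2)
    have hzL := isTwoCycle_of_pw hz hz2.le
    constructor
    · intro hcp
      obtain ⟨-, s1, s2, -⟩ := h.signs_of_isTwoCycle hκlt hx₀r (hP hcp) hzL w1 w2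
      refine ⟨⟨D1.differentiableAt, ?_⟩, ⟨D2.differentiableAt, ?_⟩⟩
      · rw [D1.deriv, abs_lt]; exact ⟨by linarith [p1.1], by linarith⟩
      · rw [D2.deriv, abs_lt]; exact ⟨by linarith [p2.1], by linarith⟩
    · intro hcn
      obtain ⟨-, s1, s2, -⟩ := h.signs_of_isTwoCycle hκlt hx₀r (hP' hcn) hzL w1 w2
      refine ⟨⟨D1.differentiableAt, ?_⟩, ⟨D2.differentiableAt, ?_⟩⟩
      · rw [D1.deriv, lt_abs]; exact Or.inl (by linarith)
      · rw [D2.deriv, lt_abs]; exact Or.inl (by linarith)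
  · intro z hz hw hz1 hz2
    obtain ⟨w1, w2⟩ := within hw
    exact h.stable_cycle_right hκ0 hκlt hs hu hz w1 w2 hz1 hz2

end FlipMaps

end FlipMaps

/-! ### Parametric calculus: Hadamard's lemma, implicit functions, Taylor estimates. -/

section Calculus

variable {E : Type} [NormedAddCommGroup E] [NormedSpace ℝ E]

/-- A property that holds near the origin holds on all small balls. -/
theorem eventually_ball_of_eventually {G : Type*} [SeminormedAddCommGroup G] {p : G → Prop}
    (h : ∀ᶠ z in 𝓝 (0 : G), p z) : ∀ᶠ ρ in 𝓝[>] (0 : ℝ), ∀ z, ‖z‖ < ρ → p z := by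
  obtain ⟨r, hr, hp⟩ := Metric.eventually_nhds_iff.1 h
  filter_upwards [Ioo_mem_nhdsGT hr] with ρ hρ z hz
  exact hp (by rw [dist_zero_right]; exact hz.trans hρ.2)

/-- The partial derivative with respect to the first variable. -/
noncomputable def pdx (F : ℝ × E → ℝ) (z : ℝ × E) : ℝ := deriv (fun x => F (x, z.2)) z.1

theorem eventually_hasDerivAt_pdx {F : ℝ × E → ℝ} {z₀ : ℝ × E} {n : WithTop ℕ∞}
    (h : ContDiffAt ℝ n F z₀) (hn : 1 ≤ n) :
    ∀ᶠ z in 𝓝 z₀, HasDerivAt (fun x => F (x, z.2)) (pdx F z) z.1 ∧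
      pdx F z = fderiv ℝ F z (1, 0) := by
  filter_upwards [(h.of_le hn).eventually (by simp)] with z hz
  have h1 : HasFDerivAt F (fderiv ℝ F z) (z.1, z.2) := (hz.differentiableAt one_ne_zero).hasFDerivAt
  have h2 : HasDerivAt (fun x : ℝ => (x, z.2)) ((1 : ℝ), (0 : E)) z.1 :=
    (hasDerivAt_id z.1).prodMk (hasDerivAt_const z.1 z.2)
  have h3 := h1.comp_hasDerivAt z.1 h2
  have h4 : pdx F z = fderiv ℝ F z (1, 0) := h3.deriv
  exact ⟨h4 ▸ h3, h4⟩

theorem ContDiffAt.pdx {F : ℝ × E → ℝ} {z₀ : ℝ × E} {m n : WithTop ℕ∞}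
    (h : ContDiffAt ℝ n F z₀) (hmn : m + 1 ≤ n) : ContDiffAt ℝ m (pdx F) z₀ := by
  have h1 : ContDiffAt ℝ m (fun z => fderiv ℝ F z (1, 0)) z₀ :=
    (h.fderiv_right hmn).clm_apply contDiffAt_const
  refine h1.congr_of_eventuallyEq ?_
  filter_upwards [eventually_hasDerivAt_pdx h (le_trans (by simp) hmn)] with z hz using hz.2

/-- Parametric integrals of `C^n` functions over `[0, 1]` are `C^n`. -/
theorem contDiffOn_integral_of_contDiffAt {U : Set E} (hU : IsOpen U) (n : ℕ) :
    ∀ {H : Type} [NormedAddCommGroup H] [NormedSpace ℝ H] [CompleteSpace H] {G : ℝ × E → H},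
      (∀ t ∈ Icc (0 : ℝ) 1, ∀ w ∈ U, ContDiffAt ℝ n G (t, w)) →
      ContDiffOn ℝ n (fun w => ∫ t in (0 : ℝ)..1, G (t, w)) U := by
  have hloc : ∀ {H : Type} [NormedAddCommGroup H] [NormedSpace ℝ H] {G : ℝ × E → H},
      (∀ t ∈ Icc (0 : ℝ) 1, ∀ w ∈ U, ContinuousAt G (t, w)) → ∀ w₀ ∈ U, ∃ C : ℝ,
      ∀ᶠ w in 𝓝 w₀, ∀ t ∈ Icc (0 : ℝ) 1, ‖G (t, w)‖ ≤ C := by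
    intro H _ _ G hG w₀ hw₀
    have hcont : ContinuousOn (fun t : ℝ => G (t, w₀)) (Icc 0 1) := fun t ht =>
      ((hG t ht w₀ hw₀).comp (f := fun t : ℝ => (t, w₀))
        (by fun_prop)).continuousWithinAt
    obtain ⟨C, hC⟩ := isCompact_Icc.exists_bound_of_continuousOn hcont
    refine ⟨C + 1, isCompact_Icc.eventually_forall_of_forall_eventually fun t ht => ?_⟩
    have h1 : ContinuousAt (fun z : E × ℝ => ‖G (z.2, z.1)‖) (w₀, t) :=
      ((hG t ht w₀ hw₀).comp (f := fun z : E × ℝ => (z.2, z.1)) (by fun_prop)).norm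
    filter_upwards [h1.eventually (gt_mem_nhds ((hC t ht).trans_lt (lt_add_one C)))] with z hz
    exact hz.le
  have hmeas : ∀ {H : Type} [NormedAddCommGroup H] [NormedSpace ℝ H] {G : ℝ × E → H},
      (∀ t ∈ Icc (0 : ℝ) 1, ∀ w ∈ U, ContinuousAt G (t, w)) → ∀ w ∈ U,
      ContinuousOn (fun t => G (t, w)) (uIcc (0 : ℝ) 1) := by
    intro H _ _ G hG w hw t ht
    rw [uIcc_of_le zero_le_one] at ht
    exact ((hG t ht w hw).comp (f := fun t : ℝ => (t, w)) (by fun_prop)).continuousWithinAt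
  have hsub : uIoc (0 : ℝ) 1 ⊆ Icc 0 1 := by
    rw [uIoc_of_le zero_le_one]; exact Ioc_subset_Icc_self
  have hsub' : uIoc (0 : ℝ) 1 ⊆ uIcc 0 1 := by
    rw [uIcc_of_le zero_le_one]; exact hsub
  induction n with
  | zero =>
    intro H _ _ _ G hG
    have hG' : ∀ t ∈ Icc (0 : ℝ) 1, ∀ w ∈ U, ContinuousAt G (t, w) := fun t ht w hw =>
      (hG t ht w hw).continuousAt
    rw [Nat.cast_zero, contDiffOn_zero]
    intro w₀ hw₀
    obtain ⟨C, hC⟩ := hloc hG' w₀ hw₀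
    refine (intervalIntegral.continuousAt_of_dominated_interval (bound := fun _ => C)
      ?_ ?_ (by simp) ?_).continuousWithinAt
    · filter_upwards [hU.mem_nhds hw₀] with w hw
      exact ((hmeas hG' w hw).mono hsub').aestronglyMeasurable measurableSet_uIoc
    · filter_upwards [hC] with w hw
      exact Eventually.of_forall fun t ht => hw t (hsub ht)
    · refine Eventually.of_forall fun t ht => ?_
      exact (hG' t (hsub ht) w₀ hw₀).comp (f := fun w : E => (t, w)) (by fun_prop)
  | succ n ih =>
    -- The target space H is quantified inside the induction because the derivative takes values in
    -- another space, E →L[ℝ] H.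
    intro H _ _ _ G hG
    have hn1 : ((n + 1 : ℕ) : WithTop ℕ∞) ≠ 0 := by exact_mod_cast Nat.succ_ne_zero n
    have hG0 : ∀ t ∈ Icc (0 : ℝ) 1, ∀ w ∈ U, ContinuousAt G (t, w) := fun t ht w hw =>
      (hG t ht w hw).continuousAt
    set G' : ℝ × E → E →L[ℝ] H := fun p => (fderiv ℝ G p).comp (ContinuousLinearMap.inr ℝ ℝ E)
      with hG'def
    have hG' : ∀ t ∈ Icc (0 : ℝ) 1, ∀ w ∈ U, ContDiffAt ℝ n G' (t, w) := fun t ht w hw =>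
      ((hG t ht w hw).fderiv_right (m := n) (by exact_mod_cast le_rfl)).clm_comp contDiffAt_const
    have hG'0 : ∀ t ∈ Icc (0 : ℝ) 1, ∀ w ∈ U, ContinuousAt G' (t, w) := fun t ht w hw =>
      (hG' t ht w hw).continuousAt
    have hderiv : ∀ w₀ ∈ U, HasFDerivAt (fun w => ∫ t in (0 : ℝ)..1, G (t, w))
        (∫ t in (0 : ℝ)..1, G' (t, w₀)) w₀ := by
      intro w₀ hw₀
      obtain ⟨C, hC⟩ := hloc hG'0 w₀ hw₀
      refine intervalIntegral.hasFDerivAt_integral_of_dominated_of_fderiv_le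
        (F := fun w t => G (t, w)) (F' := fun w t => G' (t, w)) (bound := fun _ => C)
        (inter_mem hC (hU.mem_nhds hw₀)) ?_ ?_ ?_ ?_ (by simp) ?_
      · filter_upwards [hU.mem_nhds hw₀] with w hw
        exact ((hmeas hG0 w hw).mono hsub').aestronglyMeasurable measurableSet_uIoc
      · exact (hmeas hG0 w₀ hw₀).intervalIntegrable
      · exact ((hmeas hG'0 w₀ hw₀).mono hsub').aestronglyMeasurable measurableSet_uIoc
      · exact Eventually.of_forall fun t ht w hw => hw.1 t (hsub ht)
      · refine Eventually.of_forall fun t ht w hw => ?_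
        have h1 := ((hG t (hsub ht) w hw.2).differentiableAt hn1).hasFDerivAt
        have h2 : HasFDerivAt (fun w : E => (t, w)) (ContinuousLinearMap.inr ℝ ℝ E) w :=
          hasFDerivAt_prodMk_right t w
        exact h1.comp w h2
    rw [Nat.cast_succ, contDiffOn_succ_iff_fderiv_of_isOpen hU]
    refine ⟨fun w hw => (hderiv w hw).differentiableAt.differentiableWithinAt, by simp, ?_⟩
    exact (ih hG').congr fun w hw => (hderiv w hw).fderiv

/-- Hadamard's lemma with a parameter. -/
theorem exists_contDiffAt_mul_fst {W : ℝ × E → ℝ} {n : ℕ}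
    (hW : ContDiffAt ℝ ((n + 1 : ℕ) : WithTop ℕ∞) W 0) (h0 : ∀ᶠ η in 𝓝 (0 : E), W (0, η) = 0) :
    ∃ V : ℝ × E → ℝ, ContDiffAt ℝ n V 0 ∧ (∀ᶠ w in 𝓝 (0 : ℝ × E), W w = w.1 * V w) ∧
      ∀ η, V (0, η) = pdx W (0, η) := by
  have h1 : ContDiffAt ℝ n (pdx W) 0 := hW.pdx (by exact_mod_cast le_rfl)
  have h2 := h1.eventually (by simp)
  have h3 := eventually_hasDerivAt_pdx hW (by exact_mod_cast Nat.le_add_left 1 n)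
  obtain ⟨r, hr, hp⟩ := Metric.eventually_nhds_iff_ball.1 (h2.and h3)
  have hmem : ∀ t ∈ Icc (0 : ℝ) 1, ∀ w ∈ Metric.ball (0 : ℝ × E) r,
      (t * w.1, w.2) ∈ Metric.ball (0 : ℝ × E) r := by
    intro t ht w hw
    rw [mem_ball_zero_iff, Prod.norm_def, max_lt_iff] at hw ⊢
    refine ⟨?_, hw.2⟩
    rw [norm_mul, Real.norm_of_nonneg ht.1]
    exact (mul_le_of_le_one_left (norm_nonneg _) ht.2).trans_lt hw.1
  -- The quotient of W by its first variable, written as an average of the partial derivative. This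
  -- costs one order of smoothness.
  refine ⟨fun w => ∫ t in (0 : ℝ)..1, pdx W (t * w.1, w.2), ?_, ?_, fun η => by simp⟩
  · have := contDiffOn_integral_of_contDiffAt (U := Metric.ball (0 : ℝ × E) r)
      Metric.isOpen_ball n (G := fun p : ℝ × (ℝ × E) => pdx W (p.1 * p.2.1, p.2.2))
      fun t ht w hw => by
        have h4 := (hp _ (hmem t ht w hw)).1
        exact ContDiffAt.comp (t, w) (f := fun p : ℝ × (ℝ × E) => (p.1 * p.2.1, p.2.2)) h4
          (by fun_prop)
    exact this.contDiffAt (Metric.ball_mem_nhds _ hr)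
  · have h0' : ∀ᶠ w in 𝓝 (0 : ℝ × E), W (0, w.2) = 0 :=
      (continuous_snd.tendsto (0 : ℝ × E)).eventually h0
    filter_upwards [Metric.ball_mem_nhds (0 : ℝ × E) hr, h0'] with w hw hw0
    have hd : ∀ t ∈ uIcc (0 : ℝ) 1,
        HasDerivAt (fun t => W (t * w.1, w.2)) (pdx W (t * w.1, w.2) * w.1) t := by
      intro t ht
      rw [uIcc_of_le zero_le_one] at ht
      exact HasDerivAt.comp t (hp _ (hmem t ht w hw)).2.1 (hasDerivAt_mul_const w.1)
    have hc : ContinuousOn (fun t => pdx W (t * w.1, w.2) * w.1) (uIcc (0 : ℝ) 1) := by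
      intro t ht
      rw [uIcc_of_le zero_le_one] at ht
      refine ContinuousAt.continuousWithinAt (ContinuousAt.mul ?_ continuousAt_const)
      exact ContinuousAt.comp (f := fun t : ℝ => (t * w.1, w.2))
        (hp _ (hmem t ht w hw)).1.continuousAt (by fun_prop)
    have := intervalIntegral.integral_eq_sub_of_hasDerivAt hd hc.intervalIntegrable
    rw [intervalIntegral.integral_mul_const, zero_mul, one_mul, hw0, sub_zero] at this
    rw [← this, mul_comm]

/-- The implicit function theorem for a scalar unknown, at the origin. -/
theorem exists_implicit_of_hasDerivAt [CompleteSpace E] {G : E × ℝ → ℝ} {n : WithTop ℕ∞}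
    (hG : ContDiffAt ℝ n G 0) (hn : n ≠ 0) (h0 : G 0 = 0) {d : ℝ} (hd0 : d ≠ 0)
    (hd : HasDerivAt (fun y => G (0, y)) d 0) :
    ∃ φ : E → ℝ, φ 0 = 0 ∧ ContDiffAt ℝ n φ 0 ∧ ∀ᶠ p in 𝓝 (0 : E × ℝ), G p = 0 ↔ p.2 = φ p.1 := by
  have h1 : HasFDerivAt G (fderiv ℝ G 0) ((0 : E), (0 : ℝ)) :=
    (hG.differentiableAt hn).hasFDerivAt
  have h2 : fderiv ℝ G 0 (0, 1) = d :=
    (h1.comp_hasDerivAt (0 : ℝ) ((hasDerivAt_const (0 : ℝ) (0 : E)).prodMk (hasDerivAt_id _))).unique hd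
  have hinv : (fderiv ℝ G 0 ∘L .inr ℝ E ℝ).IsInvertible := by
    refine ⟨ContinuousLinearEquiv.smulLeft (Units.mk0 d hd0), ?_⟩
    ext
    simp [h2]
  refine ⟨hG.implicitFunction hn hinv, hG.implicitFunction_apply_self hn hinv,
    hG.contDiffAt_implicitFunction hn hinv, ?_⟩
  filter_upwards [hG.eventually_apply_eq_iff_implicitFunction hn hinv] with p hp
  rw [h0] at hp
  rw [hp, eq_comm]

theorem isBigO_taylor_two {f : E → ℝ} (hf : ContDiffAt ℝ 2 f 0) :
    (fun w => f w - f 0 - fderiv ℝ f 0 w) =O[𝓝 0] fun w => ‖w‖ ^ 2 := by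
  have h1 : ContDiffAt ℝ 1 (fderiv ℝ f) 0 := hf.fderiv_right (by norm_num)
  have h2 := (h1.differentiableAt one_ne_zero).isBigO_sub
  obtain ⟨C, hC⟩ := h2.bound
  have h3 := (hf.of_le (by norm_num : (1 : WithTop ℕ∞) ≤ 2)).eventually (by simp)
  obtain ⟨r, hr, hp⟩ := Metric.eventually_nhds_iff_ball.1 (hC.and h3)
  refine IsBigO.of_bound |C| ?_
  filter_upwards [Metric.ball_mem_nhds (0 : E) hr] with w hw
  have hmem : ∀ z ∈ Metric.closedBall (0 : E) ‖w‖, z ∈ Metric.ball (0 : E) r := fun z hz =>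
    mem_ball_zero_iff.2 ((mem_closedBall_zero_iff.1 hz).trans_lt (mem_ball_zero_iff.1 hw))
  have := (convex_closedBall (0 : E) ‖w‖).norm_image_sub_le_of_norm_hasFDerivWithin_le'
    (f := f) (f' := fderiv ℝ f) (φ := fderiv ℝ f 0) (C := |C| * ‖w‖)
    (fun z hz => ((hp z (hmem z hz)).2.differentiableAt one_ne_zero).hasFDerivAt.hasFDerivWithinAt)
    (fun z hz => by
      refine (hp z (hmem z hz)).1.trans ?_
      rw [sub_zero]
      exact mul_le_mul (le_abs_self C) (mem_closedBall_zero_iff.1 hz) (norm_nonneg _) (abs_nonneg _))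
    (Metric.mem_closedBall_self (norm_nonneg w)) (mem_closedBall_zero_iff.2 le_rfl)
  rw [sub_zero] at this
  rw [norm_pow, norm_norm]
  calc _ ≤ _ := this
    _ = _ := by ring

/-- Strict differentiability on all small balls. Along a coordinate line it compares increments with
a single partial derivative at the origin, uniformly in the other variables. -/
theorem eventually_strict_bound {f : E → ℝ} {n : WithTop ℕ∞} (hf : ContDiffAt ℝ n f 0)
    (hn : n ≠ 0) {κ : ℝ} (hκ : 0 < κ) :
    ∀ᶠ ρ in 𝓝[>] (0 : ℝ), ∀ p q : E, ‖p‖ < ρ → ‖q‖ < ρ →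
      |f p - f q - fderiv ℝ f 0 (p - q)| ≤ κ * ‖p - q‖ := by
  have h := (hf.hasStrictFDerivAt hn).isLittleO.bound hκ
  have h' : ∀ᶠ z in 𝓝 (0 : E × E), ‖f z.1 - f z.2 - fderiv ℝ f 0 (z.1 - z.2)‖ ≤ κ * ‖z.1 - z.2‖ := h
  filter_upwards [eventually_ball_of_eventually h'] with ρ hρ p q hp hq
  exact hρ (p, q) (by rw [Prod.norm_def]; exact max_lt hp hq)

theorem abs_sub_le_of_abs_deriv_le {g g' : ℝ → ℝ} {a b C : ℝ}
    (hg : ∀ x ∈ uIcc a b, HasDerivAt g (g' x) x) (hC : ∀ x ∈ uIcc a b, |g' x| ≤ C)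
    (ha : g a = 0) : ∀ x ∈ uIcc a b, |g x| ≤ C * |b - a| := by
  intro x hx
  have h1 := (convex_uIcc a b).norm_image_sub_le_of_norm_hasDerivWithin_le
    (fun y hy => (hg y hy).hasDerivWithinAt) hC left_mem_uIcc hx
  rw [ha, sub_zero, Real.norm_eq_abs, Real.norm_eq_abs] at h1
  have hC0 : 0 ≤ C := (abs_nonneg _).trans (hC a left_mem_uIcc)
  exact h1.trans (mul_le_mul_of_nonneg_left (abs_sub_left_of_mem_uIcc hx) hC0)

/-- Third-order Taylor estimate at a point where a function vanishes to second order. -/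
theorem abs_sub_cubic_le {g g₁ g₂ g₃ : ℝ → ℝ} {a b c C : ℝ}
    (h1 : ∀ x ∈ uIcc a b, HasDerivAt g (g₁ x) x) (h2 : ∀ x ∈ uIcc a b, HasDerivAt g₁ (g₂ x) x)
    (h3 : ∀ x ∈ uIcc a b, HasDerivAt g₂ (g₃ x) x) (hC : ∀ x ∈ uIcc a b, |g₃ x - c| ≤ C)
    (e0 : g a = 0) (e1 : g₁ a = 0) (e2 : g₂ a = 0) :
    |g b - c * (b - a) ^ 3 / 6| ≤ C * |b - a| ^ 3 := by
  have k2 := abs_sub_le_of_abs_deriv_le (g := fun x => g₂ x - c * (x - a))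
    (fun x hx => ((h3 x hx).sub (((hasDerivAt_id x).sub_const a).const_mul c)).congr_deriv
      (by simp)) hC (by simp [e2])
  have k1 := abs_sub_le_of_abs_deriv_le (g := fun x => g₁ x - c * (x - a) ^ 2 / 2)
    (fun x hx => ((h2 x hx).sub (((((hasDerivAt_id x).sub_const a).pow 2).const_mul c).div_const
      2)).congr_deriv (show _ = g₂ x - c * (x - a) by simp; ring)) k2 (by simp [e1])
  have k0 := abs_sub_le_of_abs_deriv_le (g := fun x => g x - c * (x - a) ^ 3 / 6)
    (fun x hx => ((h1 x hx).sub (((((hasDerivAt_id x).sub_const a).pow 3).const_mul c).div_const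
      6)).congr_deriv (show _ = g₁ x - c * (x - a) ^ 2 / 2 by simp; ring)) k1 (by simp [e0])
  calc _ ≤ _ := k0 b right_mem_uIcc
    _ = _ := by ring

end Calculus

/-! ### The branch of fixed points and the two bifurcation curves. -/

/-- A germ of a two-parameter family of maps at a fixed point with multiplier `-1`. The arguments
are ordered `x, μ, η`. -/
structure FlipGerm (k : ℕ) (F : ℝ × ℝ × ℝ → ℝ) : Prop where
  smooth : ContDiffAt ℝ k F 0
  order : 3 ≤ k
  zero : ∀ᶠ η in 𝓝 (0 : ℝ), F (0, 0, η) = 0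
  dx : pdx F 0 = -1
  dμ : HasDerivAt (fun m => F (0, m, 0)) 1 0
  dη : HasDerivAt (fun η => pdx F (0, 0, η)) 1 0

namespace FlipGerm

variable {k : ℕ} {F : ℝ × ℝ × ℝ → ℝ}

theorem natCast_le {k m : ℕ} (h : m ≤ k) : (m : WithTop ℕ∞) ≤ k := by exact_mod_cast h

theorem order_ne (h : FlipGerm k F) : (k : WithTop ℕ∞) ≠ 0 := by
  have := h.order
  exact_mod_cast (by omega : k ≠ 0)

theorem order_pred_ne (h : FlipGerm k F) : ((k - 1 : ℕ) : WithTop ℕ∞) ≠ 0 := by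
  have := h.order
  exact_mod_cast (by omega : k - 1 ≠ 0)

theorem apply_zero (h : FlipGerm k F) : F 0 = 0 := h.zero.self_of_nhds

theorem differentiableAt (h : FlipGerm k F) : DifferentiableAt ℝ F 0 :=
  h.smooth.differentiableAt h.order_ne

theorem smooth_pdx (h : FlipGerm k F) : ContDiffAt ℝ ((k - 1 : ℕ) : WithTop ℕ∞) (pdx F) 0 :=
  h.smooth.pdx (by have := h.order; exact_mod_cast (by omega : k - 1 + 1 ≤ k))

theorem tendsto_pdx (h : FlipGerm k F) : Tendsto (pdx F) (𝓝 0) (𝓝 (-1)) := by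
  have := h.smooth_pdx.continuousAt.tendsto
  rwa [h.dx] at this

theorem fderiv_apply (h : FlipGerm k F) (v : ℝ × ℝ × ℝ) : fderiv ℝ F 0 v = -v.1 + v.2.1 := by
  have h0 := h.differentiableAt.hasFDerivAt
  have e1 : fderiv ℝ F 0 (1, 0, 0) = -1 := by
    have := (eventually_hasDerivAt_pdx h.smooth
      (by exact_mod_cast natCast_le (by have := h.order; omega : 1 ≤ k))).self_of_nhds.2
    rw [h.dx] at this
    exact this.symm
  have e2 : fderiv ℝ F 0 (0, 1, 0) = 1 :=
    (HasFDerivAt.comp_hasDerivAt (f := fun m : ℝ => ((0 : ℝ), m, (0 : ℝ))) (0 : ℝ) h0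
      ((hasDerivAt_const _ _).prodMk ((hasDerivAt_id _).prodMk (hasDerivAt_const _ _)))).unique h.dμ
  have e3 : fderiv ℝ F 0 (0, 0, 1) = 0 := by
    have h1 : HasDerivAt (fun η => F (0, 0, η)) (fderiv ℝ F 0 (0, 0, 1)) 0 :=
      HasFDerivAt.comp_hasDerivAt (f := fun m : ℝ => ((0 : ℝ), (0 : ℝ), m)) (0 : ℝ) h0
      ((hasDerivAt_const _ _).prodMk ((hasDerivAt_const _ _).prodMk (hasDerivAt_id _)))
    exact h1.unique ((hasDerivAt_const (0 : ℝ) (0 : ℝ)).congr_of_eventuallyEq h.zero)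
  have : v = v.1 • (1, 0, 0) + v.2.1 • (0, 1, 0) + v.2.2 • ((0, 0, 1) : ℝ × ℝ × ℝ) := by
    ext <;> simp
  rw [this, map_add, map_add, map_smul, map_smul, map_smul, e1, e2, e3]
  simp

/-- The branch of fixed points. -/
theorem exists_fixed (h : FlipGerm k F) : ∃ X : ℝ × ℝ → ℝ, X 0 = 0 ∧ ContDiffAt ℝ k X 0 ∧
    (∀ᶠ z in 𝓝 (0 : ℝ × ℝ × ℝ), F z = z.1 ↔ z.1 = X z.2) ∧
    (∀ᶠ w in 𝓝 (0 : ℝ × ℝ), F (X w, w) = X w) ∧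
    (∀ᶠ η in 𝓝 (0 : ℝ), X (0, η) = 0) ∧ ∀ w, fderiv ℝ X 0 w = w.1 / 2 := by
  have hG : ContDiffAt ℝ k (fun p : (ℝ × ℝ) × ℝ => F (p.2, p.1) - p.2) 0 := by
    refine ContDiffAt.sub ?_ contDiffAt_snd
    exact ContDiffAt.comp (0 : (ℝ × ℝ) × ℝ) (f := fun p : (ℝ × ℝ) × ℝ => (p.2, p.1)) h.smooth
      (contDiffAt_snd.prodMk contDiffAt_fst)
  have hd : HasDerivAt (fun y : ℝ => F (y, (0 : ℝ × ℝ)) - y) (-2) 0 := by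
    have h1 : HasDerivAt (fun y : ℝ => F (y, (0 : ℝ × ℝ))) (fderiv ℝ F 0 (1, 0)) 0 :=
      HasFDerivAt.comp_hasDerivAt (f := fun m : ℝ => (m, (0 : ℝ × ℝ))) (0 : ℝ)
        h.differentiableAt.hasFDerivAt ((hasDerivAt_id _).prodMk (hasDerivAt_const _ _))
    refine (h1.sub (hasDerivAt_id _)).congr_deriv ?_
    rw [h.fderiv_apply]
    norm_num
  obtain ⟨X, hX0, hX, hiff⟩ := exists_implicit_of_hasDerivAt hG h.order_ne
    (show F ((0 : ℝ), (0 : ℝ × ℝ)) - 0 = 0 by rw [sub_zero]; exact h.apply_zero) (by norm_num : (-2 : ℝ) ≠ 0) hd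
  have hXc : Tendsto X (𝓝 0) (𝓝 0) := by
    have := hX.continuousAt.tendsto
    rwa [hX0] at this
  have hiff' : ∀ᶠ z in 𝓝 (0 : ℝ × ℝ × ℝ), F z = z.1 ↔ z.1 = X z.2 := by
    have hc : Tendsto (fun z : ℝ × ℝ × ℝ => (z.2, z.1)) (𝓝 0) (𝓝 0) :=
      (continuous_snd.prodMk continuous_fst).tendsto _
    filter_upwards [hc.eventually hiff] with z hz
    rw [← hz, sub_eq_zero]
  have hXw : Tendsto (fun w : ℝ × ℝ => (X w, w)) (𝓝 0) (𝓝 0) := hXc.prodMk_nhds tendsto_id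
  have hfix : ∀ᶠ w in 𝓝 (0 : ℝ × ℝ), F (X w, w) = X w := by
    filter_upwards [hXw.eventually hiff'] with w hw using hw.2 rfl
  refine ⟨X, hX0, hX, hiff', hfix, ?_, fun w => ?_⟩
  · have hc : Tendsto (fun η : ℝ => ((0 : ℝ), (0 : ℝ), η)) (𝓝 0) (𝓝 0) :=
      Continuous.tendsto (by fun_prop) _
    filter_upwards [hc.eventually hiff', h.zero] with η h1 h2
    exact (h1.1 h2).symm
  -- Since dF = -dx + dμ at the origin, differentiating F(X w, w) = X w gives -dX + dμ = dX.
  · have hXd := (hX.differentiableAt h.order_ne).hasFDerivAt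
    have hF0 : HasFDerivAt F (fderiv ℝ F 0) (X 0, (0 : ℝ × ℝ)) := by
      rw [hX0]; exact h.differentiableAt.hasFDerivAt
    have h1 := HasFDerivAt.comp (f := fun w : ℝ × ℝ => (X w, w)) (0 : ℝ × ℝ) hF0
      (hXd.prodMk (hasFDerivAt_id 0))
    have h2 := h1.unique (hXd.congr_of_eventuallyEq hfix)
    have h3 := congrArg (fun L => L w) h2
    simp only [ContinuousLinearMap.comp_apply, ContinuousLinearMap.prod_apply,
      ContinuousLinearMap.id_apply] at h3
    rw [h.fderiv_apply] at h3
    simp only at h3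
    linarith

/-- The curve on which the fixed point has multiplier `-1`. -/
theorem exists_multiplier_curve (h : FlipGerm k F) {X : ℝ × ℝ → ℝ} (hX0 : X 0 = 0)
    (hX : ContDiffAt ℝ k X 0) (hX1 : ∀ᶠ η in 𝓝 (0 : ℝ), X (0, η) = 0)
    (hX' : ∀ w, fderiv ℝ X 0 w = w.1 / 2) :
    ContDiffAt ℝ ((k - 1 : ℕ) : WithTop ℕ∞) (fun w => pdx F (X w, w)) 0 ∧
    fderiv ℝ (fun w => pdx F (X w, w)) 0 (0, 1) = 1 ∧
    ∃ h₁ : ℝ → ℝ, h₁ 0 = 0 ∧ ContDiffAt ℝ ((k - 1 : ℕ) : WithTop ℕ∞) h₁ 0 ∧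
      (∀ᶠ w in 𝓝 (0 : ℝ × ℝ), pdx F (X w, w) = -1 ↔ w.2 = h₁ w.1) ∧
      (fun μ => h₁ μ - -(deriv (fun m => pdx F (0, m, 0)) 0 + pdx (pdx F) 0 / 2) * μ)
        =O[𝓝 0] (fun μ : ℝ => μ ^ 2) := by
  set M : ℝ × ℝ → ℝ := fun w => pdx F (X w, w) with hM
  have hXw : ContDiffAt ℝ ((k - 1 : ℕ) : WithTop ℕ∞) (fun w : ℝ × ℝ => (X w, w)) 0 :=
    (hX.of_le (natCast_le (Nat.sub_le k 1))).prodMk contDiffAt_id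
  have hp0 : ContDiffAt ℝ ((k - 1 : ℕ) : WithTop ℕ∞) (pdx F) (X 0, (0 : ℝ × ℝ)) := by
    rw [hX0]; exact h.smooth_pdx
  have hMs : ContDiffAt ℝ ((k - 1 : ℕ) : WithTop ℕ∞) M 0 :=
    ContDiffAt.comp (f := fun w : ℝ × ℝ => (X w, w)) (0 : ℝ × ℝ) hp0 hXw
  have hM0 : M 0 = -1 := by
    simp only [hM, hX0]; exact h.dx
  -- For μ = 0 the fixed point stays at 0, so M(0, η) is the linear coefficient at the origin.
  have hMη : HasDerivAt (fun η => M (0, η)) 1 0 := by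
    refine h.dη.congr_of_eventuallyEq ?_
    filter_upwards [hX1] with η hη
    simp only [hM, hη]
  have hMd := (hMs.differentiableAt h.order_pred_ne).hasFDerivAt
  have hM01 : fderiv ℝ M 0 (0, 1) = 1 :=
    (HasFDerivAt.comp_hasDerivAt (f := fun m : ℝ => ((0 : ℝ), m)) (0 : ℝ) hMd
      ((hasDerivAt_const _ _).prodMk (hasDerivAt_id _))).unique hMη
  have hG : ContDiffAt ℝ ((k - 1 : ℕ) : WithTop ℕ∞) (fun w => M w + 1) 0 := hMs.add contDiffAt_const
  obtain ⟨h₁, h₁0, h₁s, hiff⟩ := exists_implicit_of_hasDerivAt hG h.order_pred_ne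
    (by rw [hM0]; norm_num) one_ne_zero (hMη.add_const 1)
  refine ⟨hMs, hM01, h₁, h₁0, h₁s, ?_, ?_⟩
  · filter_upwards [hiff] with w hw
    rw [← hw, eq_neg_iff_add_eq_zero]
  · have h₁d := (h₁s.differentiableAt h.order_pred_ne).hasFDerivAt
    have h₁c : Tendsto (fun μ => (μ, h₁ μ)) (𝓝 0) (𝓝 (0 : ℝ × ℝ)) := by
      have := h₁s.continuousAt.tendsto
      rw [h₁0] at this
      exact tendsto_id.prodMk_nhds this
    have hMh : (fun μ => M (μ, h₁ μ)) =ᶠ[𝓝 0] fun _ => -1 := by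
      filter_upwards [h₁c.eventually hiff] with μ hμ
      exact eq_neg_iff_add_eq_zero.2 (hμ.2 rfl)
    have hMd' : HasFDerivAt M (fderiv ℝ M 0) ((0 : ℝ), h₁ 0) := by rw [h₁0]; exact hMd
    have c1 : fderiv ℝ M 0 (1, fderiv ℝ h₁ 0 1) = 0 :=
      (HasFDerivAt.comp_hasDerivAt (f := fun m : ℝ => (m, h₁ m)) (0 : ℝ) hMd'
        ((hasDerivAt_id _).prodMk h₁d.hasDerivAt)).unique
        ((hasDerivAt_const _ _).congr_of_eventuallyEq hMh)
    have hXd := (hX.differentiableAt h.order_ne).hasFDerivAt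
    have hpd := (h.smooth_pdx.differentiableAt h.order_pred_ne).hasFDerivAt
    have hpd' : HasFDerivAt (pdx F) (fderiv ℝ (pdx F) 0) (X 0, (0 : ℝ × ℝ)) := by
      rw [hX0]; exact hpd
    have c2 : fderiv ℝ M 0 = (fderiv ℝ (pdx F) 0).comp ((fderiv ℝ X 0).prod (.id ℝ (ℝ × ℝ))) :=
      hMd.unique (HasFDerivAt.comp (f := fun w : ℝ × ℝ => (X w, w)) (0 : ℝ × ℝ) hpd'
        (hXd.prodMk (hasFDerivAt_id 0)))
    have c3 : fderiv ℝ (pdx F) 0 (0, 1, 0) = deriv (fun m => pdx F (0, m, 0)) 0 :=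
      (HasFDerivAt.comp_hasDerivAt (f := fun m : ℝ => ((0 : ℝ), m, (0 : ℝ))) (0 : ℝ) hpd
        ((hasDerivAt_const _ _).prodMk ((hasDerivAt_id _).prodMk (hasDerivAt_const _ _)))).deriv.symm
    have c4 : fderiv ℝ (pdx F) 0 (1, 0, 0) = pdx (pdx F) 0 :=
      (eventually_hasDerivAt_pdx h.smooth_pdx (by
        have := h.order
        exact_mod_cast natCast_le (by omega : 1 ≤ k - 1))).self_of_nhds.2.symm
    -- The fixed point moves with μ-velocity 1 / 2, which weights the second x-derivative 2 p by 1 /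
    -- 2.
    have c5 : fderiv ℝ M 0 (1, 0) = deriv (fun m => pdx F (0, m, 0)) 0 + pdx (pdx F) 0 / 2 := by
      rw [c2, ContinuousLinearMap.comp_apply, ContinuousLinearMap.prod_apply, hX',
        ContinuousLinearMap.id_apply, ← c3, ← c4]
      rw [show ((((1 : ℝ), (0 : ℝ)).1 / 2, (1, 0)) : ℝ × ℝ × ℝ)
        = (0, 1, 0) + (1 / 2 : ℝ) • (1, 0, 0) by ext <;> simp]
      rw [map_add, map_smul]
      simp only [smul_eq_mul]
      ring
    have c6 : fderiv ℝ h₁ 0 1 = -(deriv (fun m => pdx F (0, m, 0)) 0 + pdx (pdx F) 0 / 2) := by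
      rw [show ((1 : ℝ), fderiv ℝ h₁ 0 1) = (1, 0) + fderiv ℝ h₁ 0 1 • ((0 : ℝ), (1 : ℝ)) by
        ext <;> simp, map_add, map_smul, hM01, c5] at c1
      simp only [smul_eq_mul] at c1
      linarith
    have ht := isBigO_taylor_two (h₁s.of_le (by
      have := h.order
      exact_mod_cast natCast_le (by omega : 2 ≤ k - 1)))
    refine (ht.congr' ?_ ?_)
    · filter_upwards with μ
      have : fderiv ℝ h₁ 0 μ = μ * fderiv ℝ h₁ 0 1 := by
        rw [← smul_eq_mul, ← map_smul, smul_eq_mul, mul_one]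
      rw [h₁0, this, c6]
      ring
    · filter_upwards with μ
      rw [Real.norm_eq_abs, sq_abs]

/-- The curve on which the origin has period two, and the reduced second return to the origin. -/
theorem exists_return_curve (h : FlipGerm k F) : ∃ V : ℝ × ℝ → ℝ,
    ContDiffAt ℝ ((k - 1 : ℕ) : WithTop ℕ∞) V 0 ∧ V 0 = 0 ∧ fderiv ℝ V 0 (0, 1) = 1 ∧
    (∀ᶠ w in 𝓝 (0 : ℝ × ℝ), F (F (0, w), w) = w.1 * V w) ∧
    ∃ h₂ : ℝ → ℝ, h₂ 0 = 0 ∧ ContDiffAt ℝ ((k - 1 : ℕ) : WithTop ℕ∞) h₂ 0 ∧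
      (∀ᶠ w in 𝓝 (0 : ℝ × ℝ), V w = 0 ↔ w.2 = h₂ w.1) := by
  set W : ℝ × ℝ → ℝ := fun w => F (F (0, w), w) with hW
  have hc : ContDiffAt ℝ k (fun w : ℝ × ℝ => F (0, w)) 0 :=
    ContDiffAt.comp (f := fun w : ℝ × ℝ => ((0 : ℝ), w)) (0 : ℝ × ℝ) h.smooth
      (contDiffAt_const.prodMk contDiffAt_id)
  have hF00 : F ((0 : ℝ), (0 : ℝ × ℝ)) = 0 := h.apply_zero
  have hWs : ContDiffAt ℝ k W 0 := by
    refine ContDiffAt.comp (f := fun w : ℝ × ℝ => (F (0, w), w)) (0 : ℝ × ℝ) ?_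
      (hc.prodMk contDiffAt_id)
    rw [hF00]; exact h.smooth
  have hk1 : k - 1 + 1 = k := by have := h.order; omega
  have hWz : ∀ᶠ η in 𝓝 (0 : ℝ), W (0, η) = 0 := by
    filter_upwards [h.zero] with η hη
    simp only [hW, hη]
  obtain ⟨V, hV, hWV, hV0⟩ := exists_contDiffAt_mul_fst (n := k - 1) (by rw [hk1]; exact hWs) hWz
  -- the derivative of the reduced return in `η`
  have hdiff : ∀ᶠ η in 𝓝 (0 : ℝ), DifferentiableAt ℝ F (0, 0, η) ∧
      pdx F (0, 0, η) = fderiv ℝ F (0, 0, η) (1, 0) := by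
    have hcc : Tendsto (fun η : ℝ => ((0 : ℝ), (0 : ℝ), η)) (𝓝 0) (𝓝 0) :=
      Continuous.tendsto (by fun_prop) _
    have h1k : (1 : WithTop ℕ∞) ≤ k := by
      exact_mod_cast natCast_le (by have := h.order; omega : 1 ≤ k)
    filter_upwards [hcc.eventually ((h.smooth.of_le h1k).eventually (by simp)),
      hcc.eventually (eventually_hasDerivAt_pdx h.smooth h1k)] with η h1 h2
    exact ⟨h1.differentiableAt one_ne_zero, h2.2⟩
  -- On μ = 0, V is the μ-derivative of F(F(0, μ, η), μ, η), computed by the chain rule. Its second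
  -- factor vanishes at η = 0, so only the derivative of that factor contributes below.
  have hVη : ∀ᶠ η in 𝓝 (0 : ℝ), V (0, η) =
      fderiv ℝ F (0, 0, η) (0, 1, 0) * (1 + pdx F (0, 0, η)) := by
    filter_upwards [hdiff, h.zero] with η hη h0
    have hd := hη.1.hasFDerivAt
    have d1 : HasDerivAt (fun m : ℝ => F (0, m, η)) (fderiv ℝ F (0, 0, η) (0, 1, 0)) 0 :=
      HasFDerivAt.comp_hasDerivAt (f := fun m : ℝ => ((0 : ℝ), m, η)) (0 : ℝ) hd
        ((hasDerivAt_const _ _).prodMk ((hasDerivAt_id _).prodMk (hasDerivAt_const _ _)))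
    have hd' : HasFDerivAt F (fderiv ℝ F (0, 0, η)) (F (0, 0, η), (0 : ℝ), η) := by
      rw [h0]; exact hd
    have d2 : HasDerivAt (fun m : ℝ => W (m, η))
        (fderiv ℝ F (0, 0, η) (fderiv ℝ F (0, 0, η) (0, 1, 0), 1, 0)) 0 :=
      HasFDerivAt.comp_hasDerivAt (f := fun m : ℝ => (F (0, m, η), m, η)) (0 : ℝ) hd'
        (d1.prodMk ((hasDerivAt_id _).prodMk (hasDerivAt_const _ _)))
    rw [hV0]
    refine d2.deriv.trans ?_
    rw [hη.2, show ((fderiv ℝ F (0, 0, η) (0, 1, 0), 1, 0) : ℝ × ℝ × ℝ)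
      = (0, 1, 0) + fderiv ℝ F (0, 0, η) (0, 1, 0) • ((1 : ℝ), (0 : ℝ × ℝ)) by ext <;> simp,
      map_add, map_smul, smul_eq_mul]
    ring
  have hVη' : HasDerivAt (fun η => V (0, η)) 1 0 := by
    have s1 : ContDiffAt ℝ ((k - 1 : ℕ) : WithTop ℕ∞)
        (fun z : ℝ × ℝ × ℝ => fderiv ℝ F z (0, 1, 0)) 0 :=
      (h.smooth.fderiv_right (m := ((k - 1 : ℕ) : WithTop ℕ∞))
        (by exact_mod_cast hk1.le)).clm_apply contDiffAt_const
    have s2 : DifferentiableAt ℝ (fun η : ℝ => fderiv ℝ F (0, 0, η) (0, 1, 0)) 0 :=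
      DifferentiableAt.comp (f := fun η : ℝ => ((0 : ℝ), (0 : ℝ), η)) (0 : ℝ)
        (s1.differentiableAt h.order_pred_ne) (by fun_prop)
    have s3 := s2.hasDerivAt.mul (h.dη.const_add 1)
    refine (s3.congr_deriv ?_).congr_of_eventuallyEq hVη
    have e1 : pdx F ((0 : ℝ), (0 : ℝ), (0 : ℝ)) = -1 := h.dx
    have e2 : fderiv ℝ F ((0 : ℝ), (0 : ℝ), (0 : ℝ)) (0, 1, 0) = 1 := by
      exact (h.fderiv_apply (0, 1, 0)).trans (by norm_num)
    rw [e1, e2]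
    norm_num
  have hV00 : V 0 = 0 := by
    have := hVη.self_of_nhds
    have e1 : pdx F ((0 : ℝ), (0 : ℝ), (0 : ℝ)) = -1 := h.dx
    rw [e1] at this
    exact this.trans (by norm_num)
  obtain ⟨h₂, h₂0, h₂s, hiff⟩ := exists_implicit_of_hasDerivAt hV h.order_pred_ne hV00 one_ne_zero hVη'
  refine ⟨V, hV, hV00, ?_, hWV, h₂, h₂0, h₂s, hiff⟩
  exact (HasFDerivAt.comp_hasDerivAt (f := fun m : ℝ => ((0 : ℝ), m)) (0 : ℝ)
    (hV.differentiableAt h.order_pred_ne).hasFDerivAt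
    ((hasDerivAt_const _ _).prodMk (hasDerivAt_id _))).unique hVη'

end FlipGerm

/-! ### The cubic coefficient of the second iterate and the distance between the curves. -/

theorem Filter.EventuallyEq.pdx_eq {E : Type} [NormedAddCommGroup E] [NormedSpace ℝ E]
    {F G : ℝ × E → ℝ} {z : ℝ × E} (h : F =ᶠ[𝓝 z] G) : pdx F z = pdx G z := by
  have hc : Tendsto (fun x : ℝ => (x, z.2)) (𝓝 z.1) (𝓝 z) :=
    Continuous.tendsto' (by fun_prop) _ _ rfl
  exact EventuallyEq.deriv_eq (hc.eventually h)

theorem Filter.EventuallyEq.pdx {E : Type} [NormedAddCommGroup E] [NormedSpace ℝ E]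
    {F G : ℝ × E → ℝ} {z : ℝ × E} (h : F =ᶠ[𝓝 z] G) : pdx F =ᶠ[𝓝 z] pdx G := by
  filter_upwards [eventually_eventually_nhds.2 h] with y hy using Filter.EventuallyEq.pdx_eq hy

theorem isLittleO_nhds_of_nhdsNE {f g : ℝ → ℝ} {a : ℝ} (h : f =o[𝓝[≠] a] g) (ha : f a = 0) :
    f =o[𝓝 a] g := by
  rw [isLittleO_iff] at h ⊢
  intro c hc
  filter_upwards [eventually_nhdsWithin_iff.1 (h hc)] with x hx
  by_cases hxa : x = a
  · rw [hxa, ha, norm_zero]; positivity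
  · exact hx hxa

/-- The second iterate of a family of maps. -/
def iterTwo (F : ℝ × ℝ × ℝ → ℝ) : ℝ × ℝ × ℝ → ℝ := fun z => F (F z, z.2)

/-- The cubic coefficient deciding the criticality of the flip. -/
noncomputable def flipCoef (F : ℝ × ℝ × ℝ → ℝ) : ℝ :=
  (pdx (pdx F) 0 / 2) ^ 2 + pdx (pdx (pdx F)) 0 / 6

namespace FlipGerm

variable {k : ℕ} {F : ℝ × ℝ × ℝ → ℝ}

theorem smooth_pdx_pdx (h : FlipGerm k F) :
    ContDiffAt ℝ ((k - 2 : ℕ) : WithTop ℕ∞) (pdx (pdx F)) 0 :=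
  h.smooth_pdx.pdx (by have := h.order; exact_mod_cast natCast_le (by omega : k - 2 + 1 ≤ k - 1))

theorem smooth_pdx_pdx_pdx (h : FlipGerm k F) :
    ContDiffAt ℝ ((k - 3 : ℕ) : WithTop ℕ∞) (pdx (pdx (pdx F))) 0 :=
  h.smooth_pdx_pdx.pdx (by
    have := h.order; exact_mod_cast natCast_le (by omega : k - 3 + 1 ≤ k - 2))

theorem eventually_hasDerivAt (h : FlipGerm k F) : ∀ᶠ z in 𝓝 (0 : ℝ × ℝ × ℝ),
    HasDerivAt (fun x => F (x, z.2)) (pdx F z) z.1 ∧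
    HasDerivAt (fun x => pdx F (x, z.2)) (pdx (pdx F) z) z.1 ∧
    HasDerivAt (fun x => pdx (pdx F) (x, z.2)) (pdx (pdx (pdx F)) z) z.1 := by
  have := h.order
  filter_upwards [eventually_hasDerivAt_pdx h.smooth
      (by exact_mod_cast natCast_le (by omega : 1 ≤ k)),
    eventually_hasDerivAt_pdx h.smooth_pdx
      (by exact_mod_cast natCast_le (by omega : 1 ≤ k - 1)),
    eventually_hasDerivAt_pdx h.smooth_pdx_pdx
      (by exact_mod_cast natCast_le (by omega : 1 ≤ k - 2))] with z h1 h2 h3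
  exact ⟨h1.1, h2.1, h3.1⟩

theorem tendsto_step (h : FlipGerm k F) :
    Tendsto (fun z : ℝ × ℝ × ℝ => (F z, z.2)) (𝓝 0) (𝓝 0) := by
  have h1 := h.smooth.continuousAt.tendsto
  rw [h.apply_zero] at h1
  exact h1.prodMk_nhds (continuous_snd.tendsto (0 : ℝ × ℝ × ℝ))

theorem smooth_iterTwo (h : FlipGerm k F) : ContDiffAt ℝ k (iterTwo F) 0 := by
  refine ContDiffAt.comp (f := fun z : ℝ × ℝ × ℝ => (F z, z.2)) (0 : ℝ × ℝ × ℝ) ?_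
    (h.smooth.prodMk contDiffAt_snd)
  rw [h.apply_zero]
  exact h.smooth

theorem pdx_iterTwo (h : FlipGerm k F) : pdx (iterTwo F) =ᶠ[𝓝 0] fun z =>
    pdx F (F z, z.2) * pdx F z := by
  filter_upwards [h.eventually_hasDerivAt, h.tendsto_step.eventually h.eventually_hasDerivAt]
    with z h1 h2
  exact (HasDerivAt.comp z.1 (h₂ := fun x => F (x, z.2)) (h := fun x => F (x, z.2)) h2.1 h1.1).deriv

theorem pdx_pdx_iterTwo (h : FlipGerm k F) : pdx (pdx (iterTwo F)) =ᶠ[𝓝 0] fun z =>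
    pdx (pdx F) (F z, z.2) * pdx F z ^ 2 + pdx F (F z, z.2) * pdx (pdx F) z := by
  refine h.pdx_iterTwo.pdx.trans ?_
  filter_upwards [h.eventually_hasDerivAt, h.tendsto_step.eventually h.eventually_hasDerivAt]
    with z h1 h2
  have h3 := HasDerivAt.comp z.1 (h₂ := fun x => pdx F (x, z.2)) (h := fun x => F (x, z.2)) h2.2.1 h1.1
  refine (h3.mul h1.2.1).deriv.trans ?_
  simp only [Function.comp]
  ring

/-- With x-derivatives -1, 2 p and 6 q at the fixed point 0, the chain rule gives -6 q - 12 p² - 6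
q. -/
theorem pdx_pdx_pdx_iterTwo (h : FlipGerm k F) :
    pdx (pdx (pdx (iterTwo F))) 0 = -12 * flipCoef F := by
  rw [Filter.EventuallyEq.pdx_eq h.pdx_pdx_iterTwo]
  have h1 := h.eventually_hasDerivAt.self_of_nhds
  have h2 := (h.tendsto_step.eventually h.eventually_hasDerivAt).self_of_nhds
  have e1 := HasDerivAt.comp (0 : ℝ) (h₂ := fun x => pdx F (x, (0 : ℝ × ℝ)))
    (h := fun x => F (x, (0 : ℝ × ℝ))) h2.2.1 h1.1
  have e2 := HasDerivAt.comp (0 : ℝ) (h₂ := fun x => pdx (pdx F) (x, (0 : ℝ × ℝ)))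
    (h := fun x => F (x, (0 : ℝ × ℝ))) h2.2.2 h1.1
  refine ((e2.mul (h1.2.1.pow 2)).add (e1.mul h1.2.2)).deriv.trans ?_
  simp only [Function.comp, Prod.fst_zero, Prod.snd_zero, h.apply_zero, Prod.mk_zero_zero, h.dx,
    Pi.pow_apply, flipCoef]
  norm_num
  ring

theorem smooth_pdx_iterTwo (h : FlipGerm k F) :
    ContDiffAt ℝ ((k - 1 : ℕ) : WithTop ℕ∞) (pdx (iterTwo F)) 0 :=
  h.smooth_iterTwo.pdx (by have := h.order; exact_mod_cast natCast_le (by omega : k - 1 + 1 ≤ k))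

theorem smooth_pdx_pdx_iterTwo (h : FlipGerm k F) :
    ContDiffAt ℝ ((k - 2 : ℕ) : WithTop ℕ∞) (pdx (pdx (iterTwo F))) 0 :=
  h.smooth_pdx_iterTwo.pdx (by
    have := h.order; exact_mod_cast natCast_le (by omega : k - 2 + 1 ≤ k - 1))

theorem tendsto_pdx_pdx_pdx_iterTwo (h : FlipGerm k F) :
    Tendsto (pdx (pdx (pdx (iterTwo F)))) (𝓝 0) (𝓝 (-12 * flipCoef F)) := by
  have h1 : ContDiffAt ℝ ((k - 3 : ℕ) : WithTop ℕ∞) (pdx (pdx (pdx (iterTwo F)))) 0 :=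
    h.smooth_pdx_pdx_iterTwo.pdx (by
      have := h.order; exact_mod_cast natCast_le (by omega : k - 3 + 1 ≤ k - 2))
  have h2 := h1.continuousAt.tendsto
  rwa [h.pdx_pdx_pdx_iterTwo] at h2

theorem eventually_hasDerivAt_iterTwo (h : FlipGerm k F) : ∀ᶠ z in 𝓝 (0 : ℝ × ℝ × ℝ),
    HasDerivAt (fun x => iterTwo F (x, z.2)) (pdx (iterTwo F) z) z.1 ∧
    HasDerivAt (fun x => pdx (iterTwo F) (x, z.2)) (pdx (pdx (iterTwo F)) z) z.1 ∧
    HasDerivAt (fun x => pdx (pdx (iterTwo F)) (x, z.2)) (pdx (pdx (pdx (iterTwo F))) z) z.1 := by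
  have := h.order
  filter_upwards [eventually_hasDerivAt_pdx h.smooth_iterTwo
      (by exact_mod_cast natCast_le (by omega : 1 ≤ k)),
    eventually_hasDerivAt_pdx h.smooth_pdx_iterTwo
      (by exact_mod_cast natCast_le (by omega : 1 ≤ k - 1)),
    eventually_hasDerivAt_pdx h.smooth_pdx_pdx_iterTwo
      (by exact_mod_cast natCast_le (by omega : 1 ≤ k - 2))] with z h1 h2 h3
  exact ⟨h1.1, h2.1, h3.1⟩

/-- Strict concavity of `σ` times the derivative of the second iterate, when `σ` and the cubic
coefficient have the same sign. -/
theorem eventually_strictConcaveOn (h : FlipGerm k F) {σ : ℝ} (hσ : 0 < σ * flipCoef F) :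
    ∀ᶠ ρ in 𝓝[>] (0 : ℝ), ∀ w : ℝ × ℝ, ‖w‖ < ρ →
      StrictConcaveOn ℝ (Ioo (-ρ) ρ) fun x => σ * pdx (iterTwo F) (x, w) := by
  have h3 : ∀ᶠ z in 𝓝 (0 : ℝ × ℝ × ℝ), σ * pdx (pdx (pdx (iterTwo F))) z < 0 := by
    have := h.tendsto_pdx_pdx_pdx_iterTwo.const_mul σ
    exact this.eventually (gt_mem_nhds (by linarith))
  filter_upwards [eventually_ball_of_eventually (h3.and h.eventually_hasDerivAt_iterTwo)]
    with ρ hρ w hw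
  have hmem : ∀ x ∈ Ioo (-ρ) ρ, ‖(x, w)‖ < ρ := fun x hx => by
    rw [Prod.norm_def]; exact max_lt (abs_lt.2 hx) hw
  have hd1 : ∀ x ∈ Ioo (-ρ) ρ, HasDerivAt (fun x => σ * pdx (iterTwo F) (x, w))
      (σ * pdx (pdx (iterTwo F)) (x, w)) x := fun x hx =>
    ((hρ _ (hmem x hx)).2.2.1).const_mul σ
  have hd2 : ∀ x ∈ Ioo (-ρ) ρ, HasDerivAt (fun x => σ * pdx (pdx (iterTwo F)) (x, w))
      (σ * pdx (pdx (pdx (iterTwo F))) (x, w)) x := fun x hx =>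
    ((hρ _ (hmem x hx)).2.2.2).const_mul σ
  refine StrictAntiOn.strictConcaveOn_of_deriv (convex_Ioo _ _)
    (fun x hx => (hd1 x hx).continuousAt.continuousWithinAt) ?_
  rw [interior_Ioo]
  have hanti : StrictAntiOn (fun x => σ * pdx (pdx (iterTwo F)) (x, w)) (Ioo (-ρ) ρ) := by
    refine strictAntiOn_of_deriv_neg (convex_Ioo _ _)
      (fun x hx => (hd2 x hx).continuousAt.continuousWithinAt) fun x hx => ?_
    rw [interior_Ioo] at hx
    rw [(hd2 x hx).deriv]
    exact (hρ _ (hmem x hx)).1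
  exact hanti.congr fun x hx => (hd1 x hx).deriv.symm

/-- The cubic expansion of the second iterate at a fixed point with multiplier `-1`. -/
theorem isLittleO_iterTwo (h : FlipGerm k F) {x h₁ : ℝ → ℝ} (hx : Tendsto x (𝓝 0) (𝓝 0))
    (hh : Tendsto h₁ (𝓝 0) (𝓝 0)) (hfix : ∀ᶠ μ in 𝓝 0, F (x μ, μ, h₁ μ) = x μ)
    (hmul : ∀ᶠ μ in 𝓝 0, pdx F (x μ, μ, h₁ μ) = -1) :
    (fun μ => iterTwo F (0, μ, h₁ μ) - 2 * flipCoef F * x μ ^ 3) =o[𝓝 0] fun μ => x μ ^ 3 := by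
  rw [isLittleO_iff]
  intro κ hκ
  have h3 : ∀ᶠ z in 𝓝 (0 : ℝ × ℝ × ℝ),
      |pdx (pdx (pdx (iterTwo F))) z - -12 * flipCoef F| ≤ κ := by
    have := h.tendsto_pdx_pdx_pdx_iterTwo.eventually (Metric.closedBall_mem_nhds _ hκ)
    filter_upwards [this] with z hz using hz
  obtain ⟨ρ, hρ, hp⟩ := Metric.eventually_nhds_iff_ball.1
    (((h3.and h.eventually_hasDerivAt_iterTwo).and h.pdx_iterTwo).and h.pdx_pdx_iterTwo)
  have hw : Tendsto (fun μ => (x μ, μ, h₁ μ)) (𝓝 0) (𝓝 (0 : ℝ × ℝ × ℝ)) :=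
    hx.prodMk_nhds (tendsto_id.prodMk_nhds hh)
  filter_upwards [hw.eventually (Metric.ball_mem_nhds _ hρ), hfix, hmul] with μ hμ hf hm
  replace hμ := mem_ball_zero_iff.1 hμ
  rw [Prod.norm_def, max_lt_iff] at hμ
  have hmem : ∀ t ∈ uIcc (x μ) 0, ((t, μ, h₁ μ) : ℝ × ℝ × ℝ) ∈ Metric.ball 0 ρ := by
    intro t ht
    rw [mem_ball_zero_iff, Prod.norm_def]
    refine max_lt ?_ hμ.2
    refine lt_of_le_of_lt ?_ hμ.1
    have := abs_sub_right_of_mem_uIcc ht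
    simpa using this
  have hleft := hp _ (hmem (x μ) left_mem_uIcc)
  have e1 : pdx (iterTwo F) (x μ, μ, h₁ μ) - 1 = 0 := by
    rw [hleft.1.2]; simp only [hf, hm]; norm_num
  -- With multiplier -1 the two contributions F'' · (-1)² and (-1) · F'' cancel, so the second
  -- iterate minus the identity starts with the cubic term -2 c (t - x)³. At t = 0 this is 2 c x³.
  have e2 : pdx (pdx (iterTwo F)) (x μ, μ, h₁ μ) = 0 := by
    rw [hleft.2]; simp only [hf, hm]; ring
  have key := abs_sub_cubic_le (g := fun t => iterTwo F (t, μ, h₁ μ) - t)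
    (g₁ := fun t => pdx (iterTwo F) (t, μ, h₁ μ) - 1)
    (g₂ := fun t => pdx (pdx (iterTwo F)) (t, μ, h₁ μ))
    (g₃ := fun t => pdx (pdx (pdx (iterTwo F))) (t, μ, h₁ μ)) (c := -12 * flipCoef F)
    (fun t ht => (hp _ (hmem t ht)).1.1.2.1.sub (hasDerivAt_id t))
    (fun t ht => (hp _ (hmem t ht)).1.1.2.2.1.sub_const 1)
    (fun t ht => (hp _ (hmem t ht)).1.1.2.2.2)
    (fun t ht => (hp _ (hmem t ht)).1.1.1)
    (by simp only [iterTwo, hf, sub_self]) e1 e2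
  rw [Real.norm_eq_abs, Real.norm_eq_abs, abs_pow]
  convert key using 2
  · ring
  · rw [zero_sub, abs_neg]

/-- The two curves differ by `c₀ / 4 * μ ^ 2` to leading order. -/
theorem isLittleO_curves (h : FlipGerm k F) {X V : ℝ × ℝ → ℝ} {h₁ h₂ : ℝ → ℝ} (hX0 : X 0 = 0)
    (hX : ContDiffAt ℝ k X 0) (hX' : ∀ w, fderiv ℝ X 0 w = w.1 / 2)
    (hfix : ∀ᶠ w in 𝓝 (0 : ℝ × ℝ), F (X w, w) = X w)
    (hV : ContDiffAt ℝ ((k - 1 : ℕ) : WithTop ℕ∞) V 0) (hV0 : V 0 = 0)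
    (hV' : fderiv ℝ V 0 (0, 1) = 1) (hFV : ∀ᶠ w in 𝓝 (0 : ℝ × ℝ), F (F (0, w), w) = w.1 * V w)
    (h₁0 : h₁ 0 = 0) (h₁s : ContDiffAt ℝ ((k - 1 : ℕ) : WithTop ℕ∞) h₁ 0)
    (h₁M : ∀ᶠ w in 𝓝 (0 : ℝ × ℝ), pdx F (X w, w) = -1 ↔ w.2 = h₁ w.1)
    (h₂0 : h₂ 0 = 0) (h₂s : ContDiffAt ℝ ((k - 1 : ℕ) : WithTop ℕ∞) h₂ 0)
    (h₂V : ∀ᶠ w in 𝓝 (0 : ℝ × ℝ), V w = 0 ↔ w.2 = h₂ w.1) :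
    (fun μ => h₂ μ - (h₁ μ - flipCoef F / 4 * μ ^ 2)) =o[𝓝 0] (fun μ : ℝ => μ ^ 2) := by
  have t1 : Tendsto h₁ (𝓝 0) (𝓝 0) := by
    have := h₁s.continuousAt.tendsto
    rwa [h₁0] at this
  have t2 : Tendsto h₂ (𝓝 0) (𝓝 0) := by
    have := h₂s.continuousAt.tendsto
    rwa [h₂0] at this
  have w1 : Tendsto (fun μ => (μ, h₁ μ)) (𝓝 0) (𝓝 (0 : ℝ × ℝ)) := tendsto_id.prodMk_nhds t1
  have w2 : Tendsto (fun μ => (μ, h₂ μ)) (𝓝 0) (𝓝 (0 : ℝ × ℝ)) := tendsto_id.prodMk_nhds t2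
  set x : ℝ → ℝ := fun μ => X (μ, h₁ μ) with hxdef
  have hx' : HasDerivAt x (1 / 2) 0 := by
    have hXd : HasFDerivAt X (fderiv ℝ X 0) ((0 : ℝ), h₁ 0) := by
      rw [h₁0]; exact (hX.differentiableAt h.order_ne).hasFDerivAt
    refine (HasFDerivAt.comp_hasDerivAt (f := fun m : ℝ => (m, h₁ m)) (0 : ℝ) hXd
      ((hasDerivAt_id _).prodMk (h₁s.differentiableAt h.order_pred_ne).hasDerivAt)).congr_deriv ?_
    rw [hX']
  have hx0 : x 0 = 0 := by simp only [hxdef, h₁0]; exact hX0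
  have hxt : Tendsto x (𝓝 0) (𝓝 0) := by
    have := hx'.continuousAt.tendsto
    rwa [hx0] at this
  have hslope : Tendsto (fun μ => x μ / μ) (𝓝[≠] 0) (𝓝 (1 / 2)) := by
    have := hasDerivAt_iff_tendsto_slope.1 hx'
    refine this.congr fun μ => ?_
    rw [slope_def_field, hx0, sub_zero, sub_zero]
  have hxO : x =O[𝓝 0] fun μ : ℝ => μ := by
    have := hx'.differentiableAt.isBigO_sub
    simpa [hx0] using this
  have hcub := (h.isLittleO_iterTwo hxt t1 (w1.eventually hfix) (by
    filter_upwards [w1.eventually h₁M] with μ hμ using hμ.2 rfl)).trans_isBigO (hxO.pow 3)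
  set T : ℝ → ℝ := fun μ => V (μ, h₁ μ) with hT
  -- On the first curve μ T = 2 c x³ + o(μ³) with x / μ → 1 / 2.
  have hTlim : (fun μ => T μ - flipCoef F / 4 * μ ^ 2) =o[𝓝 0] fun μ : ℝ => μ ^ 2 := by
    have hT0 : T 0 - flipCoef F / 4 * 0 ^ 2 = 0 := by
      have : V ((0 : ℝ), h₁ 0) = 0 := by rw [h₁0]; exact hV0
      simp [hT, this]
    refine isLittleO_nhds_of_nhdsNE ?_ hT0
    have hne : ∀ᶠ μ in 𝓝[≠] (0 : ℝ), μ ≠ 0 := eventually_mem_nhdsWithin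
    rw [isLittleO_iff_tendsto' (hne.mono fun μ hμ h0 => absurd (pow_eq_zero_iff two_ne_zero |>.1 h0) hμ)]
    have l1 := (isLittleO_iff_tendsto' (hne.mono fun μ hμ h0 =>
      absurd (pow_eq_zero_iff three_ne_zero |>.1 h0) hμ)).1 (hcub.mono nhdsWithin_le_nhds)
    have l2 := (((hslope.pow 3).const_mul (2 * flipCoef F)).add l1).sub_const (flipCoef F / 4)
    rw [show 2 * flipCoef F * (1 / 2) ^ 3 + 0 - flipCoef F / 4 = 0 by ring] at l2
    refine l2.congr' ?_
    filter_upwards [hne, nhdsWithin_le_nhds (w1.eventually hFV)] with μ hμ hμV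
    have : iterTwo F (0, μ, h₁ μ) = μ * T μ := hμV
    rw [this]
    field_simp
    ring
  -- V vanishes on the second curve and has unit η-derivative at the origin, so its value on the
  -- first curve is asymptotically the vertical distance between the curves.
  have hstrict : (fun μ => T μ - (h₁ μ - h₂ μ)) =o[𝓝 0] fun μ => h₁ μ - h₂ μ := by
    rw [isLittleO_iff]
    intro κ hκ
    obtain ⟨ρ, hρ, hρ0⟩ := ((eventually_strict_bound hV h.order_pred_ne hκ).and
      self_mem_nhdsWithin).exists
    filter_upwards [w1.eventually (Metric.ball_mem_nhds _ hρ0),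
      w2.eventually (Metric.ball_mem_nhds _ hρ0), w2.eventually h₂V] with μ m1 m2 m3
    replace m1 := mem_ball_zero_iff.1 m1
    replace m2 := mem_ball_zero_iff.1 m2
    have key := hρ _ _ m1 m2
    rw [m3.2 rfl, Prod.mk_sub_mk, sub_self, sub_zero,
      show ((0 : ℝ), h₁ μ - h₂ μ) = (h₁ μ - h₂ μ) • ((0 : ℝ), (1 : ℝ)) by ext <;> simp,
      map_smul, hV', norm_smul, smul_eq_mul, mul_one, Prod.norm_def] at key
    simpa using key
  have hequiv : T ~[𝓝 0] fun μ => h₁ μ - h₂ μ := hstrict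
  have hTO : T =O[𝓝 0] fun μ : ℝ => μ ^ 2 := by
    have h1 : (fun μ : ℝ => flipCoef F / 4 * μ ^ 2) =O[𝓝 0] fun μ : ℝ => μ ^ 2 :=
      (isBigO_refl _ _).const_mul_left _
    exact (hTlim.isBigO.add h1).congr_left fun μ => by ring
  have h4 : (fun μ => (h₁ μ - h₂ μ) - T μ) =o[𝓝 0] fun μ : ℝ => μ ^ 2 :=
    hequiv.symm.isLittleO.trans_isBigO hTO
  exact (h4.neg_left.sub hTlim).congr_left fun μ => by ring

end FlipGerm

/-! ### The quantitative chart and the period-doubling bifurcation. -/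

namespace FlipMaps

variable {L R L₁ R₁ P : ℝ → ℝ} {a κ r x₀ σ : ℝ}

/-- At the bifurcation, points near the fixed point are moved by the second iterate in the
direction given by the criticality. -/
theorem return_sign_of_multiplier_one (h : FlipMaps L R L₁ R₁ P a κ r x₀) (hκ : κ < 1)
    (hx₀ : |x₀| < r) (hσ : σ = 1 ∨ σ = -1)
    (hP : StrictConcaveOn ℝ (Ioo (-r) r) fun x => σ * P x) (hP1 : P x₀ = 1) {b : ℝ} (hxb : x₀ < b)
    (hb : |b| < r) (hLb : |L b| < r)
    (hLLb : |L (L b)| < r) : σ * (L (L b) - b) < 0 := by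
  have hA := h.secL.strictAntiOn (by linarith)
  have hC := ConcaveDeriv.mk h.derivLL hP
  have hLx : L b < x₀ := by
    have := hA (abs_lt.1 hx₀) (abs_lt.1 hb) hxb
    rwa [h.fixed] at this
  by_contra hcon
  rw [not_lt] at hcon
  obtain ⟨ξ, h1, h2, h3⟩ := hC.exists_slope hx₀ hb hxb
  obtain ⟨ζ, h4, h5, h6⟩ := hC.exists_slope hLb hx₀ hLx
  simp only [h.fixed] at h3 h6
  have hξ : ξ ∈ Ioo (-r) r := ⟨(abs_lt.1 hx₀).1.trans h1, h2.trans (abs_lt.1 hb).2⟩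
  have hζ : ζ ∈ Ioo (-r) r := ⟨(abs_lt.1 hLb).1.trans h4, h5.trans (abs_lt.1 hx₀).2⟩
  have s1 : 0 ≤ σ * (P ξ - 1) := by
    have : σ * (P ξ - 1) * (b - x₀) = σ * (L (L b) - b) := by
      rw [show L (L b) = x₀ + P ξ * (b - x₀) by linarith]; ring
    exact nonneg_of_mul_nonneg_left (this ▸ hcon) (sub_pos.2 hxb)
  -- Applying the decreasing map L carries the assumed displacement at b to the other side of x₀.
  -- Mean values on both sides then force σ (P x₀ - 1) > 0 by concavity, against P x₀ = 1.
  have hmir : 0 ≤ σ * (L b - L (L (L b))) := by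
    rcases hσ with rfl | rfl
    · have := hA.antitoneOn (abs_lt.1 hb) (abs_lt.1 hLLb) (by linarith)
      linarith
    · have := hA.antitoneOn (abs_lt.1 hLLb) (abs_lt.1 hb) (by linarith)
      linarith
  have s2 : 0 ≤ σ * (P ζ - 1) := by
    have : σ * (P ζ - 1) * (x₀ - L b) = σ * (L b - L (L (L b))) := by
      rw [show L (L (L b)) = x₀ - P ζ * (x₀ - L b) by linarith]; ring
    exact nonneg_of_mul_nonneg_left (this ▸ hmir) (sub_pos.2 hLx)
  have := hC.concave'.pos_of_zeros hζ hξ h5 h1 s2 s1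
  rw [hP1] at this
  simp at this

end FlipMaps

/-- Quantitative local description of a border-flip family: everything that the local dynamics
depends on, for parameters and points of norm less than `ρ`. -/
structure FlipChart (F FR : ℝ × ℝ × ℝ → ℝ) (X V : ℝ × ℝ → ℝ) (h₁ h₂ : ℝ → ℝ) (a c κ ρ : ℝ) :
    Prop where
  maps : ∀ w, ‖w‖ < ρ → FlipMaps (fun x => F (x, w)) (fun x => FR (x, w))
    (fun x => pdx F (x, w)) (fun x => pdx FR (x, w)) (fun x => pdx (iterTwo F) (x, w)) a κ ρ (X w)
  continuousAt : ∀ z, ‖z‖ < ρ → ContinuousAt F z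
  continuousAt_fixed : ∀ w, ‖w‖ < ρ → ContinuousAt X w
  abs_fixed_le : ∀ w, ‖w‖ < ρ → |X w| ≤ 3 / 4 * ‖w‖
  apply_zero : ∀ w, ‖w‖ < ρ → |F (0, w) - w.1| ≤ κ * |w.1|
  multiplier : ∀ μ η, |μ| < ρ → |η| < ρ → |h₁ μ| < ρ →
    |pdx F (X (μ, η), μ, η) + 1 - (η - h₁ μ)| ≤ 1 / 2 * |η - h₁ μ|
  return_eq : ∀ w, ‖w‖ < ρ → F (F (0, w), w) = w.1 * V w
  return_coef : ∀ μ η, |μ| < ρ → |η| < ρ → |h₂ μ| < ρ →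
    |V (μ, η) - (η - h₂ μ)| ≤ 1 / 2 * |η - h₂ μ|
  transversality : ∀ z : ℝ × ℝ × ℝ, ‖z‖ < ρ →
    deriv (fun η => F (z.1, z.2.1, η)) z.2.2 * pdx (pdx F) z +
      2 * deriv (fun η => pdx F (z.1, z.2.1, η)) z.2.2 ≠ 0
  nondegeneracy : c ≠ 0 → ∀ z : ℝ × ℝ × ℝ, ‖z‖ < ρ →
    (1 / 2 : ℝ) * pdx (pdx F) z ^ 2 + (1 / 3 : ℝ) * pdx (pdx (pdx F)) z ≠ 0
  concave : ∀ σ : ℝ, σ = 1 ∨ σ = -1 → 0 < σ * c → ∀ w, ‖w‖ < ρ →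
    StrictConcaveOn ℝ (Ioo (-ρ) ρ) fun x => σ * pdx (iterTwo F) (x, w)

theorem abs_sub_le_half_sign {x t : ℝ} (h : |x - t| ≤ 1 / 2 * |t|) :
    (0 < t ↔ 0 < x) ∧ (t < 0 ↔ x < 0) := by
  rcases lt_trichotomy t 0 with ht | rfl | ht
  · rw [abs_of_neg ht, abs_le] at h
    constructor <;> constructor <;> intro <;> linarith
  · simp only [abs_zero, mul_zero, sub_zero, abs_nonpos_iff] at h
    simp [h]
  · rw [abs_of_pos ht, abs_le] at h
    constructor <;> constructor <;> intro <;> linarith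

theorem norm_pair_lt {μ η ρ : ℝ} : ‖(μ, η)‖ < ρ ↔ |μ| < ρ ∧ |η| < ρ := by
  rw [Prod.norm_def, max_lt_iff, Real.norm_eq_abs, Real.norm_eq_abs]

namespace FlipChart

variable {F FR : ℝ × ℝ × ℝ → ℝ} {X V : ℝ × ℝ → ℝ} {h₁ h₂ : ℝ → ℝ} {a c κ ρ : ℝ}

theorem multiplier_sign (h : FlipChart F FR X V h₁ h₂ a c κ ρ) {μ η : ℝ} (hμ : |μ| < ρ)
    (hη : |η| < ρ) (h1 : |h₁ μ| < ρ) :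
    (h₁ μ < η ↔ -1 < pdx F (X (μ, η), μ, η)) ∧ (η < h₁ μ ↔ pdx F (X (μ, η), μ, η) < -1) := by
  obtain ⟨e1, e2⟩ := abs_sub_le_half_sign (h.multiplier μ η hμ hη h1)
  rw [sub_pos] at e1
  rw [sub_neg] at e2
  exact ⟨e1.trans ⟨fun _ => by linarith, fun _ => by linarith⟩,
    e2.trans ⟨fun _ => by linarith, fun _ => by linarith⟩⟩

theorem multiplier_eq_iff (h : FlipChart F FR X V h₁ h₂ a c κ ρ) {μ η : ℝ} (hμ : |μ| < ρ)
    (hη : |η| < ρ) (h1 : |h₁ μ| < ρ) : pdx F (X (μ, η), μ, η) = -1 ↔ η = h₁ μ := by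
  obtain ⟨e1, e2⟩ := h.multiplier_sign hμ hη h1
  constructor
  · intro he
    rcases lt_trichotomy η (h₁ μ) with hlt | heq | hlt
    · exact absurd (e2.1 hlt) (by rw [he]; exact lt_irrefl _)
    · exact heq
    · exact absurd (e1.1 hlt) (by rw [he]; exact lt_irrefl _)
  · intro he
    exact le_antisymm (not_lt.1 fun hc => (e1.2 hc).ne he.symm)
      (not_lt.1 fun hc => (e2.2 hc).ne he)

/-- The unstable side of the flip in terms of the multiplier of the second iterate. -/
theorem return_multiplier_sign (h : FlipChart F FR X V h₁ h₂ a c κ ρ) {σ μ η : ℝ}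
    (hκ : κ < 1) (hσ : σ = 1 ∨ σ = -1) (hμ : |μ| < ρ) (hη : |η| < ρ) (h1 : |h₁ μ| < ρ)
    (hX : |X (μ, η)| < ρ) :
    0 < σ * (pdx (iterTwo F) (X (μ, η), μ, η) - 1) ↔ 0 < -σ * (η - h₁ μ) := by
  obtain ⟨e1, e2⟩ := h.multiplier_sign hμ hη h1
  have hm := h.maps (μ, η) (norm_pair_lt.2 ⟨hμ, hη⟩)
  have hle := abs_le.1 (hm.derivL_le _ hX)
  have hsq := hm.derivLL_fixed
  rw [hsq]
  have hfac : ∀ M : ℝ, M ^ 2 - 1 = (M - 1) * (M + 1) := fun M => by ring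
  have hneg : pdx F (X (μ, η), μ, η) - 1 < 0 := by linarith
  rw [hfac]
  have hpos : ∀ t : ℝ, 0 < (pdx F (X (μ, η), μ, η) - 1) * t ↔ t < 0 := fun t =>
    ⟨fun ht => neg_of_mul_pos_right ht hneg.le, fun ht => mul_pos_of_neg_of_neg hneg ht⟩
  rw [mul_left_comm, hpos]
  rcases hσ with rfl | rfl
  · rw [one_mul, neg_one_mul, neg_sub, sub_pos, e2]
    constructor <;> intro <;> linarith
  · rw [neg_one_mul, neg_lt_zero, neg_neg, one_mul, sub_pos, e1]
    constructor <;> intro <;> linarith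

/-- Along the flip curve a two-cycle of the piecewise map near the fixed point exists on exactly
one side. -/
theorem exists_branch (h : FlipChart F FR X V h₁ h₂ a c κ ρ) {σ μ : ℝ} (hκ0 : 0 < κ)
    (hκ : κ ≤ 1 / 2) (hσ : σ = 1 ∨ σ = -1) (hσc : 0 < σ * c) (hμ : |μ| < ρ) (h1 : |h₁ μ| < ρ)
    (hX : |X (μ, h₁ μ)| < ρ) (hX0 : X (μ, h₁ μ) < 0) :
    ∃ ε₀ > 0, ∀ ε, 0 < ε → ε ≤ ε₀ → ∃ ϱ > 0, ∀ η, |η - h₁ μ| < ϱ →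
      UniqueExactlyWhen (fun z => IsTwoCycle
        (pw (fun x => F (x, μ, η)) fun x => FR (x, μ, η)) z ∧ CycleWithin (X (μ, h₁ μ)) ε z)
        (0 < -σ * (η - h₁ μ)) := by
  have hκ1 : κ < 1 := by linarith
  set η₀ := h₁ μ with hη₀
  set x₀ := X (μ, η₀) with hx₀
  have hw₀ : ‖(μ, η₀)‖ < ρ := norm_pair_lt.2 ⟨hμ, h1⟩
  have hm₀ := h.maps _ hw₀
  -- The first bound keeps the neighbourhood of x₀ in x < 0, where the piecewise map is the left
  -- half-map; the second keeps it inside the chart.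
  refine ⟨min (-x₀ / 2) (ρ - |x₀|), lt_min (by linarith) (by linarith), fun ε hε hε' => ?_⟩
  have hεx : ε ≤ -x₀ / 2 := hε'.trans (min_le_left _ _)
  have hεr : ε ≤ ρ - |x₀| := hε'.trans (min_le_right _ _)
  have hnear : ∀ x, |x - x₀| < ε → |x| < ρ ∧ x < 0 := fun x hx => by
    have h2 := abs_add_le (x - x₀) x₀
    rw [sub_add_cancel] at h2
    exact ⟨by linarith, by linarith [(abs_lt.1 hx).2]⟩
  -- Two applications of the left half-map stretch distances to x₀ by at most (3 / 2)² < 4. The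
  -- displacement at b has a strict sign at the bifurcation, and this sign persists for nearby η.
  set b := x₀ + ε / 4 with hb
  have hbx : |b - x₀| = ε / 4 := by rw [hb, add_sub_cancel_left, abs_of_pos (by linarith)]
  have hbr := hnear b (by rw [hbx]; linarith)
  have hLb : |F (b, μ, η₀) - x₀| ≤ 3 / 2 * |b - x₀| := by
    have := hm₀.secL.abs_image_sub_le (B := 3 / 2) (by linarith) (by linarith) hbr.1 hX
    rwa [hm₀.fixed] at this
  have hLb' : |F (b, μ, η₀) - x₀| < ε := by rw [hbx] at hLb; linarith
  have hLbr := hnear _ hLb'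
  have hLLb : |F (F (b, μ, η₀), μ, η₀) - x₀| ≤ 3 / 2 * |F (b, μ, η₀) - x₀| := by
    have := hm₀.secL.abs_image_sub_le (B := 3 / 2) (by linarith) (by linarith) hLbr.1 hX
    rwa [hm₀.fixed] at this
  have hLLbr := hnear (F (F (b, μ, η₀), μ, η₀)) (by rw [hbx] at hLb; linarith)
  have hmul : pdx F (x₀, μ, η₀) = -1 := (h.multiplier_eq_iff hμ h1 h1).2 rfl
  have hP1 : pdx (iterTwo F) (x₀, μ, η₀) = 1 := by
    rw [hm₀.derivLL_fixed, hmul]; norm_num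
  have hsign : σ * (iterTwo F (b, μ, η₀) - b) < 0 :=
    hm₀.return_sign_of_multiplier_one hκ1 hX hσ (h.concave σ hσ hσc _ hw₀) hP1
      (by rw [hb]; linarith) hbr.1 hLbr.1 hLLbr.1
  -- continuity in the parameter
  have hpar : ∀ x : ℝ, ContinuousAt (fun η : ℝ => (x, μ, η)) η₀ := fun x =>
    Continuous.continuousAt (by fun_prop)
  have hpar' : ContinuousAt (fun η : ℝ => (μ, η)) η₀ := Continuous.continuousAt (by fun_prop)
  have hnorm : ∀ x : ℝ, |x| < ρ → ‖(x, μ, η₀)‖ < ρ := fun x hx => by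
    rw [Prod.norm_def]; exact max_lt hx hw₀
  have c1 : ContinuousAt (fun η => F (b, μ, η)) η₀ :=
    ContinuousAt.comp (f := fun η : ℝ => (b, μ, η)) (h.continuousAt _ (hnorm b hbr.1)) (hpar b)
  have c2 : ContinuousAt (fun η => iterTwo F (b, μ, η)) η₀ :=
    ContinuousAt.comp (f := fun η : ℝ => (F (b, μ, η), μ, η))
      (h.continuousAt _ (hnorm _ hLbr.1)) (c1.prodMk hpar')
  have c3 : ContinuousAt (fun η => X (μ, η)) η₀ :=
    ContinuousAt.comp (f := fun η : ℝ => (μ, η)) (h.continuousAt_fixed _ hw₀) hpar'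
  have ev1 : ∀ᶠ η in 𝓝 η₀, σ * (iterTwo F (b, μ, η) - b) < 0 :=
    (continuousAt_const.mul (c2.sub continuousAt_const)).eventually (gt_mem_nhds hsign)
  have ev2 : ∀ᶠ η in 𝓝 η₀, |F (b, μ, η) - x₀| < ε :=
    (c1.sub continuousAt_const).abs.eventually (gt_mem_nhds hLb')
  have ev3 : ∀ᶠ η in 𝓝 η₀, |X (μ, η) - x₀| < ε / 4 := by
    refine (c3.sub continuousAt_const).abs.eventually (gt_mem_nhds ?_)
    change |x₀ - x₀| < ε / 4
    rw [sub_self, abs_zero]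
    linarith
  have ev4 : ∀ᶠ η in 𝓝 η₀, |η| < ρ := continuousAt_id.abs.eventually (gt_mem_nhds h1)
  obtain ⟨ϱ, hϱ, hev⟩ := Metric.eventually_nhds_iff_ball.1 (((ev1.and ev2).and ev3).and ev4)
  refine ⟨ϱ, hϱ, fun η hη => ?_⟩
  obtain ⟨⟨⟨d1, d2⟩, d3⟩, d4⟩ := hev η (by rwa [Metric.mem_ball, Real.dist_eq])
  have hw : ‖(μ, η)‖ < ρ := norm_pair_lt.2 ⟨hμ, d4⟩
  have hm := h.maps _ hw
  have hXη := hnear (X (μ, η)) (by linarith)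
  have hP := h.concave σ hσ hσc _ hw
  rw [← h.return_multiplier_sign hκ1 hσ hμ d4 h1 hXη.1]
  constructor
  · intro hpos
    have hxb : X (μ, η) < b := by rw [hb]; linarith [(abs_lt.1 d3).2]
    obtain ⟨y, hxy, hyb, hy⟩ := (ConcaveDeriv.mk hm.derivLL hP).exists_fixed_right hXη.1 hbr.1 hxb
      (by simp only [hm.fixed]) hpos d1
    obtain ⟨e1, e2, e3⟩ := hm.isTwoCycle_of_fixed_right hκ1 hXη.1 hbr.1 hxy hyb hy
    have hyn : |y - x₀| < ε := abs_lt.2 ⟨by linarith [(abs_lt.1 d3).1], by rw [hb] at hyb; linarith⟩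
    have hLyn : |F (y, μ, η) - x₀| < ε :=
      abs_lt.2 ⟨by linarith [(abs_lt.1 d2).1], by linarith [(abs_lt.1 d3).2]⟩
    refine ⟨(F (y, μ, η), y), ⟨FlipMaps.isTwoCycle_pw e1 (hnear y hyn).2.le, hLyn, hyn⟩, ?_⟩
    rintro z ⟨hz, hz1, hz2⟩
    exact hm.isTwoCycle_unique hκ1 hXη.1 hP e1 (hnear _ hLyn).1 (hnear _ hyn).1
      (FlipMaps.isTwoCycle_of_pw hz (hnear _ hz2).2.le) (hnear _ hz1).1 (hnear _ hz2).1
  · rintro ⟨z, hz, hz1, hz2⟩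
    exact (hm.signs_of_isTwoCycle hκ1 hXη.1 hP (FlipMaps.isTwoCycle_of_pw hz (hnear _ hz2).2.le)
      (hnear _ hz1).1 (hnear _ hz2).1).1

/-- The piecewise family has a period-doubling bifurcation along the flip curve as long as the
fixed point lies strictly to the left of the switching point. -/
theorem isPeriodDoubling (h : FlipChart F FR X V h₁ h₂ a c κ ρ) {μ : ℝ} (hκ0 : 0 < κ)
    (hκ : κ ≤ 1 / 2) (hc : c ≠ 0) (hμ : |μ| < ρ) (h1 : |h₁ μ| < ρ)
    (hX : |X (μ, h₁ μ)| < ρ) (hX0 : X (μ, h₁ μ) < 0) :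
    IsPeriodDoubling (fun x η => pw (fun x => F (x, μ, η)) (fun x => FR (x, μ, η)) x)
      (X (μ, h₁ μ)) (h₁ μ) := by
  have hw : ‖(μ, h₁ μ)‖ < ρ := norm_pair_lt.2 ⟨hμ, h1⟩
  have hz : ‖(X (μ, h₁ μ), μ, h₁ μ)‖ < ρ := by rw [Prod.norm_def]; exact max_lt hX hw
  have hev : ∀ η, (fun x => pw (fun x => F (x, μ, η)) (fun x => FR (x, μ, η)) x)
      =ᶠ[𝓝 (X (μ, h₁ μ))] fun x => F (x, μ, η) := fun η => FlipMaps.eventuallyEq_left _ _ hX0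
  have d2 : iteratedDeriv 2 (fun x => pw (fun x => F (x, μ, h₁ μ)) (fun x => FR (x, μ, h₁ μ)) x)
      (X (μ, h₁ μ)) = pdx (pdx F) (X (μ, h₁ μ), μ, h₁ μ) := by
    rw [(hev _).iteratedDeriv_eq, iteratedDeriv_succ, iteratedDeriv_one]
    rfl
  have d3 : iteratedDeriv 3 (fun x => pw (fun x => F (x, μ, h₁ μ)) (fun x => FR (x, μ, h₁ μ)) x)
      (X (μ, h₁ μ)) = pdx (pdx (pdx F)) (X (μ, h₁ μ), μ, h₁ μ) := by
    rw [(hev _).iteratedDeriv_eq, iteratedDeriv_succ, iteratedDeriv_succ, iteratedDeriv_one]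
    rfl
  have d1 : ∀ η, deriv (fun x => pw (fun x => F (x, μ, η)) (fun x => FR (x, μ, η)) x)
      (X (μ, h₁ μ)) = pdx F (X (μ, h₁ μ), μ, η) := fun η => (hev η).deriv_eq
  refine ⟨?_, ?_, ?_, ?_, ?_⟩
  · exact (pw_of_nonpos hX0.le).trans (h.maps _ hw).fixed
  · rw [d1]
    exact (h.multiplier_eq_iff hμ h1 h1).2 rfl
  · rw [d2]
    simp only [d1, pw_of_nonpos hX0.le]
    exact h.transversality _ hz
  · rw [d2, d3]
    exact h.nondegeneracy hc _ hz
  -- With σ the sign of c, the cycle lives on the side 0 < -σ (η - h₁ μ), so s = -σ.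
  · rcases lt_or_gt_of_ne hc with hc | hc
    · refine ⟨1, Or.inl rfl, ?_⟩
      have := h.exists_branch hκ0 hκ (Or.inr rfl) (by linarith) hμ h1 hX hX0
      rwa [neg_neg] at this
    · exact ⟨-1, Or.inr rfl, h.exists_branch hκ0 hκ (Or.inl rfl) (by linarith) hμ h1 hX hX0⟩

end FlipChart

/-! ### Every flip germ has a chart on all sufficiently small balls. -/

theorem eventually_secantBound {E : Type} [NormedAddCommGroup E] [NormedSpace ℝ E]
    {G : ℝ × E → ℝ} {n : WithTop ℕ∞} (hG : ContDiffAt ℝ n G 0) (hn : 1 ≤ n) {κ : ℝ} (hκ : 0 < κ) :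
    ∀ᶠ ρ in 𝓝[>] (0 : ℝ), ∀ w, ‖w‖ < ρ → SecantBound (fun x => G (x, w)) (pdx G 0) κ ρ := by
  have hd := (eventually_hasDerivAt_pdx hG hn).self_of_nhds.2
  filter_upwards [eventually_strict_bound hG (zero_lt_one.trans_le hn).ne' hκ] with ρ hρ
    w hw x y hx hy hxy
  have hmem : ∀ t : ℝ, |t| < ρ → ‖(t, w)‖ < ρ := fun t ht => by
    rw [Prod.norm_def]; exact max_lt ht hw
  have key := hρ _ _ (hmem y hy) (hmem x hx)
  rw [Prod.mk_sub_mk, sub_self, show (y - x, (0 : E)) = (y - x) • ((1 : ℝ), (0 : E)) by ext <;> simp,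
    map_smul, ← hd, norm_smul, Prod.norm_def, norm_zero, norm_one, max_eq_left zero_le_one, mul_one,
    smul_eq_mul, Real.norm_eq_abs, abs_of_nonneg (sub_nonneg.2 hxy), abs_le] at key
  constructor <;> simp only <;> nlinarith [key.1, key.2]

namespace FlipGerm

variable {k : ℕ} {F FR : ℝ × ℝ × ℝ → ℝ} {a κ : ℝ}

theorem one_le_order (h : FlipGerm k F) : (1 : WithTop ℕ∞) ≤ k := by
  exact_mod_cast natCast_le (by have := h.order; omega : 1 ≤ k)

theorem tendsto_pdx_iterTwo (h : FlipGerm k F) : Tendsto (pdx (iterTwo F)) (𝓝 0) (𝓝 1) := by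
  have h1 := h.smooth_pdx_iterTwo.continuousAt.tendsto
  have h2 := h.pdx_iterTwo.self_of_nhds
  have h3 : pdx F (F 0, (0 : ℝ × ℝ × ℝ).2) = -1 := by rw [h.apply_zero]; exact h.dx
  change pdx (iterTwo F) 0 = pdx F (F 0, (0 : ℝ × ℝ × ℝ).2) * pdx F 0 at h2
  rw [h3, h.dx] at h2
  rw [h2] at h1
  convert h1 using 2
  norm_num

/-- The comparison is with the point having the same η and μ = 0, where F vanishes. The error is
thus proportional to |μ| and not to the full parameter norm, so F(0, μ, η) has the sign of μ. -/
theorem eventually_abs_apply_zero_sub_le (h : FlipGerm k F) (hκ : 0 < κ) :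
    ∀ᶠ ρ in 𝓝[>] (0 : ℝ), ∀ w : ℝ × ℝ, ‖w‖ < ρ → |F (0, w) - w.1| ≤ κ * |w.1| := by
  have hz : ∀ᶠ w in 𝓝 (0 : ℝ × ℝ), F (0, 0, w.2) = 0 :=
    (continuous_snd.tendsto (0 : ℝ × ℝ)).eventually h.zero
  filter_upwards [eventually_strict_bound h.smooth h.order_ne hκ, eventually_ball_of_eventually hz]
    with ρ h1 h2 w hw
  have hw' := norm_pair_lt.1 (show ‖(w.1, w.2)‖ < ρ from hw)
  have hρ : 0 < ρ := (norm_nonneg _).trans_lt hw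
  have n1 : ‖((0 : ℝ), w)‖ < ρ := by
    rw [Prod.norm_def]; exact max_lt (by simpa using hρ) hw
  have n2 : ‖((0 : ℝ), (0 : ℝ), w.2)‖ < ρ := by
    rw [Prod.norm_def]
    exact max_lt (by simpa using hρ) (norm_pair_lt.2 ⟨by simpa using hρ, hw'.2⟩)
  have key := h1 _ _ n1 n2
  rw [h2 w hw, h.fderiv_apply, sub_zero,
    show ((0 : ℝ), w) - ((0 : ℝ), (0 : ℝ), w.2) = (0, w.1, 0) by ext <;> simp] at key
  have n3 : ‖((0 : ℝ), w.1, (0 : ℝ))‖ = |w.1| := by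
    simp [Prod.norm_def]
  rw [n3] at key
  simpa using key

/-- A comparison along vertical lines shows that G - v has the sign of η - g μ. It serves the
multiplier with v = -1 and the reduced return with v = 0. -/
theorem eventually_abs_sub_sub_le {n : WithTop ℕ∞} {G : ℝ × ℝ → ℝ} {g : ℝ → ℝ} {v : ℝ}
    (hG : ContDiffAt ℝ n G 0) (hn : n ≠ 0) (h1 : fderiv ℝ G 0 (0, 1) = 1)
    (hg : ∀ᶠ w in 𝓝 (0 : ℝ × ℝ), G w = v ↔ w.2 = g w.1) :
    ∀ᶠ ρ in 𝓝[>] (0 : ℝ), ∀ μ η, |μ| < ρ → |η| < ρ → |g μ| < ρ →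
      |G (μ, η) - v - (η - g μ)| ≤ 1 / 2 * |η - g μ| := by
  filter_upwards [eventually_strict_bound hG hn (by norm_num : (0 : ℝ) < 1 / 2),
    eventually_ball_of_eventually hg] with ρ hρ hρ' μ η hμ hη hgμ
  have n1 := norm_pair_lt.2 ⟨hμ, hη⟩
  have n2 := norm_pair_lt.2 ⟨hμ, hgμ⟩
  have key := hρ _ _ n1 n2
  rw [(hρ' _ n2).2 rfl, Prod.mk_sub_mk, sub_self,
    show ((0 : ℝ), η - g μ) = (η - g μ) • ((0 : ℝ), (1 : ℝ)) by ext <;> simp, map_smul, h1,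
    norm_smul, smul_eq_mul, mul_one, Prod.norm_def] at key
  simpa using key

theorem eventually_transversality (h : FlipGerm k F) : ∀ᶠ z : ℝ × ℝ × ℝ in 𝓝 0,
    deriv (fun η => F (z.1, z.2.1, η)) z.2.2 * pdx (pdx F) z +
      2 * deriv (fun η => pdx F (z.1, z.2.1, η)) z.2.2 ≠ 0 := by
  have hk := h.order
  have hline : ∀ {G : ℝ × ℝ × ℝ → ℝ} {z : ℝ × ℝ × ℝ}, DifferentiableAt ℝ G z →
      deriv (fun η => G (z.1, z.2.1, η)) z.2.2 = fderiv ℝ G z (0, 0, 1) := by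
    intro G z hG
    have hG' : HasFDerivAt G (fderiv ℝ G z) (z.1, z.2.1, z.2.2) := hG.hasFDerivAt
    exact (HasFDerivAt.comp_hasDerivAt (f := fun η : ℝ => (z.1, z.2.1, η)) z.2.2 hG'
      ((hasDerivAt_const _ _).prodMk ((hasDerivAt_const _ _).prodMk (hasDerivAt_id _)))).deriv
  have s1 : ContDiffAt ℝ ((k - 1 : ℕ) : WithTop ℕ∞) (fun z => fderiv ℝ F z (0, 0, 1)) 0 :=
    (h.smooth.fderiv_right (m := ((k - 1 : ℕ) : WithTop ℕ∞))
      (by exact_mod_cast natCast_le (by omega : k - 1 + 1 ≤ k))).clm_apply contDiffAt_const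
  have s2 : ContDiffAt ℝ ((k - 2 : ℕ) : WithTop ℕ∞) (fun z => fderiv ℝ (pdx F) z (0, 0, 1)) 0 :=
    (h.smooth_pdx.fderiv_right (m := ((k - 2 : ℕ) : WithTop ℕ∞))
      (by exact_mod_cast natCast_le (by omega : k - 2 + 1 ≤ k - 1))).clm_apply contDiffAt_const
  have e1 : fderiv ℝ F 0 (0, 0, 1) = 0 := by rw [h.fderiv_apply]; norm_num
  have e2 : fderiv ℝ (pdx F) 0 (0, 0, 1) = 1 :=
    (hline (z := 0) (h.smooth_pdx.differentiableAt h.order_pred_ne)).symm.trans h.dη.deriv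
  have hc := ((s1.continuousAt.mul h.smooth_pdx_pdx.continuousAt).add
    (s2.continuousAt.const_mul 2)).tendsto
  have hne : ∀ᶠ z in 𝓝 (0 : ℝ × ℝ × ℝ), fderiv ℝ F z (0, 0, 1) * pdx (pdx F) z +
      2 * fderiv ℝ (pdx F) z (0, 0, 1) ≠ 0 := by
    refine hc.eventually_ne ?_
    change fderiv ℝ F 0 (0, 0, 1) * pdx (pdx F) 0 + 2 * fderiv ℝ (pdx F) 0 (0, 0, 1) ≠ 0
    rw [e1, e2]
    norm_num
  have dF : ∀ᶠ z in 𝓝 (0 : ℝ × ℝ × ℝ), DifferentiableAt ℝ F z :=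
    (h.smooth.eventually (by simp)).mono fun z hz => hz.differentiableAt h.order_ne
  have dpF : ∀ᶠ z in 𝓝 (0 : ℝ × ℝ × ℝ), DifferentiableAt ℝ (pdx F) z :=
    (h.smooth_pdx.eventually (by simp)).mono fun z hz => hz.differentiableAt h.order_pred_ne
  filter_upwards [hne, dF, dpF] with z h1 h2 h3
  rwa [hline h2, hline h3]

theorem eventually_nondegeneracy (h : FlipGerm k F) (hc : flipCoef F ≠ 0) :
    ∀ᶠ z : ℝ × ℝ × ℝ in 𝓝 0,
      (1 / 2 : ℝ) * pdx (pdx F) z ^ 2 + (1 / 3 : ℝ) * pdx (pdx (pdx F)) z ≠ 0 := by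
  have hcont := (((h.smooth_pdx_pdx.continuousAt.pow 2).const_mul (1 / 2)).add
    (h.smooth_pdx_pdx_pdx.continuousAt.const_mul (1 / 3))).tendsto
  refine hcont.eventually_ne ?_
  change (1 / 2 : ℝ) * pdx (pdx F) 0 ^ 2 + (1 / 3 : ℝ) * pdx (pdx (pdx F)) 0 ≠ 0
  have : (1 / 2 : ℝ) * pdx (pdx F) 0 ^ 2 + (1 / 3 : ℝ) * pdx (pdx (pdx F)) 0 = 2 * flipCoef F := by
    rw [flipCoef]; ring
  rw [this]
  exact mul_ne_zero two_ne_zero hc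

theorem eventually_flipMaps (h : FlipGerm k F) {X V : ℝ × ℝ → ℝ}
    (hR : ContDiffAt ℝ k FR 0) (ha : pdx FR 0 = a) (h0 : ∀ᶠ w in 𝓝 (0 : ℝ × ℝ), F (0, w) = FR (0, w))
    (hX0 : X 0 = 0) (hX : ContDiffAt ℝ k X 0) (hfix : ∀ᶠ w in 𝓝 (0 : ℝ × ℝ), F (X w, w) = X w)
    (hV : ContDiffAt ℝ ((k - 1 : ℕ) : WithTop ℕ∞) V 0) (hV0 : V 0 = 0)
    (hFV : ∀ᶠ w in 𝓝 (0 : ℝ × ℝ), F (F (0, w), w) = w.1 * V w) (hκ : 0 < κ) (hκ' : κ ≤ 1 / 4) :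
    ∀ᶠ ρ in 𝓝[>] (0 : ℝ), ∀ w, ‖w‖ < ρ → FlipMaps (fun x => F (x, w)) (fun x => FR (x, w))
      (fun x => pdx F (x, w)) (fun x => pdx FR (x, w)) (fun x => pdx (iterTwo F) (x, w)) a κ ρ
      (X w) := by
  have hk := h.order
  have hXt : Tendsto (fun w : ℝ × ℝ => (X w, w)) (𝓝 0) (𝓝 0) := by
    have := hX.continuousAt.tendsto
    rw [hX0] at this
    exact this.prodMk_nhds tendsto_id
  have hVt := hV.continuousAt.tendsto
  rw [hV0] at hVt
  have hpR : Tendsto (pdx FR) (𝓝 0) (𝓝 a) := by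
    have := (hR.pdx (m := ((k - 1 : ℕ) : WithTop ℕ∞))
      (by exact_mod_cast natCast_le (by omega : k - 1 + 1 ≤ k))).continuousAt.tendsto
    rwa [ha] at this
  have near : ∀ {G : ℝ × ℝ × ℝ → ℝ} {m θ : ℝ}, Tendsto G (𝓝 0) (𝓝 m) → 0 < θ →
      ∀ᶠ z in 𝓝 (0 : ℝ × ℝ × ℝ), |G z - m| ≤ θ := fun hG hθ =>
    hG.eventually (Metric.closedBall_mem_nhds _ hθ)
  have hz := (((((eventually_hasDerivAt_pdx h.smooth h.one_le_order).and
    (eventually_hasDerivAt_pdx hR h.one_le_order)).and (near h.tendsto_pdx hκ)).and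
    (near hpR hκ)).and h.eventually_hasDerivAt_iterTwo).and
    (near h.tendsto_pdx_iterTwo (by norm_num : (0 : ℝ) < 1 / 2))
  have hw := (((h0.and hfix).and hFV).and (hXt.eventually h.pdx_iterTwo)).and
    (hVt.eventually (Metric.closedBall_mem_nhds _ (by linarith : 0 < κ / 2)))
  have hL := eventually_secantBound h.smooth h.one_le_order hκ
  have hR' := eventually_secantBound hR h.one_le_order hκ
  rw [h.dx] at hL
  rw [ha] at hR'
  filter_upwards [hL, hR', eventually_ball_of_eventually hz, eventually_ball_of_eventually hw,
    h.eventually_abs_apply_zero_sub_le hκ] with ρ b1 b2 b3 b4 b5 w hw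
  have hmem : ∀ t : ℝ, |t| < ρ → ‖(t, w)‖ < ρ := fun t ht => by
    rw [Prod.norm_def]; exact max_lt ht hw
  obtain ⟨⟨⟨⟨c1, c2⟩, c3⟩, c4⟩, c5⟩ := b4 w hw
  refine ⟨b1 w hw, b2 w hw, c1, fun x hx => (b3 _ (hmem x hx)).1.1.1.1.1.1,
    fun x hx => (b3 _ (hmem x hx)).1.1.1.1.2.1, fun x hx => ?_,
    fun x hx => (b3 _ (hmem x hx)).1.1.2, fun x hx => (b3 _ (hmem x hx)).1.2.1,
    fun x hx => (b3 _ (hmem x hx)).2, c2, ?_, ?_⟩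
  · simpa only [sub_neg_eq_add] using (b3 _ (hmem x hx)).1.1.1.2
  · rw [c4, c2, sq]
  -- The second return is μ V with |V| ≤ κ / 2, and |μ| ≤ 2 |F(0, w)|.
  · have hV' : |V w| ≤ κ / 2 := by simpa using c5
    have hμ := b5 w hw
    simp only [c3, abs_mul]
    have h1 : |w.1| ≤ |F (0, w) - w.1| + |F (0, w)| := by
      have := abs_sub (F (0, w)) (F (0, w) - w.1)
      rw [sub_sub_cancel] at this
      linarith
    have h2 : |w.1| ≤ 2 * |F (0, w)| := by nlinarith [abs_nonneg w.1]
    nlinarith [mul_le_mul_of_nonneg_left hV' (abs_nonneg w.1)]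

/-- The linear part contributes 1 / 2 and the error 1 / 4. A factor below 1 keeps the fixed point
inside the ball of the parameters. -/
theorem eventually_abs_fixed_le {n : WithTop ℕ∞} {X : ℝ × ℝ → ℝ} (hX0 : X 0 = 0)
    (hX : ContDiffAt ℝ n X 0) (hn : n ≠ 0) (hX' : ∀ w, fderiv ℝ X 0 w = w.1 / 2) :
    ∀ᶠ ρ in 𝓝[>] (0 : ℝ), ∀ w, ‖w‖ < ρ → |X w| ≤ 3 / 4 * ‖w‖ := by
  filter_upwards [eventually_strict_bound hX hn (by norm_num : (0 : ℝ) < 1 / 4)] with ρ hρ w hw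
  have key := hρ w 0 hw (by rw [norm_zero]; exact (norm_nonneg _).trans_lt hw)
  rw [hX0, hX', sub_zero, sub_zero, abs_le] at key
  have h1 := abs_le.1 (norm_fst_le w)
  rw [abs_le]
  constructor <;> linarith [key.1, key.2, h1.1, h1.2]

theorem eventually_chart (h : FlipGerm k F) {X V : ℝ × ℝ → ℝ} {h₁ h₂ : ℝ → ℝ}
    (hR : ContDiffAt ℝ k FR 0) (ha : pdx FR 0 = a) (h0 : ∀ᶠ w in 𝓝 (0 : ℝ × ℝ), F (0, w) = FR (0, w))
    (hX0 : X 0 = 0) (hX : ContDiffAt ℝ k X 0) (hX' : ∀ w, fderiv ℝ X 0 w = w.1 / 2)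
    (hfix : ∀ᶠ w in 𝓝 (0 : ℝ × ℝ), F (X w, w) = X w)
    (hM : ContDiffAt ℝ ((k - 1 : ℕ) : WithTop ℕ∞) (fun w => pdx F (X w, w)) 0)
    (hM' : fderiv ℝ (fun w => pdx F (X w, w)) 0 (0, 1) = 1)
    (hh₁ : ∀ᶠ w in 𝓝 (0 : ℝ × ℝ), pdx F (X w, w) = -1 ↔ w.2 = h₁ w.1)
    (hV : ContDiffAt ℝ ((k - 1 : ℕ) : WithTop ℕ∞) V 0) (hV0 : V 0 = 0)
    (hV' : fderiv ℝ V 0 (0, 1) = 1)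
    (hFV : ∀ᶠ w in 𝓝 (0 : ℝ × ℝ), F (F (0, w), w) = w.1 * V w)
    (hh₂ : ∀ᶠ w in 𝓝 (0 : ℝ × ℝ), V w = 0 ↔ w.2 = h₂ w.1) (hκ : 0 < κ) (hκ' : κ ≤ 1 / 4) :
    ∀ᶠ ρ in 𝓝[>] (0 : ℝ), FlipChart F FR X V h₁ h₂ a (flipCoef F) κ ρ := by
  have cF : ∀ᶠ z in 𝓝 (0 : ℝ × ℝ × ℝ), ContinuousAt F z :=
    (h.smooth.eventually (by simp)).mono fun z hz => hz.continuousAt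
  have cX : ∀ᶠ w in 𝓝 (0 : ℝ × ℝ), ContinuousAt X w :=
    (hX.eventually (by simp)).mono fun w hw => hw.continuousAt
  have hnd : ∀ᶠ ρ in 𝓝[>] (0 : ℝ), flipCoef F ≠ 0 → ∀ z : ℝ × ℝ × ℝ, ‖z‖ < ρ →
      (1 / 2 : ℝ) * pdx (pdx F) z ^ 2 + (1 / 3 : ℝ) * pdx (pdx (pdx F)) z ≠ 0 :=
    eventually_imp_distrib_left.2 fun hc =>
      eventually_ball_of_eventually (h.eventually_nondegeneracy hc)
  have hcc : ∀ σ : ℝ, ∀ᶠ ρ in 𝓝[>] (0 : ℝ), 0 < σ * flipCoef F → ∀ w : ℝ × ℝ, ‖w‖ < ρ →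
      StrictConcaveOn ℝ (Ioo (-ρ) ρ) fun x => σ * pdx (iterTwo F) (x, w) := fun σ =>
    eventually_imp_distrib_left.2 fun hc => h.eventually_strictConcaveOn hc
  filter_upwards [h.eventually_flipMaps hR ha h0 hX0 hX hfix hV hV0 hFV hκ hκ',
    eventually_ball_of_eventually cF, eventually_ball_of_eventually cX, eventually_abs_fixed_le hX0 hX h.order_ne hX',
    h.eventually_abs_apply_zero_sub_le hκ,
    eventually_abs_sub_sub_le hM h.order_pred_ne hM' hh₁, eventually_ball_of_eventually hFV,
    eventually_abs_sub_sub_le hV h.order_pred_ne hV' hh₂,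
    eventually_ball_of_eventually h.eventually_transversality, hnd, hcc 1, hcc (-1)]
    with ρ c1 c2 c3 c3' c4 c5 c6 c7 c8 c9 c10 c11
  refine ⟨c1, c2, c3, c3', c4, fun μ η h1 h2 h3 => ?_, c6, fun μ η h1 h2 h3 => ?_, c8, c9, ?_⟩
  · simpa only [sub_neg_eq_add] using c5 μ η h1 h2 h3
  · simpa only [sub_zero] using c7 μ η h1 h2 h3
  · rintro σ (rfl | rfl)
    exacts [c10, c11]

end FlipGerm

/-! ### The choice of tolerance and the dynamics read off from the chart. -/

/-- The admissible size of the deviation of the half-maps from their linear parts, given the slope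
`a` of the right half-map. -/
structure FlipTolerance (a κ : ℝ) : Prop where
  pos : 0 < κ
  le : κ ≤ 1 / 4
  ne_neg_one : a ≠ -1 → 2 * (κ * (|a| + 2)) ≤ |a + 1|
  ne_neg_one' : a ≠ -1 → 4 * (κ * (|a| + 1)) ≤ |a + 1|
  ne_one : a ≠ 1 → 2 * κ ≤ |a - 1|
  stable : |a| < 1 → (1 + κ) * (|a| + κ) < 1
  unstable : 1 < |a| → 1 < (1 - κ) * (|a| - κ)
  neg : a < 0 → a + κ ≤ 0
  lt_one : 0 ≤ a → a < 1 → (1 + κ) * (a + κ) < 1 - κ - κ ^ 2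
  chaos : 1 < a → ∃ θ > 0, θ * (2 * (a + 1)) ≤ 1 / 2 ∧ 16 * κ ≤ θ ∧
    6 * κ * (2 * (a + 1) + 1) ≤ 1 ∧
    (1 + θ / 4) * (1 + 2 * θ) ≤ (1 - κ) * (a - κ) * (1 - θ * (2 * (a + 1)))

/-- Apart from positivity of κ and the chaos clause, each requirement holds strictly at κ = 0 and is
continuous in κ, so it holds for all small κ > 0. The chaos clause comes from
`exists_chaos_constants`. -/
theorem FlipTolerance.exists (a : ℝ) : ∃ κ, FlipTolerance a κ := by
  have key : ∀ {g : ℝ → ℝ} {v : ℝ}, Continuous g → g 0 < v → ∀ᶠ κ in 𝓝[>] (0 : ℝ), g κ < v :=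
    fun hg h0 => nhdsWithin_le_nhds (hg.continuousAt.eventually (gt_mem_nhds h0))
  have e0 : ∀ᶠ κ in 𝓝[>] (0 : ℝ), (0 : ℝ) < κ := self_mem_nhdsWithin
  have e1 : ∀ᶠ κ in 𝓝[>] (0 : ℝ), κ < 1 / 4 := key continuous_id (by norm_num)
  have e2 : ∀ᶠ κ in 𝓝[>] (0 : ℝ), a ≠ -1 → 2 * (κ * (|a| + 2)) < |a + 1| :=
    eventually_imp_distrib_left.2 fun ha => key (by fun_prop) (by
      simpa using fun h : a + 1 = 0 => ha (by linarith))
  have e3 : ∀ᶠ κ in 𝓝[>] (0 : ℝ), a ≠ -1 → 4 * (κ * (|a| + 1)) < |a + 1| :=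
    eventually_imp_distrib_left.2 fun ha => key (by fun_prop) (by
      simpa using fun h : a + 1 = 0 => ha (by linarith))
  have e4 : ∀ᶠ κ in 𝓝[>] (0 : ℝ), a ≠ 1 → 2 * κ < |a - 1| :=
    eventually_imp_distrib_left.2 fun ha => key (by fun_prop) (by simpa [sub_eq_zero] using ha)
  have e5 : ∀ᶠ κ in 𝓝[>] (0 : ℝ), |a| < 1 → (1 + κ) * (|a| + κ) < 1 :=
    eventually_imp_distrib_left.2 fun ha => key (by fun_prop) (by simpa using ha)
  have e6 : ∀ᶠ κ in 𝓝[>] (0 : ℝ), 1 < |a| → -((1 - κ) * (|a| - κ)) < -1 :=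
    eventually_imp_distrib_left.2 fun ha => key (by fun_prop) (by simpa using ha)
  have e7 : ∀ᶠ κ in 𝓝[>] (0 : ℝ), a < 0 → a + κ < 0 :=
    eventually_imp_distrib_left.2 fun ha => key (by fun_prop) (by simpa using ha)
  have e8 : ∀ᶠ κ in 𝓝[>] (0 : ℝ), 0 ≤ a → a < 1 → (1 + κ) * (a + κ) - (1 - κ - κ ^ 2) < 0 :=
    eventually_imp_distrib_left.2 fun _ => eventually_imp_distrib_left.2 fun ha =>
      key (by fun_prop) (by simpa using ha)
  have e9 : ∀ᶠ κ in 𝓝[>] (0 : ℝ), 1 < a → ∃ θ > 0, θ * (2 * (a + 1)) ≤ 1 / 2 ∧ 16 * κ ≤ θ ∧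
      6 * κ * (2 * (a + 1) + 1) ≤ 1 ∧
      (1 + θ / 4) * (1 + 2 * θ) ≤ (1 - κ) * (a - κ) * (1 - θ * (2 * (a + 1))) :=
    eventually_imp_distrib_left.2 fun ha => by
      obtain ⟨θ, hθ, κ₀, hκ₀, H⟩ := exists_chaos_constants ha
      filter_upwards [Ioo_mem_nhdsGT hκ₀] with κ hκ
      exact ⟨θ, hθ, H κ hκ.1 hκ.2.le⟩
  obtain ⟨κ, h0, h1, h2, h3, h4, h5, h6, h7, h8, h9⟩ := (e0.and (e1.and (e2.and (e3.and (e4.and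
    (e5.and (e6.and (e7.and (e8.and e9))))))))).exists
  exact ⟨κ, h0, h1.le, fun h => (h2 h).le, fun h => (h3 h).le, fun h => (h4 h).le, h5,
    fun h => by linarith [h6 h], fun h => (h7 h).le, fun h h' => by linarith [h8 h h'], h9⟩

theorem minimalPeriod_eq_two_iff {f : ℝ → ℝ} {x : ℝ} :
    Function.minimalPeriod f x = 2 ↔ f (f x) = x ∧ f x ≠ x :=
  Function.minimalPeriod_eq_prime_iff

namespace FlipChart

variable {F FR : ℝ × ℝ × ℝ → ℝ} {X V : ℝ × ℝ → ℝ} {h₁ h₂ : ℝ → ℝ} {a c κ ρ μ η ε δ : ℝ}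

theorem apply_zero_sign (h : FlipChart F FR X V h₁ h₂ a c κ ρ) (hκ : κ ≤ 1 / 4) (hμ : |μ| < ρ)
    (hη : |η| < ρ) : (0 < μ ↔ 0 < F (0, μ, η)) ∧ (μ < 0 ↔ F (0, μ, η) < 0) ∧
      |F (0, μ, η)| ≤ 5 / 4 * |μ| := by
  have h0 : |F (0, μ, η) - μ| ≤ κ * |μ| := h.apply_zero (μ, η) (norm_pair_lt.2 ⟨hμ, hη⟩)
  have h1 : κ * |μ| ≤ 1 / 4 * |μ| := mul_le_mul_of_nonneg_right hκ (abs_nonneg _)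
  obtain ⟨e1, e2⟩ := abs_sub_le_half_sign (h0.trans (by linarith [abs_nonneg μ]))
  refine ⟨e1, e2, ?_⟩
  have := abs_add_le (F (0, μ, η) - μ) μ
  rw [sub_add_cancel] at this
  linarith

theorem fixed_neg (h : FlipChart F FR X V h₁ h₂ a c κ ρ) (hκ : κ ≤ 1 / 4) (hμ : |μ| < ρ)
    (hη : |η| < ρ) (hX : |X (μ, η)| < ρ) (h0 : μ < 0) : X (μ, η) < 0 :=
  ((h.maps _ (norm_pair_lt.2 ⟨hμ, hη⟩)).fixed_neg_iff (by linarith) hX).2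
    ((h.apply_zero_sign hκ hμ hη).2.1.1 h0)

theorem return_coef_sign (h : FlipChart F FR X V h₁ h₂ a c κ ρ) (hμ : |μ| < ρ) (hη : |η| < ρ)
    (h2 : |h₂ μ| < ρ) : (h₂ μ < η ↔ 0 < V (μ, η)) ∧ (η < h₂ μ ↔ V (μ, η) < 0) := by
  obtain ⟨e1, e2⟩ := abs_sub_le_half_sign (h.return_coef μ η hμ hη h2)
  rw [sub_pos] at e1
  rw [sub_neg] at e2
  exact ⟨e1, e2⟩

theorem return_sign (h : FlipChart F FR X V h₁ h₂ a c κ ρ) (hμ : |μ| < ρ) (hη : |η| < ρ)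
    (h2 : |h₂ μ| < ρ) (h0 : μ < 0) : (h₂ μ < η ↔ F (F (0, μ, η), μ, η) < 0) ∧
      (η < h₂ μ ↔ 0 < F (F (0, μ, η), μ, η)) := by
  obtain ⟨e1, e2⟩ := h.return_coef_sign hμ hη h2
  have hF : F (F (0, μ, η), μ, η) = μ * V (μ, η) :=
    h.return_eq (μ, η) (norm_pair_lt.2 ⟨hμ, hη⟩)
  rw [hF, e1, e2]
  exact ⟨⟨fun h => mul_neg_of_neg_of_pos h0 h, fun h => pos_of_mul_neg_right h h0.le⟩,
    ⟨fun h => mul_pos_of_neg_of_neg h0 h, fun h => neg_of_mul_pos_right h h0.le⟩⟩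

theorem minimalPeriod_eq_two_iff (h : FlipChart F FR X V h₁ h₂ a c κ ρ) (hκ : κ ≤ 1 / 4)
    (hμ : |μ| < ρ) (hη : |η| < ρ) (h2 : |h₂ μ| < ρ) (h0 : μ ≠ 0) :
    Function.minimalPeriod (fun x => F (x, μ, η)) 0 = 2 ↔ η = h₂ μ := by
  obtain ⟨e1, e2⟩ := h.return_coef_sign hμ hη h2
  obtain ⟨s1, s2, -⟩ := h.apply_zero_sign hκ hμ hη
  have hF : F (F (0, μ, η), μ, η) = μ * V (μ, η) :=
    h.return_eq (μ, η) (norm_pair_lt.2 ⟨hμ, hη⟩)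
  have hne : F (0, μ, η) ≠ 0 := by
    rcases lt_or_gt_of_ne h0 with h0 | h0
    · exact (s2.1 h0).ne
    · exact (s1.1 h0).ne'
  rw [_root_.minimalPeriod_eq_two_iff, hF, mul_eq_zero, or_iff_right h0, and_iff_left hne]
  constructor
  · intro hV
    exact le_antisymm (not_lt.1 fun hc => (e1.1 hc).ne' hV) (not_lt.1 fun hc => (e2.1 hc).ne hV)
  · rintro rfl
    exact le_antisymm (not_lt.1 fun hc => (e1.2 hc).false) (not_lt.1 fun hc => (e2.2 hc).false)

theorem minimalPeriod_pw (h : FlipChart F FR X V h₁ h₂ a c κ ρ) (hκ : κ ≤ 1 / 4)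
    (hμ : |μ| < ρ) (h2 : |h₂ μ| < ρ) (h0 : μ < 0) :
    F (0, μ, h₂ μ) < 0 ∧ Function.minimalPeriod
      (pw (fun x => F (x, μ, h₂ μ)) fun x => FR (x, μ, h₂ μ)) 0 = 2 := by
  have hneg := (h.apply_zero_sign hκ hμ h2).2.1.1 h0
  refine ⟨hneg, ?_⟩
  have hL := (h.minimalPeriod_eq_two_iff hκ hμ h2 h2 h0.ne).2 rfl
  rw [_root_.minimalPeriod_eq_two_iff] at hL ⊢
  rwa [pw_of_nonpos le_rfl, pw_of_nonpos hneg.le]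

theorem sectorPicture (h : FlipChart F FR X V h₁ h₂ a c κ ρ) (hκ : FlipTolerance a κ)
    (hε : ε ≤ ρ) (hδ : 3 * δ ≤ ε) (hδ' : 3 * δ ≤ |a - 1| * ε) (hμ : |μ| < δ) (hη : |η| < δ)
    (h1 : |h₁ μ| < ε) (h2 : |h₂ μ| < ε) (hX : |X (μ, η)| < δ) (ha : a ≠ 1) (ha' : a ≠ -1)
    (hc : c ≠ 0) :
    SectorPicture (pw (fun x => F (x, μ, η)) fun x => FR (x, μ, η)) ε μ η (h₁ μ) (h₂ μ) a c := by
  have hδ0 : 0 < δ := (abs_nonneg _).trans_lt hμ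
  have hμρ : |μ| < ρ := by linarith
  have hηρ : |η| < ρ := by linarith
  have hw := norm_pair_lt.2 ⟨hμρ, hηρ⟩
  obtain ⟨s1, s2, s3⟩ := h.apply_zero_sign hκ.le hμρ hηρ
  obtain ⟨m1, m2⟩ := h.multiplier_sign hμρ hηρ (h1.trans_le hε)
  have hret := h.return_sign hμρ hηρ (h2.trans_le hε)
  exact (h.maps _ hw).sectorPicture hκ.pos hκ.le ha ha' (hκ.ne_neg_one ha') (hκ.ne_neg_one' ha')
    (hκ.ne_one ha) hκ.stable hκ.unstable hε (by linarith) (by linarith) (by linarith) hc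
    (fun hc => h.concave 1 (Or.inl rfl) (by linarith) _ hw)
    (fun hc => h.concave (-1) (Or.inr rfl) (by linarith) _ hw) s2.symm s1.symm m1 m2
    (fun h0 => (hret h0).1) fun h0 => (hret h0).2

theorem not_hasCycleWithin (h : FlipChart F FR X V h₁ h₂ a c κ ρ) (hκ : FlipTolerance a κ)
    (hε : ε ≤ ρ) (hδ : 3 * δ ≤ ε) (hμ : |μ| < δ) (hη : |η| < δ) (h2 : |h₂ μ| < ε)
    (hcase : a < 1 ∨ 0 ≤ μ ∨ h₂ μ ≤ η) {n : ℕ} (hn : 3 ≤ n) :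
    ¬ HasCycleWithin (pw (fun x => F (x, μ, η)) fun x => FR (x, μ, η)) n ε := by
  have hδ0 : 0 < δ := (abs_nonneg _).trans_lt hμ
  have hμρ : |μ| < ρ := by linarith
  have hηρ : |η| < ρ := by linarith
  have hm := h.maps _ (norm_pair_lt.2 ⟨hμρ, hηρ⟩)
  obtain ⟨s1, s2, s3⟩ := h.apply_zero_sign hκ.le hμρ hηρ
  have hκ4 := hκ.le
  have hL := hm.secL.mono hε
  have hR := hm.secR.mono hε
  have hcε : |F (0, μ, η)| < ε := by linarith
  rcases lt_or_ge a 0 with ha | ha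
  · exact not_hasCycleWithin_of_neg hL hR hm.zero_eq (by linarith) (hκ.neg ha) hn
  rcases lt_or_ge a 1 with ha1 | ha1
  · refine not_hasCycleWithin_of_lt_one hL hR hm.zero_eq hκ.pos hκ.le ha le_rfl (hκ.lt_one ha ha1)
      hcε (fun h0 => ?_) hn
    have := hm.return_le
    rw [abs_of_neg h0] at this
    exact (le_abs_self _).trans this
  · refine not_hasCycleWithin_of_pos hL hR hm.zero_eq (by linarith) (by linarith) hcε ?_ hn
    rcases hcase with h' | h' | h'
    · linarith
    · exact Or.inl (not_lt.1 fun hc => not_lt.2 h' (s2.2 hc))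
    · rcases lt_or_ge μ 0 with h0 | h0
      · exact Or.inr (not_lt.1 fun hc =>
          not_lt.2 h' ((h.return_sign hμρ hηρ (h2.trans_le hε) h0).2.2 hc))
      · exact Or.inl (not_lt.1 fun hc => not_lt.2 h0 (s2.2 hc))

theorem exhibitsChaosWithin (h : FlipChart F FR X V h₁ h₂ a c κ ρ) (hκ : FlipTolerance a κ)
    (hε : ε ≤ ρ) (hδ : 3 * δ ≤ ε) (hμ : |μ| < δ) (hη : |η| < δ) (h2 : |h₂ μ| < ε)
    (ha : 1 < a) (h0 : μ < 0) (hη₂ : η < h₂ μ) :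
    ExhibitsChaosWithin (pw (fun x => F (x, μ, η)) fun x => FR (x, μ, η)) ε := by
  have hδ0 : 0 < δ := (abs_nonneg _).trans_lt hμ
  have hμρ : |μ| < ρ := by linarith
  have hηρ : |η| < ρ := by linarith
  have hm := h.maps _ (norm_pair_lt.2 ⟨hμρ, hηρ⟩)
  obtain ⟨-, s2, s3⟩ := h.apply_zero_sign hκ.le hμρ hηρ
  have hneg := s2.1 h0
  have hpos := (h.return_sign hμρ hηρ (h2.trans_le hε) h0).2.1 hη₂
  obtain ⟨θ, hθ, c1, c2, c3, c4⟩ := hκ.chaos ha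
  have hret := hm.return_le
  rw [abs_of_neg hneg] at s3
  rw [abs_of_neg hneg, abs_of_pos hpos] at hret
  refine exhibitsChaosWithin_pw (hm.secL.mono hε) (hm.secR.mono hε) hm.zero_eq ha hκ.pos hθ c1 c2
    c3 c4 hpos ?_ (by linarith)
  -- The return is at most κ |F(0)|, which is small enough to keep the two exchanged intervals
  -- disjoint.
  have h3 : (2 * (2 * (a + 1)) + 1) * (κ * -F (0, μ, η)) ≤ -F (0, μ, η) := by
    have hk := hκ.pos
    have : (2 * (2 * (a + 1)) + 1) * κ ≤ 1 := by nlinarith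
    nlinarith
  exact (mul_le_mul_of_nonneg_left hret (by linarith)).trans h3

end FlipChart

/-! ### Assembly of the main theorem. -/

theorem IsBorderFlipFamily.flipGerm {k : ℕ} (hk : 3 ≤ k) {fL fR : ℝ → ℝ → ℝ → ℝ}
    (hf : IsBorderFlipFamily k fL fR) :
    FlipGerm k fun z : ℝ × ℝ × ℝ => fL z.1 z.2.1 z.2.2 := by
  have hk0 : (k : WithTop ℕ∞) ≠ 0 := by exact_mod_cast (by omega : k ≠ 0)
  refine ⟨hf.smooth_left, hk, ?_, hf.singularity, ?_, ?_⟩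
  · have hc : Tendsto (fun η : ℝ => ((0 : ℝ), η)) (𝓝 0) (𝓝 0) :=
      Continuous.tendsto (by fun_prop) _
    filter_upwards [hc.eventually hf.const_left] with η hη
    simpa using hη
  · have hb := hf.nondegeneracy
    rw [bCoef, dslope_same] at hb
    have hd : DifferentiableAt ℝ (fun m => fL 0 m 0) 0 :=
      DifferentiableAt.comp (f := fun m : ℝ => ((0 : ℝ), m, (0 : ℝ))) (0 : ℝ)
        (hf.smooth_left.differentiableAt hk0) (by fun_prop)
    have := hd.hasDerivAt
    rwa [hb] at this
  · have hb := hf.transversality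
    have := (differentiableAt_of_deriv_ne_zero (by rw [hb]; exact one_ne_zero)).hasDerivAt
    rwa [hb] at this

theorem flipCoef_eq_c0Coef (fL : ℝ → ℝ → ℝ → ℝ) :
    flipCoef (fun z : ℝ × ℝ × ℝ => fL z.1 z.2.1 z.2.2) = c0Coef fL := by
  simp only [c0Coef, pCoef, qCoef, iteratedDeriv_succ, iteratedDeriv_zero]
  rfl

theorem theorem1 (k : ℕ) (hk : 3 ≤ k) (fL fR : ℝ → ℝ → ℝ → ℝ)
    (hf : IsBorderFlipFamily k fL fR) :
    ∃ (xs : ℝ → ℝ → ℝ) (h₁ h₂ : ℝ → ℝ) (r : ℝ), 0 < r ∧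
      -- regularity and expansions
      ContDiffOn ℝ k (fun w : ℝ × ℝ => xs w.1 w.2) (Ioo (-r) r ×ˢ Ioo (-r) r) ∧
      (fun w : ℝ × ℝ => xs w.1 w.2 - w.1 / 2) =O[𝓝 0] (fun w : ℝ × ℝ => ‖w‖ ^ 2) ∧
      ContDiffOn ℝ ((k - 1 : ℕ) : WithTop ℕ∞) h₁ (Ioo (-r) r) ∧
      ContDiffOn ℝ ((k - 1 : ℕ) : WithTop ℕ∞) h₂ (Ioo (-r) r) ∧
      (fun μ => h₁ μ - -(deriv (fun m => aCoef fL m 0) 0 + pCoef fL 0 0) * μ)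
        =O[𝓝 0] (fun μ : ℝ => μ ^ 2) ∧
      (fun μ => h₂ μ - (h₁ μ - c0Coef fL / 4 * μ ^ 2)) =o[𝓝 0] (fun μ : ℝ => μ ^ 2) ∧
      -- local uniqueness of the two curves
      (∀ g : ℝ → ℝ, g 0 = 0 → ContinuousAt g 0 →
        (∀ᶠ μ in 𝓝 0, deriv (fun x => fL x μ (g μ)) (xs μ (g μ)) = -1) → g =ᶠ[𝓝 0] h₁) ∧
      (∀ g : ℝ → ℝ, g 0 = 0 → ContinuousAt g 0 →
        (∀ᶠ μ in 𝓝[≠] 0, Function.minimalPeriod (fun x => fL x μ (g μ)) 0 = 2) →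
          g =ᶠ[𝓝 0] h₂) ∧
      -- the local dynamics, in every small enough neighbourhood of the origin
      ∀ ε, 0 < ε → ε ≤ r → ∃ δ, 0 < δ ∧ δ ≤ ε ∧
        (∀ μ, |μ| < δ → |h₁ μ| < ε ∧ |h₂ μ| < ε) ∧
        -- the fixed point of the left half-map
        (∀ μ η, |μ| < δ → |η| < δ → |xs μ η| < δ ∧
          ∀ x, |x| < ε → (fL x μ η = x ↔ x = xs μ η)) ∧
        -- period-doubling along `h₁`
        (∀ μ η, |μ| < δ → |η| < δ →
          (deriv (fun x => fL x μ η) (xs μ η) = -1 ↔ η = h₁ μ)) ∧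
        (∀ μ, |μ| < δ → fL (xs μ (h₁ μ)) μ (h₁ μ) = xs μ (h₁ μ) ∧
          deriv (fun x => fL x μ (h₁ μ)) (xs μ (h₁ μ)) = -1) ∧
        (∀ μ, -δ < μ → μ < 0 → xs μ (h₁ μ) < 0 ∧
          (c0Coef fL ≠ 0 →
            IsPeriodDoubling (fun x η => pwMap fL fR μ η x) (xs μ (h₁ μ)) (h₁ μ))) ∧
        -- the period-two orbit through the switching point along `h₂`
        (∀ μ η, |μ| < δ → |η| < δ → μ ≠ 0 →
          (Function.minimalPeriod (fun x => fL x μ η) 0 = 2 ↔ η = h₂ μ)) ∧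
        (∀ μ, |μ| < δ → μ ≠ 0 → Function.minimalPeriod (fun x => fL x μ (h₂ μ)) 0 = 2) ∧
        (∀ μ, -δ < μ → μ < 0 → fL 0 μ (h₂ μ) < 0 ∧
          Function.minimalPeriod (pwMap fL fR μ (h₂ μ)) 0 = 2) ∧
        -- fixed points and two-cycles of the piecewise map
        (aCoef fR 0 0 ≠ 1 → aCoef fR 0 0 ≠ -1 → c0Coef fL ≠ 0 →
          ∀ μ η, |μ| < δ → |η| < δ →
            SectorPicture (pwMap fL fR μ η) ε μ η (h₁ μ) (h₂ μ) (aCoef fR 0 0) (c0Coef fL)) ∧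
        -- absence of longer cycles
        (∀ μ η, |μ| < δ → |η| < δ → (aCoef fR 0 0 < 1 ∨ 0 ≤ μ ∨ h₂ μ ≤ η) →
          ∀ n, 3 ≤ n → ¬ HasCycleWithin (pwMap fL fR μ η) n ε) ∧
        -- chaos
        (1 < aCoef fR 0 0 → ∀ μ η, |μ| < δ → |η| < δ → μ < 0 → η < h₂ μ →
          ExhibitsChaosWithin (pwMap fL fR μ η) ε) := by
  set F : ℝ × ℝ × ℝ → ℝ := fun z => fL z.1 z.2.1 z.2.2 with hF
  set FR : ℝ × ℝ × ℝ → ℝ := fun z => fR z.1 z.2.1 z.2.2 with hFR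
  have hg : FlipGerm k F := hf.flipGerm hk
  have hp : pCoef fL 0 0 = pdx (pdx F) 0 / 2 := by
    rw [pCoef, iteratedDeriv_succ, iteratedDeriv_one]
    rfl
  rw [← flipCoef_eq_c0Coef, hp]
  obtain ⟨X, hX0, hX, -, hfix, hXη, hX'⟩ := hg.exists_fixed
  obtain ⟨hM, hM', h₁, h₁0, h₁s, h₁M, h₁O⟩ := hg.exists_multiplier_curve hX0 hX hXη hX'
  obtain ⟨V, hV, hV0, hV', hFV, h₂, h₂0, h₂s, h₂V⟩ := hg.exists_return_curve
  have h0 : ∀ᶠ w in 𝓝 (0 : ℝ × ℝ), F (0, w) = FR (0, w) := by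
    filter_upwards [hf.const_left, hf.const_right] with w e1 e2 using e1.trans e2.symm
  obtain ⟨κ, hκ⟩ := FlipTolerance.exists (aCoef fR 0 0)
  have hκ1 : κ < 1 := hκ.le.trans_lt (by norm_num)
  have smooth : ∀ {n : ℕ} {g : ℝ → ℝ}, ContDiffAt ℝ n g 0 →
      ∀ᶠ r in 𝓝[>] (0 : ℝ), ∀ x, ‖x‖ < r → ContDiffAt ℝ n g x := fun hg =>
    eventually_ball_of_eventually (hg.eventually (by simp))
  -- One radius r serves for the smoothness and the chart; every ε ≤ r then uses the same chart.
  obtain ⟨r, hr, hX_s, h₁_s, h₂_s, hch⟩ := ((eventually_mem_nhdsWithin (a := (0 : ℝ))).and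
    ((eventually_ball_of_eventually (hX.eventually (by simp))).and ((smooth h₁s).and
      ((smooth h₂s).and (hg.eventually_chart hf.smooth_right (a := aCoef fR 0 0) rfl h0 hX0 hX hX'
        hfix hM hM' h₁M hV hV0 hV' hFV h₂V hκ.pos hκ.le))))).exists
  refine ⟨fun μ η => X (μ, η), h₁, h₂, r, hr, ?_, ?_, ?_, ?_, h₁O,
    hg.isLittleO_curves hX0 hX hX' hfix hV hV0 hV' hFV h₁0 h₁s h₁M h₂0 h₂s h₂V, ?_, ?_, ?_⟩
  · intro w hw
    exact (hX_s w (norm_pair_lt.2 ⟨abs_lt.2 hw.1, abs_lt.2 hw.2⟩)).contDiffWithinAt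
  · have h2k : (2 : WithTop ℕ∞) ≤ k := by exact_mod_cast FlipGerm.natCast_le (by omega : 2 ≤ k)
    refine (isBigO_taylor_two (hX.of_le h2k)).congr_left fun w => ?_
    rw [hX0, hX', sub_zero]
  · exact fun μ hμ => (h₁_s μ (abs_lt.2 hμ)).contDiffWithinAt
  · exact fun μ hμ => (h₂_s μ (abs_lt.2 hμ)).contDiffWithinAt
  · intro g g0 gc hgM
    have hgt : Tendsto (fun μ => (μ, g μ)) (𝓝 0) (𝓝 (0 : ℝ × ℝ)) := by
      have := gc.tendsto
      rw [g0] at this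
      exact tendsto_id.prodMk_nhds this
    filter_upwards [hgM, hgt.eventually h₁M] with μ e1 e2 using e2.1 e1
  · intro g g0 gc hgM
    have hgt : Tendsto (fun μ => (μ, g μ)) (𝓝 0) (𝓝 (0 : ℝ × ℝ)) := by
      have := gc.tendsto
      rw [g0] at this
      exact tendsto_id.prodMk_nhds this
    filter_upwards [eventually_nhdsWithin_iff.1 hgM, hgt.eventually h₂V, hgt.eventually hFV]
      with μ e1 e2 e3
    by_cases hμ : μ = 0
    · rw [hμ, g0, h₂0]
    · refine e2.1 ((mul_eq_zero.1 (e3.symm.trans ?_)).resolve_left hμ)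
      exact (minimalPeriod_eq_two_iff.1 (e1 hμ)).1
  intro ε hε hεr
  have lim : ∀ {g : ℝ → ℝ} {n : ℕ}, ContDiffAt ℝ n g 0 → g 0 = 0 →
      ∀ᶠ δ in 𝓝[>] (0 : ℝ), ∀ μ : ℝ, ‖μ‖ < δ → |g μ| < ε := fun hgs hg0 =>
    eventually_ball_of_eventually
      (hgs.continuousAt.abs.eventually (gt_mem_nhds (by simpa [hg0] using hε)))
  have small : ∀ {v : ℝ}, 0 < v → ∀ᶠ δ in 𝓝[>] (0 : ℝ), 3 * δ ≤ v := fun {v} hv => by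
    filter_upwards [Ioo_mem_nhdsGT (by linarith : 0 < v / 3)] with δ hδ
    linarith [hδ.2]
  have small' : ∀ᶠ δ in 𝓝[>] (0 : ℝ), aCoef fR 0 0 ≠ 1 → 3 * δ ≤ |aCoef fR 0 0 - 1| * ε :=
    eventually_imp_distrib_left.2 fun ha => small (mul_pos (abs_pos.2 (sub_ne_zero.2 ha)) hε)
  -- Since |F(0, μ, η)| ≤ 5 / 4 |μ|, the bound 3 δ ≤ ε gives 2 |F(0, μ, η)| < ε. The bound with |a₀
  -- - 1| keeps the right fixed point within ε.
  obtain ⟨δ, hδ0, hδ1, hδ2, hδ, hδ'⟩ := ((eventually_mem_nhdsWithin (a := (0 : ℝ))).and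
    ((lim h₁s h₁0).and ((lim h₂s h₂0).and ((small hε).and small')))).exists
  replace hδ0 : 0 < δ := hδ0
  have hδε : δ ≤ ε := by linarith
  have hlt : ∀ {t : ℝ}, |t| < δ → |t| < r := fun ht => ht.trans_le (hδε.trans hεr)
  have b₁ : ∀ {μ : ℝ}, |μ| < δ → |h₁ μ| < r := fun hμ => (hδ1 _ hμ).trans_le hεr
  have b₂ : ∀ {μ : ℝ}, |μ| < δ → |h₂ μ| < r := fun hμ => (hδ2 _ hμ).trans_le hεr
  have hXr : ∀ {μ η : ℝ}, |μ| < r → |η| < r → |X (μ, η)| < r := fun {μ η} h1 h2 => by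
    have hw := norm_pair_lt.2 ⟨h1, h2⟩
    linarith [hch.abs_fixed_le (μ, η) hw, norm_nonneg (μ, η)]
  have hXδ : ∀ {μ η : ℝ}, |μ| < δ → |η| < δ → |X (μ, η)| < δ := fun {μ η} h1 h2 => by
    have hw := norm_pair_lt.2 ⟨h1, h2⟩
    linarith [hch.abs_fixed_le (μ, η) (norm_pair_lt.2 ⟨hlt h1, hlt h2⟩), norm_nonneg (μ, η)]
  have neg : ∀ {μ : ℝ}, -δ < μ → μ < 0 → |μ| < δ := fun h1 h2 => abs_lt.2 ⟨h1, h2.trans hδ0⟩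
  refine ⟨δ, hδ0, hδε, fun μ hμ => ⟨hδ1 μ hμ, hδ2 μ hμ⟩, fun μ η hμ hη => ⟨hXδ hμ hη, ?_⟩,
    fun μ η hμ hη => hch.multiplier_eq_iff (hlt hμ) (hlt hη) (b₁ hμ), fun μ hμ => ⟨?_, ?_⟩,
    fun μ hμ h0 => ⟨?_, fun hc => ?_⟩,
    fun μ η hμ hη h0 => hch.minimalPeriod_eq_two_iff hκ.le (hlt hμ) (hlt hη) (b₂ hμ) h0,
    fun μ hμ h0 => (hch.minimalPeriod_eq_two_iff hκ.le (hlt hμ) (b₂ hμ) (b₂ hμ) h0).2 rfl,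
    fun μ hμ h0 => hch.minimalPeriod_pw hκ.le (hlt (neg hμ h0)) (b₂ (neg hμ h0)) h0,
    fun ha ha' hc μ η hμ hη => hch.sectorPicture hκ hεr hδ (hδ' ha) hμ hη (hδ1 μ hμ) (hδ2 μ hμ)
      (hXδ hμ hη) ha ha' hc,
    fun μ η hμ hη hcase n hn => hch.not_hasCycleWithin hκ hεr hδ hμ hη (hδ2 μ hμ) hcase hn,
    fun ha μ η hμ hη h0 hη₂ => hch.exhibitsChaosWithin hκ hεr hδ hμ hη (hδ2 μ hμ) ha h0 hη₂⟩
  · have hm := hch.maps _ (norm_pair_lt.2 ⟨hlt hμ, hlt hη⟩)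
    intro x hx
    constructor
    · exact hm.eq_fixed hκ1 (hlt (hXδ hμ hη)) (hx.trans_le hεr)
    · rintro rfl
      exact hm.fixed
  · exact (hch.maps _ (norm_pair_lt.2 ⟨hlt hμ, b₁ hμ⟩)).fixed
  · exact (hch.multiplier_eq_iff (hlt hμ) (b₁ hμ) (b₁ hμ)).2 rfl
  · exact hch.fixed_neg hκ.le (hlt (neg hμ h0)) (b₁ (neg hμ h0))
      (hXr (hlt (neg hμ h0)) (b₁ (neg hμ h0))) h0
  · have hκ2 : κ ≤ 1 / 2 := hκ.le.trans (by norm_num)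
    have hμ' := hlt (neg hμ h0)
    have hX1 := hXr hμ' (b₁ (neg hμ h0))
    exact hch.isPeriodDoubling hκ.pos hκ2 hc hμ' (b₁ (neg hμ h0)) hX1
      (hch.fixed_neg hκ.le hμ' (b₁ (neg hμ h0)) hX1 h0)
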